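/- **Theorem (First variation formula).** Let $(M,\omega)$ be a connected symplectic manifold without boundary (Hausdorff, second countable, finite-dimensional, smooth, not necessarily compact), and let $X_f$ denote the vector field with $\omega(X_f,\cdot)=df$. Let $\mathrm{Ham}^c(M)$ be the group of compactly supported Hamiltonian symplectomorphisms. For a $C^\infty$ path $\psi=\{\psi_t\}_{t\in[0,1]}$ in $\mathrm{Ham}^c(M)$ (not necessarily starting at the identity), a *generating Hamiltonian* is a smooth family of functions $H_t$, $0\le t\le 1$, on $M$, supported in a common compact set, with $\frac{d}{dt}\psi_t(x)=X_{H_t}(\psi_t(x))$ for all $t,x$; it is unique up to adding a function of $t$ alone. The Hofer length of $\psi$ is $\mathcal L(\psi)=\int_0^1(\sup_M H_t-\inf_M H_t)\,dt$. Write $\mathrm{maxset}\,f=\{x: f(x)=\max f\}$ and $\mathrm{minset}\,f=\{x: f(x)=\min f\}$. Let $\gamma=\{\phi_t\}_{t\in[0,1]}$ be a $C^\infty$ path in $\mathrm{Ham}^c(M)$ with generating Hamiltonian $H_t$. A *tangent vector field* along $\gamma$ (vanishing at both ends) is a smooth family of functions $G_t$, $0\le t\le1$, on $M$, supported in a common compact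 set, with $G_0=G_1=0$. For such $G$ and $\varepsilon\in\mathbb R$ put $\gamma_\varepsilon(t)=\phi_{\varepsilon G_t}\circ\phi_t$, where, for each fixed $t$, $\phi_{\varepsilon G_t}$ is the time-1 map of the flow of $X_{\varepsilon G_t}$; then $\gamma_\varepsilon$ is again a $C^\infty$ path in $\mathrm{Ham}^c(M)$. Let $K_{\varepsilon,t}$ be its generating Hamiltonian and let $G'_t=\frac{d}{dt}G_t$. Assume that $\gamma$ satisfies the *hypothesis of continuity*: for every tangent vector field $G$ there are $\varepsilon_0>0$ and points $p_t(\varepsilon)\in\mathrm{minset}\,K_{\varepsilon,t}$, $P_t(\varepsilon)\in\mathrm{maxset}\,K_{\varepsilon,t}$, defined for all $t\in[0,1]$ and $|\varepsilon|<\varepsilon_0$, such that for each $t$ the maps $\varepsilon\mapsto p_t(\varepsilon)$ and $\varepsilon\mapsto P_t(\varepsilon)$ are smooth. Then, for every tangent vector field $G$ along $\gamma$, the function $t\mapsto \sup_{\mathrm{maxset}\,H_t}G'_t-\inf_{\mathrm{minset}\,H_t}G'_t$ is integrable on $[0,1]$, the function $\varepsilon\mapsto\mathcal L(\gamma_\varepsilon)$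 is differentiable at $\varepsilon=0$, and $$\frac{d}{d\varepsilon}\Big|_{\varepsilon=0}\mathcal L(\gamma_\varepsilon)=\int_0^1\Big(\sup_{\mathrm{maxset}\,H_t}G'_t-\inf_{\mathrm{minset}\,H_t}G'_t\Big)\,dt .$$ -/

import Mathlib

open Set
open scoped Manifold ContDiff Topology

noncomputable section

namespace HoferVariation

variable {E : Type*} [NormedAddCommGroup E] [NormedSpace ℝ E]
  {M : Type*} [TopologicalSpace M] [ChartedSpace E M]

/-- The local expression, in the preferred chart at `x₀`, of a field of bilinear forms on the
tangent spaces of `M`: its pullback to (an open subset of) the model space `E` by the inverse of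
the chart. -/
def chartForm (Ω : ∀ x : M, TangentSpace 𝓘(ℝ, E) x →L[ℝ] TangentSpace 𝓘(ℝ, E) x →L[ℝ] ℝ)
    (x₀ : M) (y : E) : E →L[ℝ] E →L[ℝ] ℝ :=
  let D : E →L[ℝ] E :=
    mfderiv 𝓘(ℝ, E) 𝓘(ℝ, E) (extChartAt 𝓘(ℝ, E) x₀).symm y
  let B : E →L[ℝ] E →L[ℝ] ℝ := Ω ((extChartAt 𝓘(ℝ, E) x₀).symm y)
  B.bilinearComp D D

variable (E M) in
/-- A symplectic form on a manifold `M` without boundary, modelled on `E`: a smooth, closed,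
non-degenerate differential 2-form. Smoothness and closedness are expressed in charts; the cyclic
sum in `closed'` is the value of the exterior derivative of the local expression on `u, v, w`. -/
structure SymplecticForm where
  /-- the alternating bilinear form on each tangent space -/
  form : ∀ x : M, TangentSpace 𝓘(ℝ, E) x →L[ℝ] TangentSpace 𝓘(ℝ, E) x →L[ℝ] ℝ
  alternating' : ∀ (x : M) (v : TangentSpace 𝓘(ℝ, E) x), form x v v = 0
  nondegenerate' : ∀ (x : M) (v : TangentSpace 𝓘(ℝ, E) x), (∀ w, form x v w = 0) → v = 0
  smooth' : ∀ x₀ : M, ContDiffOn ℝ ∞ (chartForm form x₀) (extChartAt 𝓘(ℝ, E) x₀).target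
  closed' : ∀ x₀ : M, ∀ y ∈ (extChartAt 𝓘(ℝ, E) x₀).target, ∀ u v w : E,
    fderiv ℝ (chartForm form x₀) y u v w + fderiv ℝ (chartForm form x₀) y v w u +
      fderiv ℝ (chartForm form x₀) y w u v = 0

theorem SymplecticForm.exists_dual [FiniteDimensional ℝ E] (Ω : SymplecticForm E M) (x : M)
    (α : TangentSpace 𝓘(ℝ, E) x →L[ℝ] ℝ) :
    ∃ X : TangentSpace 𝓘(ℝ, E) x, Ω.form x X = α := by
  let B : E →L[ℝ] E →L[ℝ] ℝ := Ω.form x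
  have hinj : Function.Injective ((ContinuousLinearMap.coeLM ℝ).comp B.toLinearMap :
      E →ₗ[ℝ] (E →ₗ[ℝ] ℝ)) := by
    rw [← LinearMap.ker_eq_bot, LinearMap.ker_eq_bot']
    intro v hv
    exact Ω.nondegenerate' x v fun w => LinearMap.congr_fun hv w
  have hdim : Module.finrank ℝ E = Module.finrank ℝ (E →ₗ[ℝ] ℝ) :=
    (Subspace.dual_finrank_eq (K := ℝ) (V := E)).symm
  let β : E →L[ℝ] ℝ := α
  obtain ⟨X, hX⟩ :=
    (LinearMap.injective_iff_surjective_of_finrank_eq_finrank hdim).1 hinj β.toLinearMap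
  exact ⟨X, ContinuousLinearMap.ext fun w => LinearMap.congr_fun hX w⟩

variable [FiniteDimensional ℝ E]

/-- The Hamiltonian vector field (symplectic gradient) `X_f` of a function `f`, determined by
`ω(X_f, ·) = df`. -/
def hamField (Ω : SymplecticForm E M) (f : M → ℝ) (x : M) : TangentSpace 𝓘(ℝ, E) x :=
  Classical.choose (Ω.exists_dual x (mfderiv 𝓘(ℝ, E) 𝓘(ℝ, ℝ) f x))

theorem form_hamField (Ω : SymplecticForm E M) (f : M → ℝ) (x : M)
    (v : TangentSpace 𝓘(ℝ, E) x) :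
    Ω.form x (hamField Ω f x) v = mfderiv 𝓘(ℝ, E) 𝓘(ℝ, ℝ) f x v :=
  DFunLike.congr_fun
    (Classical.choose_spec (Ω.exists_dual x (mfderiv 𝓘(ℝ, E) 𝓘(ℝ, ℝ) f x))) v

variable (E) in
/-- A smooth family `F_t`, `0 ≤ t ≤ 1`, of functions on `M` supported in a common compact set. -/
structure IsTimeDepHamiltonian (F : ℝ → M → ℝ) : Prop where
  smooth : ContMDiffOn (𝓘(ℝ, ℝ).prod 𝓘(ℝ, E)) 𝓘(ℝ, ℝ) ∞ (fun q : ℝ × M => F q.1 q.2)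
    (Icc 0 1 ×ˢ univ)
  compactSupport : ∃ K : Set M, IsCompact K ∧ ∀ t ∈ Icc (0 : ℝ) 1, ∀ x ∉ K, F t x = 0

/-- `H` is a generating Hamiltonian of the smooth path of maps `φ_t`, `0 ≤ t ≤ 1`:
`d/dt φ_t(x) = X_{H_t}(φ_t(x))` for all `x` and all `t ∈ [0,1]`, with one-sided derivatives at the
endpoints. -/
structure Generates (Ω : SymplecticForm E M) (H : ℝ → M → ℝ) (φ : ℝ → M → M) : Prop where
  smooth : ContMDiffOn (𝓘(ℝ, ℝ).prod 𝓘(ℝ, E)) 𝓘(ℝ, E) ∞ (fun q : ℝ × M => φ q.1 q.2)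
    (Icc 0 1 ×ˢ univ)
  hamiltonian : IsTimeDepHamiltonian E H
  ode : ∀ t ∈ Icc (0 : ℝ) 1, ∀ x : M,
    HasMFDerivWithinAt 𝓘(ℝ, ℝ) 𝓘(ℝ, E) (fun s => φ s x) (Icc 0 1) t
      ((1 : ℝ →L[ℝ] ℝ).smulRight (hamField Ω (H t) (φ t x)))

/-- Membership in the group `Ham^c(M)` of compactly supported Hamiltonian symplectomorphisms. -/
def IsHamiltonianDiffeo (Ω : SymplecticForm E M) (f : M → M) : Prop :=
  ∃ (H : ℝ → M → ℝ) (φ : ℝ → M → M), Generates Ω H φ ∧ φ 0 = id ∧ φ 1 = f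

/-- A smooth path `φ_t`, `0 ≤ t ≤ 1`, in `Ham^c(M)`, not necessarily starting at the identity. -/
def IsHamiltonianPath (Ω : SymplecticForm E M) (φ : ℝ → M → M) : Prop :=
  IsHamiltonianDiffeo Ω (φ 0) ∧ ∃ H, Generates Ω H φ

open Classical in
/-- The generating Hamiltonian of a path in `Ham^c(M)`. For connected `M` it is unique up to
adding a function of `t` alone, on which nothing below depends. (It is `0` by convention for
families of maps that have no generating Hamiltonian.) -/
def generatingHamiltonian (Ω : SymplecticForm E M) (φ : ℝ → M → M) : ℝ → M → ℝ :=
  if h : ∃ H, Generates Ω H φ then Classical.choose h else 0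

/-- Total variation (oscillation) of a function. -/
def totVar (f : M → ℝ) : ℝ := (⨆ x, f x) - ⨅ x, f x

/-- The Hofer length of a path in `Ham^c(M)`. -/
def hoferLength (Ω : SymplecticForm E M) (φ : ℝ → M → M) : ℝ :=
  ∫ t in (0 : ℝ)..1, totVar (generatingHamiltonian Ω φ t)

/-- The set of points where `f` attains its maximum. -/
def maxset (f : M → ℝ) : Set M := {x | ∀ y, f y ≤ f x}

/-- The set of points where `f` attains its minimum. -/
def minset (f : M → ℝ) : Set M := {x | ∀ y, f x ≤ f y}

open Classical in
/-- The flow of an autonomous (complete) vector field on `M`; points without a global integral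
curve are fixed by convention. -/
def flow (X : ∀ x : M, TangentSpace 𝓘(ℝ, E) x) (s : ℝ) (x : M) : M :=
  if h : ∃ γ : ℝ → M, γ 0 = x ∧ IsMIntegralCurve (I := 𝓘(ℝ, E)) γ X then
    Classical.choose h s else x

variable (E) in
/-- A tangent vector field along a path `φ_t`, vanishing at both ends: a smooth compactly supported
family of functions `G_t`, `0 ≤ t ≤ 1`, with `G_0 = G_1 = 0`. -/
structure IsTangentField (G : ℝ → M → ℝ) : Prop where
  hamiltonian : IsTimeDepHamiltonian E G
  zero : G 0 = 0
  one : G 1 = 0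

/-- The derivative `G'_t` of a family of functions with respect to `t ∈ [0,1]`. -/
def timeDeriv (G : ℝ → M → ℝ) (t : ℝ) (x : M) : ℝ :=
  derivWithin (fun s => G s x) (Icc 0 1) t

/-- The variation `γ_ε(t) = φ_{εG_t} ∘ φ_t`, where `φ_{εG_t}` is the time-1 map of the flow of the
autonomous Hamiltonian `εG_t` (`t` being fixed). -/
def variation (Ω : SymplecticForm E M) (G : ℝ → M → ℝ) (φ : ℝ → M → M) (ε : ℝ) :
    ℝ → M → M :=
  fun t => flow (hamField Ω (fun x => ε * G t x)) 1 ∘ φ t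

/-- The hypothesis of continuity for a path `φ_t`: for every tangent vector field `G` one can choose
points `p_t(ε)` and `P_t(ε)` at which the generating Hamiltonian `K_{ε,t}` of the variation `γ_ε`
attains its minimum and its maximum, depending smoothly on `ε`, for all small `ε` and all
`t ∈ [0,1]`. -/
def HypothesisOfContinuity (Ω : SymplecticForm E M) (φ : ℝ → M → M) : Prop :=
  ∀ G : ℝ → M → ℝ, IsTangentField E G →
    ∃ ε₀ > (0 : ℝ), ∃ p P : ℝ → ℝ → M, ∀ t ∈ Icc (0 : ℝ) 1,
      ContMDiffOn 𝓘(ℝ, ℝ) 𝓘(ℝ, E) ∞ (p t) (Ioo (-ε₀) ε₀) ∧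
      ContMDiffOn 𝓘(ℝ, ℝ) 𝓘(ℝ, E) ∞ (P t) (Ioo (-ε₀) ε₀) ∧
      ∀ ε ∈ Ioo (-ε₀) ε₀,
        p t ε ∈ minset (generatingHamiltonian Ω (variation Ω G φ ε) t) ∧
        P t ε ∈ maxset (generatingHamiltonian Ω (variation Ω G φ ε) t)

end HoferVariation

end

/-! Composing a path generated by H_t with the time-one maps of the flows of a family F_t gives a
path with an explicit generating Hamiltonian, `pushHam`. For F = εG, pulled back by the time-ε flow
of G_t, this Hamiltonian becomes H_t + ε a_ε, where a_ε(z) averages G'_t over the orbit of z under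
the flow of G_t from time 0 to time ε (`pushHam_const_mul`). Pulling back by a bijection preserves
the oscillation, so the length of γ_ε is the integral over t of the oscillation of H_t + ε a_ε.

What remains is an envelope argument. If z_ε maximizes H_t + ε a_ε and x maximizes H_t, then ε
a_ε(x) ≤ max(H_t + ε a_ε) - max H_t ≤ ε a_ε(z_ε). The hypothesis of continuity gives z_ε → z_0.
Dividing by ε of either sign forces a_0(x) = a_0(z_0), and a_0 = G'_t. So G'_t is constant on the
maximum set, and that constant is the derivative of the maximum (`hasDerivAt_of_squeeze`); minima
are treated alike. The oscillation moves by at most 2C|ε| if |G'_t| ≤ C, so dominated convergence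
differentiates the length and yields the integrability of the derivative
(`hasDerivAt_integral_of_lipschitz_at`).

The formula for `pushHam` comes from dω = 0. If u(s,t,r) is the time-s flow of F_t applied to a
surface c(t,r), then ∂_s ω(u_t, u_r) = ∂_r (F'_t ∘ u) (`hasDerivAt_surfForm`). Integrating over s in
[0,1], with c tangent to the vector field of H_t in the t direction, gives `formAt_flowDeriv`.

Two facts support this. First, flows depend smoothly on time, parameter and initial point, up to the
ends of the parameter interval (`contMDiffOn_familyFlow`): in charts the field is extended past t =
0, 1 by reflection, the implicit function theorem in a space of curves solves the integral equation
for short times, and the group law carries smoothness to all times. Second, `generatingHamiltonian`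
is only some choice, so it has to be compared with `pushHam`: both generate the same path, hence
they differ by a constant at each t, provided that the maps of the path are onto
(`Generates.surjective`). -/

noncomputable section

namespace HoferVariation

set_option linter.unusedSectionVars false

universe u v

/-! ### Superposition operators on spaces of continuous maps -/

section Superposition

variable {K : Type*} [TopologicalSpace K] [CompactSpace K]

/-- Pointwise application of a continuous family of operators to a continuous family of vectors. -/
def pointwiseApply (K : Type*) [TopologicalSpace K] [CompactSpace K]
    (E F : Type*) [NormedAddCommGroup E] [NormedSpace ℝ E]
    [NormedAddCommGroup F] [NormedSpace ℝ F] :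
    C(K, E →L[ℝ] F) →L[ℝ] C(K, E) →L[ℝ] C(K, F) :=
  LinearMap.mkContinuous₂
    (LinearMap.mk₂ ℝ (fun (A : C(K, E →L[ℝ] F)) (y : C(K, E)) =>
      (⟨fun k => A k (y k), by fun_prop⟩ : C(K, F)))
      (fun _ _ _ => by ext; simp) (fun _ _ _ => by ext; simp)
      (fun _ _ _ => by ext; simp) (fun _ _ _ => by ext; simp)) 1
    (fun A y => by
      rw [one_mul]
      refine (ContinuousMap.norm_le _ (by positivity)).2 fun k => ?_
      exact (A k).le_of_opNorm_le_of_le (A.norm_coe_le_norm k) (y.norm_coe_le_norm k))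

@[simp]
theorem pointwiseApply_apply {E F : Type*} [NormedAddCommGroup E] [NormedSpace ℝ E]
    [NormedAddCommGroup F] [NormedSpace ℝ F] (A : C(K, E →L[ℝ] F)) (y : C(K, E)) (k : K) :
    pointwiseApply K E F A y k = A k (y k) := rfl

/-- The mean value inequality is applied on each segment from y(k) to y(k) + η(k). The estimate is
uniform in k because y ↦ f' ∘ y is continuous for the sup norm. -/
theorem hasFDerivAt_superposition {E F : Type*} [NormedAddCommGroup E] [NormedSpace ℝ E]
    [NormedAddCommGroup F] [NormedSpace ℝ F] {f : E → F} {f' : E → E →L[ℝ] F}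
    (hf : ∀ x, HasFDerivAt f (f' x) x) (hc : Continuous f) (hc' : Continuous f') (y : C(K, E)) :
    HasFDerivAt (fun y : C(K, E) => (⟨f, hc⟩ : C(E, F)).comp y)
      (pointwiseApply K E F ((⟨f', hc'⟩ : C(E, E →L[ℝ] F)).comp y)) y := by
  rw [hasFDerivAt_iff_isLittleO_nhds_zero, Asymptotics.isLittleO_iff]
  intro ε hε
  have hcont : Continuous fun y : C(K, E) => (⟨f', hc'⟩ : C(E, E →L[ℝ] F)).comp y :=
    ContinuousMap.continuous_postcomp _
  obtain ⟨δ, hδ, h⟩ := (Metric.continuous_iff (α := C(K, E)) (β := C(K, E →L[ℝ] F))).1 hcont y ε hε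
  filter_upwards [Metric.ball_mem_nhds (0 : C(K, E)) hδ] with η hη
  refine (ContinuousMap.norm_le _ (by positivity)).2 fun k => ?_
  have hη' : ‖η‖ < δ := by simpa using hη
  have key : ∀ x ∈ segment ℝ (y k) (y k + η k), ‖f' x - f' (y k)‖ ≤ ε := by
    intro x hx
    rw [segment_eq_image'] at hx
    obtain ⟨τ, hτ, rfl⟩ := hx
    have h1 : dist (y + τ • η) y < δ := by
      rw [dist_eq_norm, add_sub_cancel_left, norm_smul, Real.norm_eq_abs, abs_of_nonneg hτ.1]
      nlinarith [norm_nonneg η, hτ.2]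
    have h2 := (ContinuousMap.dist_lt_iff hε).1 (h _ h1) k
    rw [dist_eq_norm] at h2
    simpa using h2.le
  have := (convex_segment (𝕜 := ℝ) (y k) (y k + η k)).norm_image_sub_le_of_norm_hasFDerivWithin_le'
    (fun x _ => (hf x).hasFDerivWithinAt) key (left_mem_segment _ _ _) (right_mem_segment _ _ _)
  rw [add_sub_cancel_left] at this
  refine le_trans ?_ (this.trans (mul_le_mul_of_nonneg_left (η.norm_coe_le_norm k) hε.le))
  simp

/-- The superposition operator `y ↦ f ∘ y` on continuous maps is as smooth as `f`. -/
theorem contDiff_superposition {E : Type u} [NormedAddCommGroup E] [NormedSpace ℝ E] (n : ℕ) :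
    ∀ {F : Type max u v} [NormedAddCommGroup F] [NormedSpace ℝ F] {f : E → F}
      (hf : ContDiff ℝ n f),
      ContDiff ℝ n (fun y : C(K, E) => (⟨f, hf.continuous⟩ : C(E, F)).comp y) := by
  -- The derivative of a superposition operator is the superposition operator of f', followed by a
  -- bounded linear map. Since f' takes values in `E →L[ℝ] F`, the induction ranges over all F, in a
  -- universe that contains that of E.
  induction n with
  | zero =>
    intro F _ _ f hf
    exact contDiff_zero.2 (ContinuousMap.continuous_postcomp _)
  | succ n ih =>
    intro F _ _ f hf
    obtain ⟨f', hf', hd⟩ := (contDiff_succ_iff_hasFDerivAt (n := n)).1 hf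
    refine (contDiff_succ_iff_hasFDerivAt (n := n)).2
      ⟨fun y => pointwiseApply K E F ((⟨f', hf'.continuous⟩ : C(E, E →L[ℝ] F)).comp y), ?_,
        fun y => hasFDerivAt_superposition hd hf.continuous hf'.continuous y⟩
    exact (pointwiseApply K E F).contDiff.comp (ih hf')

end Superposition

/-! ### Short-time flows by the implicit function theorem -/

section LocalFlow

open intervalIntegral

variable {E : Type*} [NormedAddCommGroup E]

/-- The interval on which rescaled integral curves are parametrized. -/
abbrev TimeInterval : Type := Icc (-2 : ℝ) 2

/-- A continuous curve on `[-2,2]`, extended to the real line by constants. -/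
def extendCurve (y : C(TimeInterval, E)) (τ : ℝ) : E :=
  IccExtend (by norm_num : (-2 : ℝ) ≤ 2) y τ

theorem continuous_extendCurve (y : C(TimeInterval, E)) : Continuous (extendCurve y) :=
  y.continuous.Icc_extend'

theorem extendCurve_of_mem (y : C(TimeInterval, E)) {τ : ℝ} (hτ : τ ∈ Icc (-2 : ℝ) 2) :
    extendCurve y τ = y ⟨τ, hτ⟩ := IccExtend_of_mem _ _ hτ

theorem norm_extendCurve_le (y : C(TimeInterval, E)) (τ : ℝ) : ‖extendCurve y τ‖ ≤ ‖y‖ :=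
  y.norm_coe_le_norm _

theorem norm_extendCurve_sub_le (y z : C(TimeInterval, E)) (τ : ℝ) :
    ‖extendCurve y τ - extendCurve z τ‖ ≤ ‖y - z‖ :=
  (y - z).norm_coe_le_norm _

variable [NormedSpace ℝ E]

/-- The primitive, vanishing at `0`, of a continuous curve on `[-2,2]`. -/
def curvePrimitive (E : Type*) [NormedAddCommGroup E] [NormedSpace ℝ E] :
    C(TimeInterval, E) →L[ℝ] C(TimeInterval, E) :=
  LinearMap.mkContinuous
    { toFun := fun y => ⟨fun σ => ∫ τ in (0 : ℝ)..σ, extendCurve y τ,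
        (continuous_primitive (fun _ _ => (continuous_extendCurve y).intervalIntegrable _ _)
          0).comp continuous_subtype_val⟩
      map_add' := fun y z => by
        ext σ
        exact integral_add ((continuous_extendCurve y).intervalIntegrable _ _)
          ((continuous_extendCurve z).intervalIntegrable _ _)
      map_smul' := fun c y => by
        ext σ
        exact integral_smul c (extendCurve y) } 2
    (fun y => by
      refine (ContinuousMap.norm_le _ (by positivity)).2 fun σ => ?_
      have := norm_integral_le_of_norm_le_const (a := 0) (b := (σ : ℝ))
        (fun τ _ => norm_extendCurve_le y τ)
      refine this.trans ?_
      rw [mul_comm, sub_zero]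
      exact mul_le_mul_of_nonneg_right (abs_le.2 σ.2) (norm_nonneg _))

/-- Integrals over `[0,1]` depend smoothly on parameters. -/
theorem contDiff_integral_of_contDiff {P : Type u} [NormedAddCommGroup P] [NormedSpace ℝ P]
    {F : Type max u v} [NormedAddCommGroup F] [NormedSpace ℝ F] {n : ℕ} {g : ℝ × P → F}
    (hg : ContDiff ℝ n g) : ContDiff ℝ n fun p => ∫ σ in (0 : ℝ)..1, g (σ, p) := by
  -- The curve σ ↦ (σ, p) depends affinely on p; superposing g, taking the primitive and evaluating
  -- at 1 are smooth operations.
  let A : P →L[ℝ] C(TimeInterval, ℝ × P) :=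
    (ContinuousLinearMap.inr ℝ ℝ P).compLeftContinuous ℝ TimeInterval ∘L
      ContinuousLinearMap.const ℝ TimeInterval
  let c : C(TimeInterval, ℝ × P) := ⟨fun σ => (σ, 0), by fun_prop⟩
  have h := (ContinuousMap.evalCLM ℝ (⟨1, by norm_num⟩ : TimeInterval)).contDiff.comp
    ((curvePrimitive F).contDiff.comp
      ((contDiff_superposition.{u, v} (K := TimeInterval) n hg).comp
        (A.contDiff.add (contDiff_const (c := c)))))
  refine contDiff_iff_contDiffAt.2 fun p₀ => h.contDiffAt.congr_of_eventuallyEq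
    (Filter.Eventually.of_forall fun p => ?_)
  refine integral_congr fun σ hσ => ?_
  rw [uIcc_of_le zero_le_one] at hσ
  rw [extendCurve_of_mem _ ⟨by linarith [hσ.1], by linarith [hσ.2]⟩]
  simp [A, c]

variable [CompleteSpace E]

/-- The integral curves of `a • f` on `[-2,2]` depend on `a` and on the initial value as smoothly
as `f` does on its argument, locally around `a = 0`. -/
theorem exists_contDiffAt_rescaledFlow {n : ℕ} (hn : n ≠ 0) {f : E → E} (hf : ContDiff ℝ n f)
    (x₀ : E) :
    ∃ Y : ℝ × E → C(TimeInterval, E), ContDiffAt ℝ n Y (0, x₀) ∧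
      Y (0, x₀) = ContinuousMap.const _ x₀ ∧
      ∀ᶠ q in 𝓝 ((0 : ℝ), x₀), extendCurve (Y q) 0 = q.2 ∧
        ∀ σ ∈ Ioo (-2 : ℝ) 2,
          HasDerivAt (extendCurve (Y q)) (q.1 • f (extendCurve (Y q) σ)) σ := by
  let cst : E →L[ℝ] C(TimeInterval, E) := ContinuousLinearMap.const ℝ TimeInterval
  let N : C(TimeInterval, E) → C(TimeInterval, E) := fun y => (⟨f, hf.continuous⟩ : C(E, E)).comp y
  have hN : ContDiff ℝ n N := contDiff_superposition n hf
  -- Zeros of Φ are the solutions of y(σ) = x + a ∫₀^σ f(y). At a = 0 the solution is the constant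
  -- curve x and the partial derivative in y is the identity, so the implicit function theorem
  -- applies. Small a replaces short time, which keeps the interval of the curves fixed.
  let Φ : (ℝ × E) × C(TimeInterval, E) → C(TimeInterval, E) := fun u =>
    u.2 - cst u.1.2 - u.1.1 • curvePrimitive E (N u.2)
  have hΦ : ContDiff ℝ n Φ := by
    have h1 : ContDiff ℝ n fun u : (ℝ × E) × C(TimeInterval, E) => curvePrimitive E (N u.2) :=
      (curvePrimitive E).contDiff.comp (hN.comp contDiff_snd)
    have h2 : ContDiff ℝ n fun u : (ℝ × E) × C(TimeInterval, E) => cst u.1.2 :=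
      cst.contDiff.comp (contDiff_snd.comp contDiff_fst)
    exact (contDiff_snd.sub h2).sub ((contDiff_fst.comp contDiff_fst).smul h1)
  let u₀ : (ℝ × E) × C(TimeInterval, E) := ((0, x₀), cst x₀)
  have hn' : (n : ℕ∞ω) ≠ 0 := by exact_mod_cast hn
  have hpartial : fderiv ℝ Φ u₀ ∘L .inr ℝ (ℝ × E) C(TimeInterval, E) = .id ℝ _ := by
    have h1 : HasFDerivAt (fun y => Φ ((0, x₀), y))
        (fderiv ℝ Φ u₀ ∘L .inr ℝ (ℝ × E) C(TimeInterval, E)) (cst x₀) :=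
      ((hΦ.differentiable hn').differentiableAt (x := u₀)).hasFDerivAt.comp (cst x₀)
        (hasFDerivAt_prodMk_right (𝕜 := ℝ) (0, x₀) (cst x₀))
    have h2 : HasFDerivAt (fun y => Φ ((0, x₀), y)) (.id ℝ _) (cst x₀) := by
      have : (fun y => Φ ((0, x₀), y)) = fun y => y - cst x₀ := by
        ext y; simp [Φ]
      rw [this]
      exact (hasFDerivAt_id _).sub_const _
    exact h1.unique h2
  have if₂ : (fderiv ℝ Φ u₀ ∘L .inr ℝ (ℝ × E) C(TimeInterval, E)).IsInvertible := by
    rw [hpartial]; exact ⟨.refl ℝ _, rfl⟩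
  have cdf : ContDiffAt ℝ n Φ u₀ := hΦ.contDiffAt
  refine ⟨cdf.implicitFunction hn' if₂, cdf.contDiffAt_implicitFunction hn' if₂,
    cdf.implicitFunction_apply_self hn' if₂, ?_⟩
  filter_upwards [cdf.eventually_apply_implicitFunction hn' if₂] with q hq
  set y := cdf.implicitFunction hn' if₂ q
  have hΦ0 : Φ u₀ = 0 := by simp [Φ, u₀]
  have hy : y = cst q.2 + q.1 • curvePrimitive E (N y) := by
    rw [hΦ0] at hq
    have : y - cst q.2 - q.1 • curvePrimitive E (N y) = 0 := hq
    rw [sub_sub, sub_eq_zero] at this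
    exact this
  have hval : ∀ σ ∈ Icc (-2 : ℝ) 2,
      extendCurve y σ = q.2 + q.1 • ∫ τ in (0 : ℝ)..σ, f (extendCurve y τ) := by
    intro σ hσ
    rw [extendCurve_of_mem y hσ]
    exact DFunLike.congr_fun hy ⟨σ, hσ⟩
  refine ⟨by rw [hval 0 (by norm_num)]; simp, fun σ hσ => ?_⟩
  have hc : Continuous fun τ => f (extendCurve y τ) :=
    hf.continuous.comp (continuous_extendCurve y)
  have hd : HasDerivAt (fun σ => q.2 + q.1 • ∫ τ in (0 : ℝ)..σ, f (extendCurve y τ))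
      (q.1 • f (extendCurve y σ)) σ :=
    ((integral_hasDerivAt_right (hc.intervalIntegrable _ _)
      (hc.stronglyMeasurableAtFilter _ _) hc.continuousAt).const_smul q.1).const_add q.2
  refine hd.congr_of_eventuallyEq ?_
  filter_upwards [Icc_mem_nhds hσ.1 hσ.2] with τ hτ using hval τ hτ

end LocalFlow

/-! ### Extension of differentiable functions beyond [0,1] by reflection -/

section Extension

/-- The extension of `f` from `t ≥ 0` to `t < 0` by a weighted sum of rescaled reflections. -/
def reflectExtend {ι : Type*} [Fintype ι] {E F : Type*} [NormedAddCommGroup F] [NormedSpace ℝ F]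
    (a l : ι → ℝ) (f : ℝ × E → F) (q : ℝ × E) : F :=
  open Classical in if 0 ≤ q.1 then f q else ∑ k, a k • f (l k * q.1, q.2)

variable {ι : Type*} [Fintype ι] {E : Type u}

theorem reflectExtend_of_nonneg {F : Type*} [NormedAddCommGroup F] [NormedSpace ℝ F]
    (a l : ι → ℝ) (f : ℝ × E → F) {q : ℝ × E} (hq : 0 ≤ q.1) : reflectExtend a l f q = f q :=
  if_pos hq

theorem reflectExtend_of_nonpos {F : Type*} [NormedAddCommGroup F] [NormedSpace ℝ F]
    {a : ι → ℝ} (l : ι → ℝ) (ha : ∑ k, a k = 1) (f : ℝ × E → F) {q : ℝ × E} (hq : q.1 ≤ 0) :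
    reflectExtend a l f q = ∑ k, a k • f (l k * q.1, q.2) := by
  rcases hq.lt_or_eq with h | h
  · exact if_neg (not_le.2 h)
  · obtain ⟨t, x⟩ := q
    obtain rfl : t = 0 := h
    rw [reflectExtend_of_nonneg _ _ _ le_rfl]
    simp [← Finset.sum_smul, ha]

variable [NormedAddCommGroup E] [NormedSpace ℝ E]

/-- The derivative of the extension is again an extension of this type: by the chain rule the time
part has weights a k * l k, and the space part keeps the weights a k. The moment conditions up to n
+ 1 for a contain those up to n for both, so induction applies. The moments 0 and 1 make the
one-sided derivatives agree at t = 0. -/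
theorem contDiff_reflectExtend (l : ι → ℝ) (hl : ∀ k, l k < 0) (n : ℕ) :
    ∀ {F : Type max u v} [NormedAddCommGroup F] [NormedSpace ℝ F] (a : ι → ℝ)
      (_ : ∀ j ≤ n, ∑ k, a k * l k ^ j = 1) {f : ℝ × E → F}
      (_ : ContDiffOn ℝ n f (Ici 0 ×ˢ univ)), ContDiff ℝ n (reflectExtend a l f) := by
  have hneg : ∀ k, MapsTo (fun q : ℝ × E => (l k * q.1, q.2)) (Iic 0 ×ˢ univ) (Ici 0 ×ˢ univ) :=
    fun k q hq => ⟨mul_nonneg_of_nonpos_of_nonpos (hl k).le hq.1, mem_univ _⟩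
  have hcover : (Ici 0 ×ˢ univ : Set (ℝ × E)) ∪ Iic 0 ×ˢ univ = univ := by
    rw [← union_prod, Ici_union_Iic, univ_prod_univ]
  induction n with
  | zero =>
    intro F _ _ a ha f hf
    have ha0 : ∑ k, a k = 1 := by simpa using ha 0 le_rfl
    have hfc := hf.continuousOn
    refine contDiff_zero.2 ?_
    rw [← continuousOn_univ, ← hcover]
    refine ContinuousOn.union_of_isClosed ?_ ?_ (isClosed_Ici.prod isClosed_univ)
      (isClosed_Iic.prod isClosed_univ)
    · exact hfc.congr fun q hq => reflectExtend_of_nonneg a l f hq.1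
    · refine ContinuousOn.congr (f := fun q : ℝ × E => ∑ k, a k • f (l k * q.1, q.2)) ?_
        fun q hq => reflectExtend_of_nonpos l ha0 f hq.1
      exact continuousOn_finsetSum _ fun k _ => (hfc.comp (by fun_prop) (hneg k)).const_smul (a k)
  | succ n ih =>
    intro F _ _ a ha f hf
    have ha0 : ∑ k, a k = 1 := by simpa using ha 0 (Nat.zero_le _)
    have hS : UniqueDiffOn ℝ (Ici 0 ×ˢ univ : Set (ℝ × E)) :=
      (uniqueDiffOn_Ici 0).prod uniqueDiffOn_univ
    set f' := fderivWithin ℝ f (Ici 0 ×ˢ univ)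
    have hf' : ContDiffOn ℝ n f' (Ici 0 ×ˢ univ) := hf.fderivWithin hS (by norm_cast)
    have hd : ∀ q ∈ (Ici 0 ×ˢ univ : Set (ℝ × E)), HasFDerivWithinAt f (f' q) (Ici 0 ×ˢ univ) q :=
      fun q hq => ((hf.differentiableOn (by simp)) q hq).hasFDerivWithinAt
    let P₁ : ℝ × E →L[ℝ] ℝ × E := .inl ℝ ℝ E ∘L .fst ℝ ℝ E
    let P₂ : ℝ × E →L[ℝ] ℝ × E := .inr ℝ ℝ E ∘L .snd ℝ ℝ E
    let g' : ℝ × E → ℝ × E →L[ℝ] F := fun q =>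
      reflectExtend (fun k => a k * l k) l (fun q => f' q ∘L P₁) q +
        reflectExtend a l (fun q => f' q ∘L P₂) q
    have hP : ∀ A : ℝ × E →L[ℝ] F, A ∘L P₁ + A ∘L P₂ = A := fun A => by
      rw [← ContinuousLinearMap.comp_add]
      have : P₁ + P₂ = .id ℝ _ := by ext <;> simp [P₁, P₂]
      rw [this, ContinuousLinearMap.comp_id]
    have hpos : ∀ q : ℝ × E, 0 ≤ q.1 →
        HasFDerivWithinAt (reflectExtend a l f) (g' q) (Ici 0 ×ˢ univ) q := by
      intro q hq
      have : g' q = f' q := by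
        simp only [g', reflectExtend_of_nonneg _ _ _ hq, hP]
      rw [this]
      exact (hd q ⟨hq, mem_univ _⟩).congr (fun q hq => reflectExtend_of_nonneg a l f hq.1)
        (reflectExtend_of_nonneg a l f hq)
    have hnonpos : ∀ q : ℝ × E, q.1 ≤ 0 →
        HasFDerivWithinAt (reflectExtend a l f) (g' q) (Iic 0 ×ˢ univ) q := by
      intro q hq
      have hal : ∑ k, a k * l k = 1 := by simpa using ha 1 (by omega)
      have : g' q = ∑ k, a k • (f' (l k * q.1, q.2) ∘L (l k • P₁ + P₂)) := by
        simp only [g', reflectExtend_of_nonpos l hal _ hq, reflectExtend_of_nonpos l ha0 _ hq]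
        rw [← Finset.sum_add_distrib]
        refine Finset.sum_congr rfl fun k _ => ?_
        rw [ContinuousLinearMap.comp_add, smul_add, ContinuousLinearMap.comp_smul, smul_smul]
      rw [this]
      refine HasFDerivWithinAt.congr (f := fun q : ℝ × E => ∑ k, a k • f (l k * q.1, q.2)) ?_
        (fun q hq => reflectExtend_of_nonpos l ha0 f hq.1) (reflectExtend_of_nonpos l ha0 f hq)
      refine HasFDerivWithinAt.fun_sum fun k _ => HasFDerivWithinAt.const_smul ?_ _
      refine (hd _ (hneg k ⟨hq, mem_univ _⟩)).comp q ?_ (hneg k)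
      have : HasFDerivAt (fun q => (l k • P₁ + P₂) q) (l k • P₁ + P₂) q :=
        (l k • P₁ + P₂).hasFDerivAt
      refine (this.congr_of_eventuallyEq (Filter.Eventually.of_forall fun q => ?_)).hasFDerivWithinAt
      ext <;> simp [P₁, P₂]
    refine (contDiff_succ_iff_hasFDerivAt (n := n)).2 ⟨g', ?_, fun q => ?_⟩
    · refine (ih (fun k => a k * l k) (fun j hj => ?_) ?_).add
        (ih a (fun j hj => ha j (by omega)) ?_)
      · rw [← ha (j + 1) (by omega)]
        exact Finset.sum_congr rfl fun k _ => by ring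
      · exact hf'.clm_comp contDiffOn_const
      · exact hf'.clm_comp contDiffOn_const
    · rcases lt_trichotomy q.1 0 with h | h | h
      · exact (hnonpos q h.le).hasFDerivAt (prod_mem_nhds (Iic_mem_nhds h) Filter.univ_mem)
      · rw [← hasFDerivWithinAt_univ, ← hcover]
        exact (hpos q h.ge).union (hnonpos q h.le)
      · exact (hpos q h.le).hasFDerivAt (prod_mem_nhds (Ici_mem_nhds h) Filter.univ_mem)

/-- The weights are the Lagrange basis polynomials at the nodes -(k+1), evaluated at 1.
Interpolation at n + 1 nodes reproduces X^j for j ≤ n, and X^j takes the value 1 at 1. -/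
theorem exists_reflection_weights (n : ℕ) :
    ∃ a : Fin (n + 1) → ℝ, ∀ j ≤ n, ∑ k, a k * (-((k : ℝ) + 1)) ^ j = 1 := by
  let v : Fin (n + 1) → ℝ := fun k => -((k : ℝ) + 1)
  have hv : Set.InjOn v (Finset.univ : Finset (Fin (n + 1))) := fun i _ j _ h => by
    have : (i : ℝ) = j := by simpa [v] using h
    exact Fin.ext (by exact_mod_cast this)
  refine ⟨fun k => (Lagrange.basis Finset.univ v k).eval 1, fun j hj => ?_⟩
  have h := Lagrange.eq_interpolate (s := Finset.univ) (f := (Polynomial.X : Polynomial ℝ) ^ j) hv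
    (by simpa using (by exact_mod_cast Nat.lt_succ_of_le hj : (j : WithBot ℕ) < n + 1))
  have h2 := congrArg (Polynomial.eval 1) h
  rw [Lagrange.interpolate_apply, Polynomial.eval_finsetSum] at h2
  simp only [Polynomial.eval_pow, Polynomial.eval_X, one_pow, Polynomial.eval_mul,
    Polynomial.eval_C] at h2
  exact (Finset.sum_congr rfl fun k _ => mul_comm _ _).trans h2.symm

theorem exists_contDiff_extension_of_Ici {F : Type max u v} [NormedAddCommGroup F]
    [NormedSpace ℝ F] {n : ℕ} {f : ℝ × E → F} (hf : ContDiffOn ℝ n f (Ici 0 ×ˢ univ)) :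
    ∃ g : ℝ × E → F, ContDiff ℝ n g ∧ EqOn g f (Ici 0 ×ˢ univ) := by
  obtain ⟨a, ha⟩ := exists_reflection_weights n
  exact ⟨_, contDiff_reflectExtend.{u, v} _ (fun k => by linarith [(k : ℕ).cast_nonneg (α := ℝ)])
    n a ha hf, fun q hq => reflectExtend_of_nonneg _ _ _ hq.1⟩

/-- Vanishing beyond 2/3 makes f itself of class C^n on the whole half-line t ≥ 0, so only the end t
= 0 needs reflection. -/
theorem exists_contDiff_extension_of_eq_zero {F : Type max u v} [NormedAddCommGroup F]
    [NormedSpace ℝ F] {n : ℕ} {f : ℝ × E → F} (hf : ContDiffOn ℝ n f (Icc 0 1 ×ˢ univ))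
    (h0 : ∀ q : ℝ × E, 2 / 3 ≤ q.1 → f q = 0) :
    ∃ g : ℝ × E → F, ContDiff ℝ n g ∧ EqOn g f (Icc 0 1 ×ˢ univ) := by
  obtain ⟨g, hg, hgf⟩ := exists_contDiff_extension_of_Ici (f := f) (n := n) (by
    rintro q ⟨hq, -⟩
    rcases lt_or_ge q.1 1 with h1 | h1
    · refine (hf q ⟨⟨hq, h1.le⟩, mem_univ _⟩).mono_of_mem_nhdsWithin ?_
      filter_upwards [self_mem_nhdsWithin, nhdsWithin_le_nhds
        (prod_mem_nhds (Iio_mem_nhds h1) Filter.univ_mem)] with p hp hp'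
      exact ⟨⟨hp.1, hp'.1.le⟩, mem_univ _⟩
    · refine (contDiffWithinAt_const (c := 0)).congr_of_eventuallyEq ?_ (h0 q (by linarith))
      filter_upwards [nhdsWithin_le_nhds (prod_mem_nhds
        (Ioi_mem_nhds (show 2 / 3 < q.1 by linarith)) Filter.univ_mem)] with p hp
      exact h0 p hp.1.le)
  exact ⟨g, hg, hgf.mono (prod_mono_left fun t ht => ht.1)⟩

/-- A function which is `C^n` on `[0,1] × E`, up to the boundary, is the restriction of
a `C^n` function. -/
theorem exists_contDiff_extension {F : Type max u v} [NormedAddCommGroup F]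
    [NormedSpace ℝ F] {n : ℕ} {f : ℝ × E → F} (hf : ContDiffOn ℝ n f (Icc 0 1 ×ˢ univ)) :
    ∃ g : ℝ × E → F, ContDiff ℝ n g ∧ EqOn g f (Icc 0 1 ×ˢ univ) := by
  -- Partition f = (1 - ρ) f + ρ f, with ρ = 0 up to 1/3 and ρ = 1 from 2/3 on. The first summand
  -- vanishes near t = 1; the second does so after the substitution t ↦ 1 - t.
  let ρ : ℝ → ℝ := fun t => Real.smoothTransition (3 * t - 1)
  have hρ : ContDiff ℝ n ρ := Real.smoothTransition.contDiff.comp (by fun_prop)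
  have hρ1 : ∀ t, 2 / 3 ≤ t → ρ t = 1 := fun t ht =>
    Real.smoothTransition.one_of_one_le (by linarith)
  have hρ0 : ∀ t, t ≤ 1 / 3 → ρ t = 0 := fun t ht =>
    Real.smoothTransition.zero_of_nonpos (by linarith)
  obtain ⟨g₁, hg₁, h₁⟩ := exists_contDiff_extension_of_eq_zero
    (f := fun q => (1 - ρ q.1) • f q) (n := n)
    ((contDiff_const.sub (hρ.comp contDiff_fst)).contDiffOn.smul hf)
    (fun q hq => by rw [hρ1 _ hq, sub_self]; exact zero_smul ℝ (f q))
  obtain ⟨g₂, hg₂, h₂⟩ := exists_contDiff_extension_of_eq_zero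
    (f := fun q : ℝ × E => ρ (1 - q.1) • f (1 - q.1, q.2)) (n := n)
    ((hρ.comp (contDiff_const.sub contDiff_fst)).contDiffOn.smul
      (hf.comp (by fun_prop) fun q hq =>
        ⟨⟨by linarith [hq.1.2], by linarith [hq.1.1]⟩, mem_univ _⟩))
    (fun q hq => by simp [hρ0 (1 - q.1) (by linarith)])
  refine ⟨fun q => g₁ q + g₂ (1 - q.1, q.2), hg₁.add (hg₂.comp (by fun_prop)), fun q hq => ?_⟩
  have hq' : ((1 - q.1, q.2) : ℝ × E) ∈ (Icc 0 1 ×ˢ univ : Set (ℝ × E)) :=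
    ⟨⟨by linarith [hq.1.2], by linarith [hq.1.1]⟩, mem_univ _⟩
  have e1 := h₁ hq
  have e2 := h₂ hq'
  simp only [sub_sub_cancel] at e1 e2
  show g₁ q + g₂ (1 - q.1, q.2) = f q
  rw [e1, e2, ← add_smul, sub_add_cancel, one_smul]

end Extension

/-! ### Symplectic forms and Hamiltonian fields in charts -/

section Charts

variable {E : Type*} [NormedAddCommGroup E] [NormedSpace ℝ E]
  {M : Type*} [TopologicalSpace M] [ChartedSpace E M]

/-- The derivative of the inverse of the preferred chart at `x₀`. -/
def chartSymmDeriv (x₀ : M) (y : E) : E →L[ℝ] E :=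
  mfderiv 𝓘(ℝ, E) 𝓘(ℝ, E) (extChartAt 𝓘(ℝ, E) x₀).symm y

/-- The derivative of the preferred chart at `x₀`. -/
def chartDeriv (x₀ : M) (x : M) : E →L[ℝ] E :=
  mfderiv 𝓘(ℝ, E) 𝓘(ℝ, E) (extChartAt 𝓘(ℝ, E) x₀) x

/-- The bilinear form of a symplectic form at `x`, on the model space. -/
def SymplecticForm.formAt (Ω : SymplecticForm E M) (x : M) : E →L[ℝ] E →L[ℝ] ℝ := Ω.form x

theorem SymplecticForm.formAt_self (Ω : SymplecticForm E M) (x : M) (v : E) :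
    Ω.formAt x v v = 0 := Ω.alternating' x v

theorem SymplecticForm.eq_of_formAt_eq (Ω : SymplecticForm E M) {x : M} {u v : E}
    (h : ∀ w, Ω.formAt x u w = Ω.formAt x v w) : u = v := by
  have h' : ∀ w, Ω.formAt x (u - v) w = 0 := fun w => by rw [map_sub, sub_apply, h, sub_self]
  exact sub_eq_zero.1 (Ω.nondegenerate' x (u - v) h')

/-- The differential of a function, as a functional on the model space. -/
def differentialAt (f : M → ℝ) (x : M) : E →L[ℝ] ℝ := mfderiv 𝓘(ℝ, E) 𝓘(ℝ, ℝ) f x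

theorem SymplecticForm.chartForm_apply (Ω : SymplecticForm E M) (x₀ : M) (y u v : E) :
    chartForm Ω.form x₀ y u v = Ω.formAt ((extChartAt 𝓘(ℝ, E) x₀).symm y)
      (chartSymmDeriv x₀ y u) (chartSymmDeriv x₀ y v) := rfl

theorem chartTarget_mem_nhds {x₀ : M} {y : E} (hy : y ∈ (extChartAt 𝓘(ℝ, E) x₀).target) :
    (extChartAt 𝓘(ℝ, E) x₀).target ∈ 𝓝 y :=
  (isOpen_extChartAt_target x₀).mem_nhds hy

variable [IsManifold 𝓘(ℝ, E) ∞ M]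

theorem contMDiffOn_chart_symm (x₀ : M) :
    ContMDiffOn 𝓘(ℝ, E) 𝓘(ℝ, E) ∞ (extChartAt 𝓘(ℝ, E) x₀).symm
      (extChartAt 𝓘(ℝ, E) x₀).target := contMDiffOn_extChartAt_symm x₀

theorem contMDiffOn_chart (x₀ : M) :
    ContMDiffOn 𝓘(ℝ, E) 𝓘(ℝ, E) ∞ (extChartAt 𝓘(ℝ, E) x₀)
      (extChartAt 𝓘(ℝ, E) x₀).source := by
  rw [extChartAt_source]
  exact contMDiffOn_extChartAt

theorem hasMFDerivAt_chart_symm {x₀ : M} {y : E} (hy : y ∈ (extChartAt 𝓘(ℝ, E) x₀).target) :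
    HasMFDerivAt 𝓘(ℝ, E) 𝓘(ℝ, E) (extChartAt 𝓘(ℝ, E) x₀).symm y (chartSymmDeriv (E := E) x₀ y) :=
  (((contMDiffOn_chart_symm x₀).contMDiffAt (chartTarget_mem_nhds hy)).mdifferentiableAt
    (by simp)).hasMFDerivAt

theorem chartDeriv_comp_chartSymmDeriv {x₀ : M} {y : E}
    (hy : y ∈ (extChartAt 𝓘(ℝ, E) x₀).target) (v : E) :
    chartDeriv x₀ ((extChartAt 𝓘(ℝ, E) x₀).symm y) (chartSymmDeriv x₀ y v) = v := by
  have : IsManifold 𝓘(ℝ, E) 1 M := IsManifold.of_le (n := ∞) (by simp)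
  have h := mfderiv_extChartAt_comp_mfderivWithin_extChartAt_symm (I := 𝓘(ℝ, E)) hy
  rw [modelWithCornersSelf_coe, range_id, mfderivWithin_univ] at h
  exact DFunLike.congr_fun h v

theorem chartSymmDeriv_comp_chartDeriv {x₀ : M} {y : E}
    (hy : y ∈ (extChartAt 𝓘(ℝ, E) x₀).target) (v : E) :
    chartSymmDeriv x₀ y (chartDeriv x₀ ((extChartAt 𝓘(ℝ, E) x₀).symm y) v) = v := by
  have : IsManifold 𝓘(ℝ, E) 1 M := IsManifold.of_le (n := ∞) (by simp)
  have h := mfderivWithin_extChartAt_symm_comp_mfderiv_extChartAt (I := 𝓘(ℝ, E)) hy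
  rw [modelWithCornersSelf_coe, range_id, mfderivWithin_univ] at h
  exact DFunLike.congr_fun h v

theorem SymplecticForm.chartForm_self (Ω : SymplecticForm E M) (x₀ : M) (y u : E) :
    chartForm Ω.form x₀ y u u = 0 := by
  rw [Ω.chartForm_apply, Ω.formAt_self]

theorem SymplecticForm.chartForm_swap (Ω : SymplecticForm E M) (x₀ : M) (y u v : E) :
    chartForm Ω.form x₀ y u v = - chartForm Ω.form x₀ y v u := by
  have h := Ω.chartForm_self x₀ y (u + v)
  simp only [map_add, add_apply, Ω.chartForm_self, zero_add, add_zero] at h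
  linarith

variable [FiniteDimensional ℝ E]

/-- Nondegeneracy gives injectivity because the derivative of the inverse chart is bijective, and E
and its dual have equal dimension. Inversion of operators is smooth at invertible ones, whence the
smoothness of `chartField`. -/
theorem SymplecticForm.isInvertible_chartForm (Ω : SymplecticForm E M) {x₀ : M} {y : E}
    (hy : y ∈ (extChartAt 𝓘(ℝ, E) x₀).target) : (chartForm Ω.form x₀ y).IsInvertible := by
  have hinj : Function.Injective (chartForm Ω.form x₀ y : E →ₗ[ℝ] (E →L[ℝ] ℝ)) := by
    rw [← LinearMap.ker_eq_bot, LinearMap.ker_eq_bot']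
    intro v hv
    have h0 : chartSymmDeriv x₀ y v = 0 := by
      refine Ω.eq_of_formAt_eq (x := (extChartAt 𝓘(ℝ, E) x₀).symm y) fun w => ?_
      have h : chartForm Ω.form x₀ y v
          (chartDeriv x₀ ((extChartAt 𝓘(ℝ, E) x₀).symm y) w) = 0 := by
        have h' : chartForm Ω.form x₀ y v = 0 := hv
        rw [h', zero_apply]
      rw [Ω.chartForm_apply, chartSymmDeriv_comp_chartDeriv hy] at h
      rw [h, map_zero, zero_apply]
    rw [← chartDeriv_comp_chartSymmDeriv hy v, h0, map_zero]
  have hdim : Module.finrank ℝ E = Module.finrank ℝ (E →L[ℝ] ℝ) := by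
    rw [← (LinearMap.toContinuousLinearMap (𝕜 := ℝ) (E := E) (F' := ℝ)).finrank_eq]
    exact (Subspace.dual_finrank_eq (K := ℝ) (V := E)).symm
  exact ⟨(LinearEquiv.ofInjectiveOfFinrankEq _ hinj hdim).toContinuousLinearEquiv, by ext; rfl⟩

/-- The local expression of the Hamiltonian vector field of `f` in the preferred chart at `x₀`. -/
def chartField (Ω : SymplecticForm E M) (x₀ : M) (f : M → ℝ) (y : E) : E :=
  (chartForm Ω.form x₀ y).inverse (fderiv ℝ (f ∘ (extChartAt 𝓘(ℝ, E) x₀).symm) y)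

theorem chartForm_chartField (Ω : SymplecticForm E M) {x₀ : M} (f : M → ℝ) {y : E}
    (hy : y ∈ (extChartAt 𝓘(ℝ, E) x₀).target) :
    chartForm Ω.form x₀ y (chartField Ω x₀ f y) =
      fderiv ℝ (f ∘ (extChartAt 𝓘(ℝ, E) x₀).symm) y := by
  obtain ⟨B, hB⟩ := Ω.isInvertible_chartForm hy
  rw [chartField, ← hB, ContinuousLinearMap.inverse_equiv]
  simp

/-- The Hamiltonian vector field, as a vector of the model space. -/
def hamAt (Ω : SymplecticForm E M) (f : M → ℝ) (x : M) : E := hamField Ω f x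

theorem formAt_hamAt (Ω : SymplecticForm E M) (f : M → ℝ) (x : M) (v : E) :
    Ω.formAt x (hamAt Ω f x) v = differentialAt f x v := form_hamField Ω f x v

theorem eq_hamAt_of_forall (Ω : SymplecticForm E M) {f : M → ℝ} {x : M} {X : E}
    (h : ∀ v, Ω.formAt x X v = differentialAt f x v) : X = hamAt Ω f x :=
  Ω.eq_of_formAt_eq fun w => by rw [h, formAt_hamAt]

theorem hasFDerivAt_comp_chart_symm {x₀ : M} {f : M → ℝ} {y : E}
    (hy : y ∈ (extChartAt 𝓘(ℝ, E) x₀).target)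
    (hf : MDifferentiableAt 𝓘(ℝ, E) 𝓘(ℝ, ℝ) f ((extChartAt 𝓘(ℝ, E) x₀).symm y)) :
    HasFDerivAt (f ∘ (extChartAt 𝓘(ℝ, E) x₀).symm)
      (differentialAt f ((extChartAt 𝓘(ℝ, E) x₀).symm y) ∘L chartSymmDeriv x₀ y) y :=
  (hf.hasMFDerivAt.comp y (hasMFDerivAt_chart_symm hy)).hasFDerivAt

/-- This links the field defined by choice on M with a field on E given by a formula, for which the
differential equation can be solved. -/
theorem chartSymmDeriv_chartField (Ω : SymplecticForm E M) {x₀ : M} {f : M → ℝ} {y : E}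
    (hy : y ∈ (extChartAt 𝓘(ℝ, E) x₀).target)
    (hf : MDifferentiableAt 𝓘(ℝ, E) 𝓘(ℝ, ℝ) f ((extChartAt 𝓘(ℝ, E) x₀).symm y)) :
    chartSymmDeriv x₀ y (chartField Ω x₀ f y) =
      hamAt Ω f ((extChartAt 𝓘(ℝ, E) x₀).symm y) := by
  refine eq_hamAt_of_forall Ω fun v => ?_
  obtain ⟨w, rfl⟩ : ∃ w : E, chartSymmDeriv x₀ y w = v :=
    ⟨_, chartSymmDeriv_comp_chartDeriv hy v⟩
  have h2 : chartForm Ω.form x₀ y (chartField Ω x₀ f y) w =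
      fderiv ℝ (f ∘ (extChartAt 𝓘(ℝ, E) x₀).symm) y w := by rw [chartForm_chartField Ω f hy]
  rw [(hasFDerivAt_comp_chart_symm hy hf).fderiv] at h2
  exact h2

theorem chartDeriv_hamAt (Ω : SymplecticForm E M) {x₀ : M} {f : M → ℝ} {y : E}
    (hy : y ∈ (extChartAt 𝓘(ℝ, E) x₀).target)
    (hf : MDifferentiableAt 𝓘(ℝ, E) 𝓘(ℝ, ℝ) f ((extChartAt 𝓘(ℝ, E) x₀).symm y)) :
    chartDeriv x₀ ((extChartAt 𝓘(ℝ, E) x₀).symm y)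
      (hamAt Ω f ((extChartAt 𝓘(ℝ, E) x₀).symm y)) = chartField Ω x₀ f y := by
  rw [← chartSymmDeriv_chartField Ω hy hf]
  exact chartDeriv_comp_chartSymmDeriv hy _

theorem differentialAt_const_mul {f : M → ℝ} {x : M} (c : ℝ)
    (hf : MDifferentiableAt 𝓘(ℝ, E) 𝓘(ℝ, ℝ) f x) :
    differentialAt (E := E) (fun x => c * f x) x = c • differentialAt f x :=
  (hf.hasMFDerivAt.const_smul c).mfderiv

theorem hamAt_const_mul (Ω : SymplecticForm E M) {f : M → ℝ} {x : M} (c : ℝ)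
    (hf : MDifferentiableAt 𝓘(ℝ, E) 𝓘(ℝ, ℝ) f x) :
    hamAt Ω (fun x => c * f x) x = c • hamAt Ω f x := by
  refine (eq_hamAt_of_forall Ω fun v => ?_).symm
  rw [differentialAt_const_mul c hf, map_smul, smul_apply, smul_apply, formAt_hamAt]

theorem hamAt_eq_zero_of_eventually (Ω : SymplecticForm E M) {f : M → ℝ} {x : M}
    (hf : f =ᶠ[𝓝 x] fun _ => 0) : hamAt Ω f x = 0 := by
  refine (eq_hamAt_of_forall Ω fun v => ?_).symm
  have : differentialAt (E := E) f x = 0 := by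
    have h : mfderiv 𝓘(ℝ, E) 𝓘(ℝ, ℝ) f x = mfderiv 𝓘(ℝ, E) 𝓘(ℝ, ℝ) (fun _ : M => (0 : ℝ)) x :=
      hf.mfderiv_eq
    exact h.trans mfderiv_const
  rw [this, map_zero]

/-! ### Families of functions -/

/-- The local expression, in the preferred chart at `x₀`, of a family of functions. -/
def chartFamily (x₀ : M) (F : ℝ → M → ℝ) (q : ℝ × E) : ℝ :=
  F q.1 ((extChartAt 𝓘(ℝ, E) x₀).symm q.2)

variable {S : Set ℝ} {F : ℝ → M → ℝ}

theorem contDiffOn_chartFamily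
    (hF : ContMDiffOn (𝓘(ℝ, ℝ).prod 𝓘(ℝ, E)) 𝓘(ℝ, ℝ) ∞ (fun q : ℝ × M => F q.1 q.2)
      (S ×ˢ univ)) (x₀ : M) :
    ContDiffOn ℝ ∞ (chartFamily x₀ F) (S ×ˢ (extChartAt 𝓘(ℝ, E) x₀).target) := by
  rw [← contMDiffOn_iff_contDiffOn]
  refine hF.comp (t := S ×ˢ univ) (ContMDiffOn.prodMk (contDiff_fst.contMDiff.contMDiffOn)
    ((contMDiffOn_chart_symm x₀).comp contDiff_snd.contMDiff.contMDiffOn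
      fun q hq => hq.2)) fun q hq => ⟨hq.1, mem_univ _⟩

theorem contMDiff_of_family
    (hF : ContMDiffOn (𝓘(ℝ, ℝ).prod 𝓘(ℝ, E)) 𝓘(ℝ, ℝ) ∞ (fun q : ℝ × M => F q.1 q.2)
      (S ×ˢ univ)) {t : ℝ} (ht : t ∈ S) : ContMDiff 𝓘(ℝ, E) 𝓘(ℝ, ℝ) ∞ (F t) := by
  rw [← contMDiffOn_univ]
  exact hF.comp (t := S ×ˢ univ) (contMDiff_const.prodMk contMDiff_id).contMDiffOn
    fun x _ => ⟨ht, mem_univ _⟩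

theorem mdifferentiableAt_of_family
    (hF : ContMDiffOn (𝓘(ℝ, ℝ).prod 𝓘(ℝ, E)) 𝓘(ℝ, ℝ) ∞ (fun q : ℝ × M => F q.1 q.2)
      (S ×ˢ univ)) {t : ℝ} (ht : t ∈ S) (x : M) :
    MDifferentiableAt 𝓘(ℝ, E) 𝓘(ℝ, ℝ) (F t) x :=
  (contMDiff_of_family hF ht).mdifferentiableAt (by simp)

theorem contDiffOn_chartField (Ω : SymplecticForm E M)
    (hF : ContMDiffOn (𝓘(ℝ, ℝ).prod 𝓘(ℝ, E)) 𝓘(ℝ, ℝ) ∞ (fun q : ℝ × M => F q.1 q.2)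
      (S ×ˢ univ)) (x₀ : M) :
    ContDiffOn ℝ ∞ (fun q : ℝ × E => chartField Ω x₀ (F q.1) q.2)
      (S ×ˢ (extChartAt 𝓘(ℝ, E) x₀).target) := by
  have hT : IsOpen (extChartAt 𝓘(ℝ, E) x₀).target := isOpen_extChartAt_target x₀
  rintro ⟨t, y⟩ ⟨ht, hy⟩
  have hB : ContDiffWithinAt ℝ ∞ (fun q : ℝ × E => (chartForm Ω.form x₀ q.2).inverse)
      (S ×ˢ (extChartAt 𝓘(ℝ, E) x₀).target) (t, y) := by
    have h1 := (Ω.isInvertible_chartForm hy).contDiffAt_map_inverse (n := ∞)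
    exact h1.comp_contDiffWithinAt (t, y)
      (((Ω.smooth' x₀) y hy).comp (t, y) contDiffWithinAt_snd (fun q hq => hq.2 : MapsTo Prod.snd (S ×ˢ (extChartAt 𝓘(ℝ, E) x₀).target) _))
  refine hB.clm_apply ?_
  have h2 : ContDiffWithinAt ℝ ∞ (fun q : ℝ × E =>
      fderivWithin ℝ (F q.1 ∘ (extChartAt 𝓘(ℝ, E) x₀).symm)
        (extChartAt 𝓘(ℝ, E) x₀).target q.2)
      (S ×ˢ (extChartAt 𝓘(ℝ, E) x₀).target) (t, y) := by
    refine ContDiffWithinAt.fderivWithin (n := ∞) (m := ∞)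
      (f := fun q : ℝ × E => F q.1 ∘ (extChartAt 𝓘(ℝ, E) x₀).symm) (g := Prod.snd)
      ?_ contDiffWithinAt_snd hT.uniqueDiffOn (by simp) ⟨ht, hy⟩ fun q hq => hq.2
    exact ((contDiffOn_chartFamily hF x₀) (t, y) ⟨ht, hy⟩).comp
      (((t, y), y) : (ℝ × E) × E) (f := fun p : (ℝ × E) × E => (p.1.1, p.2))
      (by fun_prop) fun p hp => ⟨hp.1.1, hp.2⟩
  refine h2.congr_of_mem (fun q hq => ?_) ⟨ht, hy⟩
  rw [fderivWithin_of_isOpen hT hq.2]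

end Charts

/-! ### Cutoffs and globally defined local expressions -/

section Cutoff

variable {E : Type u} [NormedAddCommGroup E] [NormedSpace ℝ E] [FiniteDimensional ℝ E]
  {F : Type u} [NormedAddCommGroup F] [NormedSpace ℝ F]

theorem exists_cutoff {y₀ : E} {T : Set E} (hT : T ∈ 𝓝 y₀) :
    ∃ χ : E → ℝ, ContDiff ℝ ∞ χ ∧ tsupport χ ⊆ T ∧ ∀ᶠ y in 𝓝 y₀, χ y = 1 := by
  obtain ⟨r, hr, hrT⟩ := Metric.nhds_basis_closedBall.mem_iff.1 hT
  let χ : ContDiffBump y₀ := ⟨r / 2, r, by positivity, by linarith⟩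
  exact ⟨χ, χ.contDiff, by rwa [χ.tsupport_eq], χ.eventuallyEq_one⟩

theorem contDiffOn_cutoff_smul {P : Type*} [NormedAddCommGroup P] [NormedSpace ℝ P] {n : ℕ}
    {F : Type*} [NormedAddCommGroup F] [NormedSpace ℝ F]
    {χ : E → ℝ} (hχ : ContDiff ℝ ∞ χ) {T : Set E} (hT : IsOpen T) (hs : tsupport χ ⊆ T)
    {S : Set P} {f : P × E → F} (hf : ContDiffOn ℝ n f (S ×ˢ T)) :
    ContDiffOn ℝ n (fun q => χ q.2 • f q) (S ×ˢ univ) := by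
  rintro ⟨t, y⟩ ⟨ht, -⟩
  have hχ' : ContDiff ℝ n χ := hχ.of_le (by exact_mod_cast le_top)
  by_cases hy : y ∈ T
  · have h1 : ContDiffWithinAt ℝ n (fun q : P × E => χ q.2 • f q) (S ×ˢ T) (t, y) :=
      ((hχ'.comp contDiff_snd).contDiffWithinAt).smul (hf (t, y) ⟨ht, hy⟩)
    refine h1.mono_of_mem_nhdsWithin ?_
    filter_upwards [self_mem_nhdsWithin, nhdsWithin_le_nhds
      (prod_mem_nhds Filter.univ_mem (hT.mem_nhds hy))] with q hq hq'
    exact ⟨hq.1, hq'.2⟩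
  · have h0 : (fun q : P × E => χ q.2 • f q) =ᶠ[𝓝 (t, y)] fun _ => 0 := by
      have : (tsupport χ)ᶜ ∈ 𝓝 y :=
        (isClosed_tsupport χ).isOpen_compl.mem_nhds fun h => hy (hs h)
      filter_upwards [prod_mem_nhds Filter.univ_mem this] with q hq
      rw [image_eq_zero_of_notMem_tsupport hq.2, zero_smul]
    exact (contDiffAt_const.congr_of_eventuallyEq h0).contDiffWithinAt

/-- The flow construction needs a field on all of ℝ × E. Cutting off in space and reflecting in time
provides one, equal to f near y₀ simultaneously for all t in [0,1]. -/
theorem exists_contDiff_extension_near {n : ℕ} {y₀ : E} {T : Set E} (hT : IsOpen T) (hy₀ : y₀ ∈ T)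
    {f : ℝ × E → F} (hf : ContDiffOn ℝ n f (Icc 0 1 ×ˢ T)) :
    ∃ g : ℝ × E → F, ContDiff ℝ n g ∧ ∀ᶠ y in 𝓝 y₀, ∀ t ∈ Icc (0 : ℝ) 1, g (t, y) = f (t, y) := by
  obtain ⟨χ, hχ, hs, h1⟩ := exists_cutoff (hT.mem_nhds hy₀)
  obtain ⟨g, hg, hgf⟩ := exists_contDiff_extension.{u, u} (contDiffOn_cutoff_smul hχ hT hs hf)
  refine ⟨g, hg, ?_⟩
  filter_upwards [h1] with y hy t ht
  rw [hgf (show ((t, y) : ℝ × E) ∈ Icc 0 1 ×ˢ univ from ⟨ht, mem_univ _⟩)]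
  simp [hy]

theorem exists_contDiff_eventually_eq {n : ℕ} {y₀ : E} {T : Set E} (hT : IsOpen T) (hy₀ : y₀ ∈ T)
    {f : ℝ × E → F} (hf : ContDiffOn ℝ n f (univ ×ˢ T)) :
    ∃ g : ℝ × E → F, ContDiff ℝ n g ∧ ∀ᶠ y in 𝓝 y₀, ∀ t, g (t, y) = f (t, y) := by
  obtain ⟨χ, hχ, hs, h1⟩ := exists_cutoff (hT.mem_nhds hy₀)
  have := contDiffOn_cutoff_smul hχ hT hs hf
  rw [univ_prod_univ, contDiffOn_univ] at this
  refine ⟨_, this, ?_⟩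
  filter_upwards [h1] with y hy t
  simp [hy]

/-- Curves close in sup norm to the constant x₀ stay in W at all times. This keeps solutions where
the extended field is the true one. -/
theorem eventually_extendCurve_mem {E : Type*} [NormedAddCommGroup E] [NormedSpace ℝ E]
    {Y : ℝ × E → C(TimeInterval, E)} {x₀ : E} (hY : ContinuousAt Y (0, x₀))
    (h0 : Y (0, x₀) = ContinuousMap.const _ x₀) {W : Set E} (hW : W ∈ 𝓝 x₀) :
    ∀ᶠ q in 𝓝 ((0 : ℝ), x₀), ∀ σ, extendCurve (Y q) σ ∈ W := by
  obtain ⟨r, hr, hrW⟩ := Metric.mem_nhds_iff.1 hW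
  have h := hY (Metric.ball_mem_nhds (Y (0, x₀)) hr)
  filter_upwards [h] with q hq σ
  refine hrW ?_
  have h1 := norm_extendCurve_sub_le (Y q) (Y (0, x₀)) σ
  have h2 : extendCurve (Y (0, x₀)) σ = x₀ := by rw [h0]; rfl
  rw [h2] at h1
  rw [mem_ball_iff_norm]
  have h3 : dist (Y q) (Y (0, x₀)) < r := hq
  rw [dist_eq_norm] at h3
  exact h1.trans_lt h3

end Cutoff

/-! ### Velocities of curves in a manifold -/

section Velocity

variable {E : Type u} [NormedAddCommGroup E] [NormedSpace ℝ E]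
  {M : Type*} [TopologicalSpace M] [ChartedSpace E M]

/-- The curve `γ` has velocity `v` at `t` within `s`. -/
def HasVelocityWithinAt (γ : ℝ → M) (v : E) (s : Set ℝ) (t : ℝ) : Prop :=
  HasMFDerivWithinAt 𝓘(ℝ, ℝ) 𝓘(ℝ, E) γ s t
    ((1 : ℝ →L[ℝ] ℝ).smulRight (v : TangentSpace 𝓘(ℝ, E) (γ t)))

/-- The curve `γ` has velocity `v` at `t`. -/
def HasVelocityAt (γ : ℝ → M) (v : E) (t : ℝ) : Prop :=
  HasMFDerivAt 𝓘(ℝ, ℝ) 𝓘(ℝ, E) γ t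
    ((1 : ℝ →L[ℝ] ℝ).smulRight (v : TangentSpace 𝓘(ℝ, E) (γ t)))

theorem HasVelocityAt.hasVelocityWithinAt {γ : ℝ → M} {v : E} {s : Set ℝ} {t : ℝ}
    (h : HasVelocityAt γ v t) : HasVelocityWithinAt γ v s t :=
  HasMFDerivAt.hasMFDerivWithinAt h

variable [IsManifold 𝓘(ℝ, E) ∞ M]

theorem hasVelocityAt_chart_symm {x₀ : M} {y : ℝ → E} {v : E} {t : ℝ}
    (h : HasDerivAt y v t) (hy : y t ∈ (extChartAt 𝓘(ℝ, E) x₀).target) :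
    HasVelocityAt (fun s => (extChartAt 𝓘(ℝ, E) x₀).symm (y s)) (chartSymmDeriv x₀ (y t) v) t := by
  have h1 := (hasMFDerivAt_chart_symm hy).comp t h.hasFDerivAt.hasMFDerivAt
  refine h1.congr_mfderiv ?_
  refine ContinuousLinearMap.ext_ring ?_
  show chartSymmDeriv x₀ (y t) ((1 : ℝ) • v) = (1 : ℝ) • chartSymmDeriv x₀ (y t) v
  rw [one_smul, one_smul]

end Velocity

/-! ### Short Hamiltonian flows on the manifold -/

section LocalFlowCharts

variable {E : Type u} [NormedAddCommGroup E] [NormedSpace ℝ E] [FiniteDimensional ℝ E]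
  {M : Type*} [TopologicalSpace M] [ChartedSpace E M] [IsManifold 𝓘(ℝ, E) ∞ M]

/-- The Hamiltonian flows of a smooth family of functions depend smoothly on time, on the parameter
of the family, and on the initial value, for short times. -/
theorem exists_contMDiffAt_shortFlow (Ω : SymplecticForm E M) {F : ℝ → M → ℝ}
    (hF : ContMDiffOn (𝓘(ℝ, ℝ).prod 𝓘(ℝ, E)) 𝓘(ℝ, ℝ) ∞ (fun q : ℝ × M => F q.1 q.2)
      (Icc 0 1 ×ˢ univ)) {n : ℕ} (hn : n ≠ 0) {t₀ : ℝ} (x₀ : M) :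
    ∃ Z : ℝ × ℝ × M → M,
      ContMDiffAt (𝓘(ℝ, ℝ).prod (𝓘(ℝ, ℝ).prod 𝓘(ℝ, E))) 𝓘(ℝ, E) n Z (0, t₀, x₀) ∧
      ∀ᶠ q in 𝓝 ((0 : ℝ), t₀, x₀), q.2.1 ∈ Icc (0 : ℝ) 1 → ∃ c : ℝ → M, c 0 = q.2.2 ∧ c 1 = Z q ∧
        ∀ σ ∈ Ioo (-2 : ℝ) 2, HasVelocityAt c (q.1 • hamAt Ω (F q.2.1) (c σ)) σ := by
  set e := extChartAt 𝓘(ℝ, E) x₀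
  have hT : IsOpen e.target := isOpen_extChartAt_target x₀
  have hy₀ : e x₀ ∈ e.target := mem_extChartAt_target x₀
  obtain ⟨g, hg, hgf⟩ := exists_contDiff_extension_near hT hy₀
    ((contDiffOn_chartField Ω hF x₀).of_le (m := n) (by exact_mod_cast le_top))
  -- The parameter t is an additional coordinate with zero velocity, so that dependence on the
  -- parameter becomes dependence on the initial value.
  obtain ⟨Y, hY, hY0, hode⟩ := exists_contDiffAt_rescaledFlow hn
    (f := fun q : ℝ × E => ((0 : ℝ), g q)) (contDiff_const.prodMk hg) (t₀, e x₀)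
  let ev : C(TimeInterval, ℝ × E) →L[ℝ] ℝ × E := ContinuousMap.evalCLM ℝ ⟨1, by norm_num⟩
  have hsrc : e.source ∈ 𝓝 x₀ := extChartAt_source_mem_nhds x₀
  let toChart : ℝ × ℝ × M → ℝ × ℝ × E := fun q => (q.1, q.2.1, e q.2.2)
  have htoChart : ContMDiffAt (𝓘(ℝ, ℝ).prod (𝓘(ℝ, ℝ).prod 𝓘(ℝ, E))) 𝓘(ℝ, ℝ × ℝ × E) ∞ toChart
      (0, t₀, x₀) := by
    refine contMDiffAt_fst.prodMk_space ((contMDiffAt_fst.comp _ contMDiffAt_snd).prodMk_space ?_)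
    exact ContMDiffAt.comp (g := e) ((0, t₀, x₀) : ℝ × ℝ × M)
      ((contMDiffOn_chart x₀).contMDiffAt hsrc) (contMDiffAt_snd.comp _ contMDiffAt_snd)
  have hsnd : ContMDiffAt 𝓘(ℝ, ℝ × ℝ × E) 𝓘(ℝ, E) n (fun q => (ev (Y q)).2) (0, t₀, e x₀) :=
    (contDiffAt_snd.comp _ (ev.contDiff.contDiffAt.comp _ hY)).contMDiffAt
  have hbase : (ev (Y (0, t₀, e x₀))).2 = e x₀ := by rw [hY0]; rfl
  refine ⟨fun q => e.symm (ev (Y (toChart q))).2, ?_, ?_⟩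
  · refine ContMDiffAt.comp_of_eq (I' := 𝓘(ℝ, E)) (g := e.symm) (y := e x₀)
      (f := fun q => (ev (Y (toChart q))).2)
      (((contMDiffOn_chart_symm x₀).contMDiffAt (hT.mem_nhds hy₀)).of_le
        (by exact_mod_cast le_top)) ?_ hbase
    exact ContMDiffAt.comp (g := fun q => (ev (Y q)).2) (f := toChart) _ hsnd
      (htoChart.of_le (by exact_mod_cast le_top))
  · have hW : {p : ℝ × E | p.2 ∈ e.target ∧ ∀ t ∈ Icc (0 : ℝ) 1,
        g (t, p.2) = chartField Ω x₀ (F t) p.2} ∈ 𝓝 (t₀, e x₀) :=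
      (continuous_snd.tendsto (t₀, e x₀)).eventually ((hT.eventually_mem hy₀).and hgf)
    have hev := htoChart.continuousAt.eventually
      (hode.and (eventually_extendCurve_mem hY.continuousAt hY0 hW))
    have hxs : ∀ᶠ q : ℝ × ℝ × M in 𝓝 (0, t₀, x₀), q.2.2 ∈ e.source :=
      (continuousAt_snd.comp continuousAt_snd).eventually hsrc
    filter_upwards [hev, hxs] with q ⟨⟨hq0, hqode⟩, hqmem⟩ hqs hqt
    set α := extendCurve (Y (toChart q))
    have hfst : ∀ σ ∈ Ioo (-2 : ℝ) 2, (α σ).1 = q.2.1 := by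
      have hd : ∀ σ ∈ Ioo (-2 : ℝ) 2, HasDerivAt (fun σ => (α σ).1) 0 σ := by
        intro σ hσ
        have h := (hqode σ hσ).hasFDerivAt.fst.hasDerivAt
        simpa using h
      intro σ hσ
      have h0 : (0 : ℝ) ∈ Ioo (-2 : ℝ) 2 := by norm_num
      have : (α σ).1 = (α 0).1 := isOpen_Ioo.is_const_of_deriv_eq_zero isPreconnected_Ioo
        (fun σ hσ => (hd σ hσ).differentiableAt.differentiableWithinAt)
        (fun σ hσ => (hd σ hσ).deriv) hσ h0
      rw [this, hq0]
    refine ⟨fun σ => e.symm (α σ).2, ?_, ?_, fun σ hσ => ?_⟩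
    · simp only [hq0]
      exact e.left_inv hqs
    · show e.symm (extendCurve (Y (toChart q)) 1).2 = _
      rw [extendCurve_of_mem _ (by norm_num)]
      rfl
    · have h := (hqode σ hσ).hasFDerivAt.snd.hasDerivAt
      have h' : HasDerivAt (fun σ => (α σ).2) (q.1 • g (α σ)) σ := by simpa [toChart] using h
      have hv := hasVelocityAt_chart_symm (x₀ := x₀) h' (hqmem σ).1
      have hα : α σ = (q.2.1, (α σ).2) := by rw [← hfst σ hσ]
      rw [hα, (hqmem σ).2 _ hqt, map_smul, chartSymmDeriv_chartField Ω (hqmem σ).1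
        (mdifferentiableAt_of_family hF hqt _)] at hv
      exact hv

end LocalFlowCharts

/-! ### A criterion for completeness of vector fields -/

section Completeness

variable {E : Type*} [NormedAddCommGroup E] [NormedSpace ℝ E] [CompleteSpace E]
  {H : Type*} [TopologicalSpace H] {I : ModelWithCorners ℝ E H}
  {N : Type*} [TopologicalSpace N] [ChartedSpace H N] [IsManifold I 1 N]
  [BoundarylessManifold I N] [T2Space N]

/-- A vector field with uniform existence times off a compact set, and locally uniform existence
times on this compact set, is complete. -/
theorem exists_isMIntegralCurve_of_isCompact {v : (x : N) → TangentSpace I x}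
    (hv : ContMDiff I I.tangent 1 (fun x => (⟨x, v x⟩ : TangentBundle I N))) {K : Set N}
    (hK : IsCompact K)
    (hin : ∀ x ∈ K, ∃ δ > 0, ∀ᶠ x' in 𝓝 x, ∃ γ : ℝ → N, γ 0 = x' ∧
      IsMIntegralCurveOn γ v (Ioo (-δ) δ))
    (hout : ∃ δ > 0, ∀ x ∉ K, ∃ γ : ℝ → N, γ 0 = x ∧ IsMIntegralCurveOn γ v (Ioo (-δ) δ)) (x : N) :
    ∃ γ : ℝ → N, γ 0 = x ∧ IsMIntegralCurve γ v := by
  have key : ∃ δ > 0, ∀ x ∈ K, ∃ γ : ℝ → N, γ 0 = x ∧ IsMIntegralCurveOn γ v (Ioo (-δ) δ) := by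
    refine hK.induction_on (p := fun A => ∃ δ > 0, ∀ x ∈ A, ∃ γ : ℝ → N, γ 0 = x ∧
      IsMIntegralCurveOn γ v (Ioo (-δ) δ)) ⟨1, one_pos, fun x hx => hx.elim⟩ ?_ ?_ ?_
    · rintro A B hAB ⟨δ, hδ, h⟩
      exact ⟨δ, hδ, fun x hx => h x (hAB hx)⟩
    · rintro A B ⟨δ, hδ, h⟩ ⟨δ', hδ', h'⟩
      refine ⟨min δ δ', lt_min hδ hδ', fun x hx => ?_⟩
      rcases hx with hx | hx
      · obtain ⟨γ, h0, hγ⟩ := h x hx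
        exact ⟨γ, h0, hγ.mono (Ioo_subset_Ioo (neg_le_neg (min_le_left _ _)) (min_le_left _ _))⟩
      · obtain ⟨γ, h0, hγ⟩ := h' x hx
        exact ⟨γ, h0, hγ.mono (Ioo_subset_Ioo (neg_le_neg (min_le_right _ _)) (min_le_right _ _))⟩
    · intro x hx
      obtain ⟨δ, hδ, h⟩ := hin x hx
      exact ⟨_, mem_nhdsWithin_of_mem_nhds h, δ, hδ, fun x' hx' => hx'⟩
  obtain ⟨δ, hδ, h⟩ := key
  obtain ⟨δ', hδ', h'⟩ := hout
  refine exists_isMIntegralCurve_of_isMIntegralCurveOn hv (lt_min hδ hδ') (fun x => ?_) x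
  by_cases hx : x ∈ K
  · obtain ⟨γ, h0, hγ⟩ := h x hx
    exact ⟨γ, h0, hγ.mono (Ioo_subset_Ioo (neg_le_neg (min_le_left _ _)) (min_le_left _ _))⟩
  · obtain ⟨γ, h0, hγ⟩ := h' x hx
    exact ⟨γ, h0, hγ.mono (Ioo_subset_Ioo (neg_le_neg (min_le_right _ _)) (min_le_right _ _))⟩

end Completeness

/-! ### Global flows of compactly supported Hamiltonians -/

section Flow

variable {E : Type u} [NormedAddCommGroup E] [NormedSpace ℝ E] [FiniteDimensional ℝ E]
  {M : Type*} [TopologicalSpace M] [ChartedSpace E M] [IsManifold 𝓘(ℝ, E) ∞ M]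

/-- Read in the trivialization at x₀, the section is `chartField`, which is smooth in parameter and
point. -/
theorem contMDiffOn_hamField (Ω : SymplecticForm E M) {S : Set ℝ} {F : ℝ → M → ℝ}
    (hF : ContMDiffOn (𝓘(ℝ, ℝ).prod 𝓘(ℝ, E)) 𝓘(ℝ, ℝ) ∞ (fun q : ℝ × M => F q.1 q.2)
      (S ×ˢ univ)) :
    ContMDiffOn (𝓘(ℝ, ℝ).prod 𝓘(ℝ, E)) 𝓘(ℝ, E).tangent ∞
      (fun q : ℝ × M => (⟨q.2, hamField Ω (F q.1) q.2⟩ : TangentBundle 𝓘(ℝ, E) M))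
      (S ×ˢ univ) := by
  have h1 : IsManifold 𝓘(ℝ, E) 1 M := IsManifold.of_le (n := ∞) (by simp)
  have h2 : IsManifold 𝓘(ℝ, E) (∞ + 1) M := by simpa
  rintro ⟨t₀, x₀⟩ ⟨ht₀, -⟩
  refine Bundle.contMDiffWithinAt_totalSpace.2 ⟨contMDiffWithinAt_snd, ?_⟩
  set e := extChartAt 𝓘(ℝ, E) x₀
  have hsrc : e.source ∈ 𝓝 x₀ := extChartAt_source_mem_nhds x₀
  have hx₀ : x₀ ∈ e.source := mem_extChartAt_source x₀
  have hsm : ContMDiffWithinAt (𝓘(ℝ, ℝ).prod 𝓘(ℝ, E)) 𝓘(ℝ, E) ∞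
      (fun q : ℝ × M => chartField Ω x₀ (F q.1) (e q.2)) (S ×ˢ e.source) (t₀, x₀) := by
    have h := (contDiffOn_chartField Ω hF x₀ (t₀, e x₀)
      ⟨ht₀, mem_extChartAt_target x₀⟩).contMDiffWithinAt
    refine ContMDiffWithinAt.comp (I' := 𝓘(ℝ, ℝ × E)) (t₀, x₀)
      (g := fun q : ℝ × E => chartField Ω x₀ (F q.1) q.2) (f := fun q : ℝ × M => (q.1, e q.2)) h
      (contMDiffWithinAt_fst.prodMk_space ?_) fun q hq => ⟨hq.1, e.map_source hq.2⟩
    exact (contMDiffOn_chart x₀ x₀ hx₀).comp (t₀, x₀) contMDiffWithinAt_snd fun q hq => hq.2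
  have hsm' : ContMDiffWithinAt (𝓘(ℝ, ℝ).prod 𝓘(ℝ, E)) 𝓘(ℝ, E) ∞
      (fun q : ℝ × M => chartField Ω x₀ (F q.1) (e q.2)) (S ×ˢ univ) (t₀, x₀) := by
    refine hsm.mono_of_mem_nhdsWithin ?_
    filter_upwards [self_mem_nhdsWithin, nhdsWithin_le_nhds
      (prod_mem_nhds Filter.univ_mem hsrc)] with q hq hq' using ⟨hq.1, hq'.2⟩
  have heq : ∀ q ∈ S ×ˢ e.source, (trivializationAt E (TangentSpace 𝓘(ℝ, E)) x₀
      (⟨q.2, hamField Ω (F q.1) q.2⟩ : TangentBundle 𝓘(ℝ, E) M)).2 =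
        chartField Ω x₀ (F q.1) (e q.2) := by
    rintro ⟨t, x⟩ ⟨ht, hx⟩
    have hx' : x ∈ (chartAt E x₀).source := by simpa [e] using hx
    have h3 : (trivializationAt E (TangentSpace 𝓘(ℝ, E)) x₀
      (⟨x, hamField Ω (F t) x⟩ : TangentBundle 𝓘(ℝ, E) M)).2 =
      (trivializationAt E (TangentSpace 𝓘(ℝ, E)) x₀).continuousLinearMapAt ℝ x
        (hamField Ω (F t) x) := by
      rw [Bundle.Trivialization.continuousLinearMapAt_apply,
        Bundle.Trivialization.linearMapAt_apply, if_pos (by simpa using hx')]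
    rw [h3, TangentBundle.continuousLinearMapAt_trivializationAt hx']
    have h4 := chartDeriv_hamAt Ω (x₀ := x₀) (f := F t) (e.map_source hx)
      (mdifferentiableAt_of_family hF ht _)
    rw [e.left_inv hx] at h4
    exact h4
  refine hsm'.congr_of_eventuallyEq ?_ (heq (t₀, x₀) ⟨ht₀, hx₀⟩)
  filter_upwards [self_mem_nhdsWithin, nhdsWithin_le_nhds
      (prod_mem_nhds Filter.univ_mem hsrc)] with q hq hq' using heq q ⟨hq.1, hq'.2⟩

variable (Ω : SymplecticForm E M) {F : ℝ → M → ℝ}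

theorem contMDiff_hamField {g : M → ℝ} (hg : ContMDiff 𝓘(ℝ, E) 𝓘(ℝ, ℝ) ∞ g) :
    ContMDiff 𝓘(ℝ, E) 𝓘(ℝ, E).tangent 1
      (fun x => (⟨x, hamField Ω g x⟩ : TangentBundle 𝓘(ℝ, E) M)) := by
  have h1 := contMDiffOn_hamField Ω (S := univ) (F := fun _ => g)
    (hg.comp contMDiff_snd).contMDiffOn
  rw [univ_prod_univ, contMDiffOn_univ] at h1
  exact (h1.comp (contMDiff_const (c := (0 : ℝ)).prodMk contMDiff_id)).of_le
    (by exact_mod_cast le_top)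

variable [T2Space M]

theorem contMDiffOn_const_family {g : M → ℝ} (hg : ContMDiff 𝓘(ℝ, E) 𝓘(ℝ, ℝ) ∞ g) :
    ContMDiffOn (𝓘(ℝ, ℝ).prod 𝓘(ℝ, E)) 𝓘(ℝ, ℝ) ∞ (fun q : ℝ × M => g q.2)
      (Icc 0 1 ×ˢ univ) :=
  (hg.comp contMDiff_snd).contMDiffOn

theorem hamField_eq_zero_of_notMem {K : Set M} (hK : IsCompact K) {g : M → ℝ}
    (h0 : ∀ x ∉ K, g x = 0) {x : M} (hx : x ∉ K) : hamField Ω g x = 0 :=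
  hamAt_eq_zero_of_eventually Ω
    (Filter.eventually_of_mem (hK.isClosed.isOpen_compl.mem_nhds hx) h0)

/-- Off K the field vanishes and constant curves serve. Near a point of K one fixed rescaling factor
a > 0 works for all nearby initial points. -/
theorem exists_isMIntegralCurve_hamField {g : M → ℝ} (hg : ContMDiff 𝓘(ℝ, E) 𝓘(ℝ, ℝ) ∞ g)
    {K : Set M} (hK : IsCompact K) (h0 : ∀ x ∉ K, g x = 0) (x : M) :
    ∃ γ : ℝ → M, γ 0 = x ∧ IsMIntegralCurve (I := 𝓘(ℝ, E)) γ (hamField Ω g) := by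
  have h1 : IsManifold 𝓘(ℝ, E) 1 M := IsManifold.of_le (n := ∞) (by simp)
  refine exists_isMIntegralCurve_of_isCompact (contMDiff_hamField Ω hg) hK (fun x hx => ?_)
    ⟨1, one_pos, fun x hx => ⟨fun _ => x, rfl,
      (isMIntegralCurve_const (hamField_eq_zero_of_notMem Ω hK h0 hx)).isMIntegralCurveOn _⟩⟩ x
  obtain ⟨Z, -, hZ⟩ := exists_contMDiffAt_shortFlow Ω (F := fun _ => g)
    (contMDiffOn_const_family hg) one_ne_zero
    (t₀ := 0) x
  have h2 := hZ.curry_nhds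
  have h3 : ∃ a > (0 : ℝ), ∀ᶠ y : ℝ × M in 𝓝 (0, x), y.1 ∈ Icc (0 : ℝ) 1 →
      ∃ c : ℝ → M, c 0 = y.2 ∧ c 1 = Z (a, y) ∧
        ∀ σ ∈ Ioo (-2 : ℝ) 2, HasVelocityAt c (a • hamAt Ω g (c σ)) σ := by
    obtain ⟨a, ha, h⟩ := (h2.filter_mono nhdsWithin_le_nhds |>.and
      (self_mem_nhdsWithin : Ioi (0 : ℝ) ∈ 𝓝[>] 0)).exists
    exact ⟨a, h, ha⟩
  obtain ⟨a, ha, h4⟩ := h3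
  refine ⟨a, ha, ?_⟩
  filter_upwards [h4.curry_nhds.self_of_nhds] with x' hx'
  obtain ⟨c, hc0, -, hc⟩ := hx' (by norm_num)
  -- The curve c follows a times the field on (-2, 2); slowed down by a, it follows the field itself
  -- on (-2a, 2a), which contains (-a, a).
  refine ⟨c ∘ (· * a⁻¹), by simp [hc0], ?_⟩
  have h5 : IsMIntegralCurveOn (I := 𝓘(ℝ, E)) c (a • hamField Ω g) (Ioo (-2) 2) :=
    fun σ hσ => (hc σ hσ).hasMFDerivWithinAt
  have h6 := h5.comp_mul a⁻¹
  rw [smul_smul, inv_mul_cancel₀ ha.ne', one_smul] at h6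
  refine h6.mono fun s hs => ⟨?_, ?_⟩
  · have : -1 < s * a⁻¹ := by
      rw [← div_eq_mul_inv, lt_div_iff₀ ha]; linarith [hs.1]
    linarith
  · have : s * a⁻¹ < 1 := by
      rw [← div_eq_mul_inv, div_lt_iff₀ ha]; linarith [hs.2]
    linarith

/-- A smooth function with compact support, the Hamiltonian of a complete flow. -/
structure IsCompactHamiltonian (g : M → ℝ) : Prop where
  smooth : ContMDiff 𝓘(ℝ, E) 𝓘(ℝ, ℝ) ∞ g
  compactSupport : ∃ K : Set M, IsCompact K ∧ ∀ x ∉ K, g x = 0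

theorem IsTimeDepHamiltonian.isCompactHamiltonian (hF : IsTimeDepHamiltonian E F) {t : ℝ}
    (ht : t ∈ Icc (0 : ℝ) 1) : IsCompactHamiltonian (E := E) (F t) where
  smooth := contMDiff_of_family hF.smooth ht
  compactSupport := let ⟨K, hK, h⟩ := hF.compactSupport; ⟨K, hK, h t ht⟩

variable {g : M → ℝ}

/-- Uniqueness of integral curves makes the choice in `flow` immaterial. -/
theorem flow_eq (hg : IsCompactHamiltonian (E := E) g) {γ : ℝ → M}
    (hγ : IsMIntegralCurve (I := 𝓘(ℝ, E)) γ (hamField Ω g)) (s : ℝ) :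
    flow (hamField Ω g) s (γ 0) = γ s := by
  have h1 : IsManifold 𝓘(ℝ, E) 1 M := IsManifold.of_le (n := ∞) (by simp)
  have h : ∃ γ' : ℝ → M, γ' 0 = γ 0 ∧ IsMIntegralCurve (I := 𝓘(ℝ, E)) γ' (hamField Ω g) :=
    ⟨γ, rfl, hγ⟩
  rw [flow, dif_pos h]
  exact congrFun (isMIntegralCurve_Ioo_eq_of_contMDiff_boundaryless (t₀ := 0)
    (contMDiff_hamField Ω hg.smooth) (Classical.choose_spec h).2 hγ (Classical.choose_spec h).1) s

theorem isMIntegralCurve_flow (hg : IsCompactHamiltonian (E := E) g) (x : M) :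
    IsMIntegralCurve (I := 𝓘(ℝ, E)) (fun s => flow (hamField Ω g) s x) (hamField Ω g) := by
  obtain ⟨K, hK, h0⟩ := hg.compactSupport
  obtain ⟨γ, rfl, hγ⟩ := exists_isMIntegralCurve_hamField Ω hg.smooth hK h0 x
  have : (fun s => flow (hamField Ω g) s (γ 0)) = γ := funext (flow_eq Ω hg hγ)
  rwa [this]

theorem flow_zero (hg : IsCompactHamiltonian (E := E) g) (x : M) :
    flow (hamField Ω g) 0 x = x := by
  obtain ⟨K, hK, h0⟩ := hg.compactSupport
  obtain ⟨γ, rfl, hγ⟩ := exists_isMIntegralCurve_hamField Ω hg.smooth hK h0 x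
  exact flow_eq Ω hg hγ 0

theorem flow_add (hg : IsCompactHamiltonian (E := E) g) (s s' : ℝ) (x : M) :
    flow (hamField Ω g) (s + s') x = flow (hamField Ω g) s (flow (hamField Ω g) s' x) := by
  have h := flow_eq Ω hg ((isMIntegralCurve_flow Ω hg x).comp_add s') s
  simpa using h.symm

theorem flow_of_notMem (hg : IsCompactHamiltonian (E := E) g) {K : Set M} (hK : IsCompact K)
    (h0 : ∀ x ∉ K, g x = 0) {x : M} (hx : x ∉ K) (s : ℝ) : flow (hamField Ω g) s x = x :=
  flow_eq Ω hg (γ := fun _ => x)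
    (isMIntegralCurve_const (hamField_eq_zero_of_notMem Ω hK h0 hx)) s

theorem hamField_const_mul_eq (hg : IsCompactHamiltonian (E := E) g) (a : ℝ) :
    hamField Ω (fun x => a * g x) = a • hamField Ω g :=
  funext fun _ => hamAt_const_mul Ω a (hg.smooth.mdifferentiableAt (by simp))

theorem IsCompactHamiltonian.const_mul (hg : IsCompactHamiltonian (E := E) g) (a : ℝ) :
    IsCompactHamiltonian (E := E) (fun x => a * g x) where
  smooth := contMDiff_const.mul hg.smooth
  compactSupport := let ⟨K, hK, h⟩ := hg.compactSupport; ⟨K, hK, fun x hx => by rw [h x hx, mul_zero]⟩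

theorem flow_const_mul (hg : IsCompactHamiltonian (E := E) g) (a s : ℝ) (x : M) :
    flow (hamField Ω (fun x => a * g x)) s x = flow (hamField Ω g) (s * a) x := by
  have h := (isMIntegralCurve_flow Ω hg x).comp_mul a
  rw [← hamField_const_mul_eq Ω hg] at h
  have h2 := flow_eq Ω (hg.const_mul a) h s
  simpa [flow_zero Ω hg] using h2

/-- Identifies the short curves found by the implicit function theorem with the global flow, which
thereby inherits their smoothness near time 0. -/
theorem eq_flow_of_hasVelocityAt (hg : IsCompactHamiltonian (E := E) g) {a : ℝ} {c : ℝ → M}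
    (hc : ∀ σ ∈ Ioo (-2 : ℝ) 2, HasVelocityAt c (a • hamAt Ω g (c σ)) σ) :
    c 1 = flow (hamField Ω g) a (c 0) := by
  have h1 : IsManifold 𝓘(ℝ, E) 1 M := IsManifold.of_le (n := ∞) (by simp)
  have h2 : IsMIntegralCurveOn (I := 𝓘(ℝ, E)) c (hamField Ω fun x => a * g x) (Ioo (-2) 2) := by
    rw [hamField_const_mul_eq Ω hg]
    exact fun σ hσ => (hc σ hσ).hasMFDerivWithinAt
  have h3 := isMIntegralCurveOn_Ioo_eqOn_of_contMDiff_boundaryless (t₀ := 0) (by norm_num)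
    (contMDiff_hamField Ω (hg.const_mul a).smooth) h2
    ((isMIntegralCurve_flow Ω (hg.const_mul a) (c 0)).isMIntegralCurveOn _)
    (flow_zero Ω (hg.const_mul a) _).symm
  have h4 := flow_const_mul Ω hg a 1 (c 0)
  rw [one_mul] at h4
  exact (h3 (by norm_num : (1 : ℝ) ∈ Ioo (-2) 2)).trans h4

end Flow

/-! ### Joint smoothness of flows at all times -/

section SmoothFlow

variable {E : Type u} [NormedAddCommGroup E] [NormedSpace ℝ E] [FiniteDimensional ℝ E]
  {M : Type*} [TopologicalSpace M] [ChartedSpace E M] [IsManifold 𝓘(ℝ, E) ∞ M] [T2Space M]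
  (Ω : SymplecticForm E M) {F : ℝ → M → ℝ}

/-- The flows of a family of Hamiltonians, as a function of time, parameter and initial value. -/
def familyFlow (F : ℝ → M → ℝ) (q : ℝ × ℝ × M) : M := flow (hamField Ω (F q.2.1)) q.1 q.2.2

/-- The domain of smoothness of the flows of a family of Hamiltonians. -/
abbrev flowDomain (M : Type*) : Set (ℝ × ℝ × M) := univ ×ˢ Icc (0 : ℝ) 1 ×ˢ univ

theorem contMDiffWithinAt_familyFlow_zero (hF : IsTimeDepHamiltonian E F) {n : ℕ} (hn : n ≠ 0)
    {t₀ : ℝ} (ht₀ : t₀ ∈ Icc (0 : ℝ) 1) (x₀ : M) :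
    ContMDiffWithinAt (𝓘(ℝ, ℝ).prod (𝓘(ℝ, ℝ).prod 𝓘(ℝ, E))) 𝓘(ℝ, E) n (familyFlow Ω F)
      (flowDomain M) (0, t₀, x₀) := by
  obtain ⟨Z, hZ, hc⟩ := exists_contMDiffAt_shortFlow Ω hF.smooth hn (t₀ := t₀) x₀
  have h : ∀ᶠ q in 𝓝 ((0 : ℝ), t₀, x₀), q.2.1 ∈ Icc (0 : ℝ) 1 → familyFlow Ω F q = Z q := by
    filter_upwards [hc] with q hq hqt
    obtain ⟨c, hc0, hc1, hv⟩ := hq hqt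
    rw [← hc1, eq_flow_of_hasVelocityAt Ω (hF.isCompactHamiltonian hqt) hv, hc0]
    rfl
  refine hZ.contMDiffWithinAt.congr_of_eventuallyEq ?_ (h.self_of_nhds ht₀)
  filter_upwards [nhdsWithin_le_nhds h, self_mem_nhdsWithin] with q hq hqS using hq hqS.2.1

/-- The set A of times at which the flow is smooth contains 0. The group law shows that it is open
and closed: the flow at times near s'' is the flow at times near s'' - s', smooth because that is
close to 0, after the flow at time s'. -/
theorem contMDiffWithinAt_familyFlow (hF : IsTimeDepHamiltonian E F) {n : ℕ} (hn : n ≠ 0)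
    (s₀ : ℝ) {t₀ : ℝ} (ht₀ : t₀ ∈ Icc (0 : ℝ) 1) (x₀ : M) :
    ContMDiffWithinAt (𝓘(ℝ, ℝ).prod (𝓘(ℝ, ℝ).prod 𝓘(ℝ, E))) 𝓘(ℝ, E) n (familyFlow Ω F)
      (flowDomain M) (s₀, t₀, x₀) := by
  have h1 : IsManifold 𝓘(ℝ, E) n M := IsManifold.of_le (n := ∞) (by exact_mod_cast le_top)
  let A : Set ℝ := {s | ContMDiffWithinAt (𝓘(ℝ, ℝ).prod (𝓘(ℝ, ℝ).prod 𝓘(ℝ, E))) 𝓘(ℝ, E) n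
    (familyFlow Ω F) (flowDomain M) (s, t₀, x₀)}
  have hg := hF.isCompactHamiltonian ht₀
  let c : ℝ → M := fun s => flow (hamField Ω (F t₀)) s x₀
  have hc : Continuous c := (isMIntegralCurve_flow Ω hg x₀).continuous
  -- Any two times near s₁ transfer smoothness to each other. Fixing the first at s₁ gives openness,
  -- fixing the second gives closedness. As the order n is finite, smoothness at (0, t₀, c s₁)
  -- spreads to a neighbourhood.
  have hloc : ∀ s₁, ∀ᶠ p : ℝ × ℝ in 𝓝 (s₁, s₁), p.1 ∈ A → p.2 ∈ A := by
    intro s₁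
    have hnear := (contMDiffWithinAt_iff_contMDiffWithinAt_nhdsWithin (by simp)).1
      (contMDiffWithinAt_familyFlow_zero Ω hF hn ht₀ (c s₁))
    rw [insert_eq_of_mem (show ((0 : ℝ), t₀, c s₁) ∈ flowDomain M from
      ⟨mem_univ _, ht₀, mem_univ _⟩)] at hnear
    have hτ : Filter.Tendsto (fun p : ℝ × ℝ => (p.2 - p.1, t₀, c p.1)) (𝓝 (s₁, s₁))
        (𝓝[flowDomain M] (0, t₀, c s₁)) := by
      refine tendsto_nhdsWithin_iff.2 ⟨?_, Filter.Eventually.of_forall fun p =>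
        ⟨mem_univ _, ht₀, mem_univ _⟩⟩
      have : Continuous fun p : ℝ × ℝ => (p.2 - p.1, t₀, c p.1) :=
        (continuous_snd.sub continuous_fst).prodMk
          (continuous_const.prodMk (hc.comp continuous_fst))
      simpa using this.tendsto (s₁, s₁)
    filter_upwards [hτ.eventually hnear] with ⟨s', s''⟩ hp hs'
    have hs'A : ContMDiffWithinAt (𝓘(ℝ, ℝ).prod (𝓘(ℝ, ℝ).prod 𝓘(ℝ, E))) 𝓘(ℝ, E) n
      (familyFlow Ω F) (flowDomain M) (s', t₀, x₀) := hs'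
    have hinner : ContMDiffWithinAt (𝓘(ℝ, ℝ).prod (𝓘(ℝ, ℝ).prod 𝓘(ℝ, E)))
        (𝓘(ℝ, ℝ).prod (𝓘(ℝ, ℝ).prod 𝓘(ℝ, E))) n
        (fun q : ℝ × ℝ × M => (q.1 - s', q.2.1, familyFlow Ω F (s', q.2)))
        (flowDomain M) (s'', t₀, x₀) := by
      refine ContMDiffWithinAt.prodMk ?_ (ContMDiffWithinAt.prodMk ?_ ?_)
      · exact ((contDiff_id.sub contDiff_const).contMDiff.comp contMDiff_fst).contMDiffAt.contMDiffWithinAt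
      · exact (contMDiff_fst.comp contMDiff_snd).contMDiffAt.contMDiffWithinAt
      · exact hs'A.comp_of_eq (contMDiff_const.prodMk contMDiff_snd).contMDiffAt.contMDiffWithinAt
          (fun q hq => ⟨mem_univ _, hq.2⟩) rfl
    have hcomp := ContMDiffWithinAt.comp_of_eq (g := familyFlow Ω F) hp hinner
      (fun q hq => ⟨mem_univ _, hq.2.1, mem_univ _⟩) rfl
    refine hcomp.congr (fun q hq => ?_) ?_
    · show flow _ _ _ = flow _ _ (flow _ _ _)
      rw [← flow_add Ω (hF.isCompactHamiltonian hq.2.1), sub_add_cancel]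
    · show flow _ _ _ = flow _ _ (flow _ _ _)
      rw [← flow_add Ω hg, sub_add_cancel]
  have hopen : IsOpen A := isOpen_iff_mem_nhds.2 fun s₁ hs₁ => by
    filter_upwards [(hloc s₁).curry_nhds.self_of_nhds] with s'' h using h hs₁
  have hclosed : IsClosed A := by
    refine isClosed_of_closure_subset fun s₁ hs₁ => ?_
    obtain ⟨s', hs', h⟩ := ((mem_closure_iff_frequently.1 hs₁).and_eventually
      (hloc s₁).curry_nhds).exists
    exact h.self_of_nhds hs'
  have huniv : A = univ := IsClopen.eq_univ ⟨hclosed, hopen⟩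
    ⟨0, contMDiffWithinAt_familyFlow_zero Ω hF hn ht₀ x₀⟩
  exact (huniv ▸ mem_univ s₀ : s₀ ∈ A)

theorem contMDiffOn_familyFlow (hF : IsTimeDepHamiltonian E F) :
    ContMDiffOn (𝓘(ℝ, ℝ).prod (𝓘(ℝ, ℝ).prod 𝓘(ℝ, E))) 𝓘(ℝ, E) ∞ (familyFlow Ω F)
      (flowDomain M) := by
  rintro ⟨s, t, x⟩ ⟨-, ht, -⟩
  refine contMDiffWithinAt_infty.2 fun n => ?_
  exact (contMDiffWithinAt_familyFlow Ω hF n.succ_ne_zero s ht x).of_le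
    (by exact_mod_cast n.le_succ)

end SmoothFlow

/-! ### Pullbacks of closed 2-forms -/

section ClosedForms

variable {V : Type*} [NormedAddCommGroup V] [NormedSpace ℝ V]
  {E : Type*} [NormedAddCommGroup E] [NormedSpace ℝ E]

theorem hasFDerivWithinAt_fderivWithin {G : Type*} [NormedAddCommGroup G] [NormedSpace ℝ G]
    {f : V → G} {S : Set V} {q : V} (hf : ContDiffWithinAt ℝ ∞ f S q) (hS : UniqueDiffOn ℝ S)
    (hq : q ∈ S) : HasFDerivWithinAt (fderivWithin ℝ f S)
      (fderivWithin ℝ (fderivWithin ℝ f S) S q) S q :=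
  ((hf.fderivWithin_right (m := 1) hS (by norm_cast) hq).differentiableWithinAt
    (by simp)).hasFDerivWithinAt

theorem fderivWithin_fderivWithin_swap {G : Type*} [NormedAddCommGroup G] [NormedSpace ℝ G]
    {f : V → G} {S : Set V} {q : V} (hf : ContDiffWithinAt ℝ ∞ f S q) (hS : UniqueDiffOn ℝ S)
    (hq : q ∈ S) (hq' : q ∈ closure (interior S)) (a b : V) :
    fderivWithin ℝ (fderivWithin ℝ f S) S q a b = fderivWithin ℝ (fderivWithin ℝ f S) S q b a :=
  hf.isSymmSndFDerivWithinAt (by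
    rw [minSmoothness_of_isRCLikeNormedField]
    exact WithTop.coe_le_coe.2 le_top) hS hq' hq a b

/-- The pullback by `y` of a field `B` of bilinear forms, evaluated at the vectors `a`, `b`. -/
def pullbackForm (B : E → E →L[ℝ] E →L[ℝ] ℝ) (y : V → E) (S : Set V) (a b : V) (q : V) : ℝ :=
  B (y q) (fderivWithin ℝ y S q a) (fderivWithin ℝ y S q b)

theorem hasFDerivWithinAt_pullbackForm {B : E → E →L[ℝ] E →L[ℝ] ℝ} {y : V → E} {S : Set V} {q : V}
    (hB : DifferentiableAt ℝ B (y q)) (hy : ContDiffWithinAt ℝ ∞ y S q) (hS : UniqueDiffOn ℝ S)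
    (hq : q ∈ S) (a b : V) :
    ∃ L : V →L[ℝ] ℝ, HasFDerivWithinAt (pullbackForm B y S a b) L S q ∧
      ∀ c, L c = fderiv ℝ B (y q) (fderivWithin ℝ y S q c) (fderivWithin ℝ y S q a)
          (fderivWithin ℝ y S q b) +
        B (y q) (fderivWithin ℝ (fderivWithin ℝ y S) S q c a) (fderivWithin ℝ y S q b) +
        B (y q) (fderivWithin ℝ y S q a) (fderivWithin ℝ (fderivWithin ℝ y S) S q c b) := by
  have h1 := HasFDerivAt.comp_hasFDerivWithinAt (g := B) (f := y) q hB.hasFDerivAt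
    (hy.differentiableWithinAt (by simp)).hasFDerivWithinAt
  have h2 := hasFDerivWithinAt_fderivWithin hy hS hq
  have ha := h2.clm_apply (hasFDerivWithinAt_const a q S)
  have hb := h2.clm_apply (hasFDerivWithinAt_const b q S)
  refine ⟨_, (h1.clm_apply ha).clm_apply hb, fun c => ?_⟩
  simp
  ring

/-- The pullback of a closed 2-form is closed. -/
theorem fderivWithin_pullbackForm_cyclic {B : E → E →L[ℝ] E →L[ℝ] ℝ} {y : V → E} {S : Set V}
    {q : V} (hB : DifferentiableAt ℝ B (y q)) (hy : ContDiffWithinAt ℝ ∞ y S q)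
    (hS : UniqueDiffOn ℝ S) (hq : q ∈ S) (hq' : q ∈ closure (interior S))
    (halt : ∀ u v, B (y q) u v = - B (y q) v u)
    (hclosed : ∀ u v w, fderiv ℝ B (y q) u v w + fderiv ℝ B (y q) v w u +
      fderiv ℝ B (y q) w u v = 0) (a b c : V) :
    fderivWithin ℝ (pullbackForm B y S a b) S q c + fderivWithin ℝ (pullbackForm B y S b c) S q a +
      fderivWithin ℝ (pullbackForm B y S c a) S q b = 0 := by
  obtain ⟨L₁, h₁, e₁⟩ := hasFDerivWithinAt_pullbackForm hB hy hS hq a b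
  obtain ⟨L₂, h₂, e₂⟩ := hasFDerivWithinAt_pullbackForm hB hy hS hq b c
  obtain ⟨L₃, h₃, e₃⟩ := hasFDerivWithinAt_pullbackForm hB hy hS hq c a
  rw [h₁.fderivWithin (hS q hq), h₂.fderivWithin (hS q hq), h₃.fderivWithin (hS q hq), e₁, e₂, e₃]
  -- Symmetry of the second derivatives of y and antisymmetry of B make the six second-order terms
  -- cancel in pairs, leaving the cyclic sum of the derivative of B.
  have s := fderivWithin_fderivWithin_swap hy hS hq hq'
  rw [s c a, s c b, s b a,
    halt (fderivWithin ℝ y S q a) (fderivWithin ℝ (fderivWithin ℝ y S) S q b c),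
    halt (fderivWithin ℝ y S q b) (fderivWithin ℝ (fderivWithin ℝ y S) S q a c),
    halt (fderivWithin ℝ y S q c) (fderivWithin ℝ (fderivWithin ℝ y S) S q a b)]
  linear_combination hclosed (fderivWithin ℝ y S q c) (fderivWithin ℝ y S q a)
    (fderivWithin ℝ y S q b)

/-- If the contraction of the pulled back form with `c` is, along `a` and `b`, the differential of
a function `g` up to a correction `h` along `a`, then its derivative along `c` is `dh(b)`. -/
theorem fderivWithin_pullbackForm_eq {B : E → E →L[ℝ] E →L[ℝ] ℝ} {y : V → E} {S : Set V}
    {q : V} (hB : DifferentiableAt ℝ B (y q)) (hy : ContDiffWithinAt ℝ ∞ y S q)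
    (hS : UniqueDiffOn ℝ S) (hq : q ∈ S) (hq' : q ∈ closure (interior S))
    (halt : ∀ z ∈ range y, ∀ u v, B z u v = - B z v u)
    (hclosed : ∀ u v w, fderiv ℝ B (y q) u v w + fderiv ℝ B (y q) v w u +
      fderiv ℝ B (y q) w u v = 0) {a b c : V} {g h : V → ℝ} (hg : ContDiffWithinAt ℝ ∞ g S q)
    (hh : DifferentiableWithinAt ℝ h S q)
    (hca : ∀ᶠ p in 𝓝[S] q, pullbackForm B y S c a p = fderivWithin ℝ g S p a - h p)
    (hcb : ∀ᶠ p in 𝓝[S] q, pullbackForm B y S c b p = fderivWithin ℝ g S p b) :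
    fderivWithin ℝ (pullbackForm B y S a b) S q c = fderivWithin ℝ h S q b := by
  -- In the cyclic identity the (c, a) term contributes ∂_b∂_a g - ∂_b h and the (b, c) term
  -- contributes -∂_a∂_b g; only ∂_b h survives.
  have hcyc := fderivWithin_pullbackForm_cyclic hB hy hS hq hq' (halt _ (mem_range_self q))
    hclosed a b c
  have h2 := hasFDerivWithinAt_fderivWithin hg hS hq
  have ha := h2.clm_apply (hasFDerivWithinAt_const a q S)
  have hb := h2.clm_apply (hasFDerivWithinAt_const b q S)
  have hbc : ∀ᶠ p in 𝓝[S] q, pullbackForm B y S b c p = - fderivWithin ℝ g S p b := by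
    filter_upwards [hcb] with p hp
    rw [← hp, pullbackForm, halt _ (mem_range_self p), pullbackForm]
  have e1 : fderivWithin ℝ (pullbackForm B y S b c) S q a =
      - fderivWithin ℝ (fderivWithin ℝ g S) S q a b := by
    have := (hb.neg.congr_of_eventuallyEq hbc (hbc.self_of_nhdsWithin hq)).fderivWithin (hS q hq)
    rw [this]
    simp
  have e2 : fderivWithin ℝ (pullbackForm B y S c a) S q b =
      fderivWithin ℝ (fderivWithin ℝ g S) S q b a - fderivWithin ℝ h S q b := by
    have := ((ha.sub hh.hasFDerivWithinAt).congr_of_eventuallyEq hca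
      (hca.self_of_nhdsWithin hq)).fderivWithin (hS q hq)
    rw [this]
    simp
  rw [e1, e2, fderivWithin_fderivWithin_swap hg hS hq hq' b a] at hcyc
  linarith

end ClosedForms

/-! ### Time derivatives of families of functions -/

section TimeDerivative

variable {E : Type u} [NormedAddCommGroup E] [NormedSpace ℝ E] [FiniteDimensional ℝ E]
  {M : Type*} [TopologicalSpace M] [ChartedSpace E M] [IsManifold 𝓘(ℝ, E) ∞ M]
  {F : ℝ → M → ℝ}

theorem uniqueDiffOn_family (x₀ : M) :
    UniqueDiffOn ℝ (Icc (0 : ℝ) 1 ×ˢ (extChartAt 𝓘(ℝ, E) x₀).target) :=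
  (uniqueDiffOn_Icc_zero_one).prod (isOpen_extChartAt_target x₀).uniqueDiffOn

theorem hasFDerivWithinAt_chartFamily (hF : IsTimeDepHamiltonian E F) {x₀ : M} {t : ℝ}
    (ht : t ∈ Icc (0 : ℝ) 1) {y : E} (hy : y ∈ (extChartAt 𝓘(ℝ, E) x₀).target) :
    HasFDerivWithinAt (chartFamily x₀ F)
      (fderivWithin ℝ (chartFamily x₀ F) (Icc (0 : ℝ) 1 ×ˢ (extChartAt 𝓘(ℝ, E) x₀).target) (t, y))
      (Icc (0 : ℝ) 1 ×ˢ (extChartAt 𝓘(ℝ, E) x₀).target) (t, y) :=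
  (((contDiffOn_chartFamily hF.smooth x₀) (t, y) ⟨ht, hy⟩).differentiableWithinAt
    (by simp)).hasFDerivWithinAt

theorem hasDerivWithinAt_family_chart (hF : IsTimeDepHamiltonian E F) {x₀ : M} {t : ℝ}
    (ht : t ∈ Icc (0 : ℝ) 1) {y : E} (hy : y ∈ (extChartAt 𝓘(ℝ, E) x₀).target) :
    HasDerivWithinAt (fun s => F s ((extChartAt 𝓘(ℝ, E) x₀).symm y))
      (fderivWithin ℝ (chartFamily x₀ F) (Icc (0 : ℝ) 1 ×ˢ (extChartAt 𝓘(ℝ, E) x₀).target) (t, y)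
        (1, 0)) (Icc 0 1) t := by
  have h1 : HasDerivWithinAt (fun s : ℝ => (s, y)) ((1 : ℝ), (0 : E)) (Icc 0 1) t :=
    (hasDerivWithinAt_id _ _).prodMk (hasDerivWithinAt_const _ _ _)
  exact (hasFDerivWithinAt_chartFamily hF ht hy).comp_hasDerivWithinAt t h1
    (show MapsTo _ _ (Icc (0 : ℝ) 1 ×ˢ (extChartAt 𝓘(ℝ, E) x₀).target) from
      fun s hs => ⟨hs, hy⟩)

theorem timeDeriv_chart (hF : IsTimeDepHamiltonian E F) {x₀ : M} {t : ℝ}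
    (ht : t ∈ Icc (0 : ℝ) 1) {y : E} (hy : y ∈ (extChartAt 𝓘(ℝ, E) x₀).target) :
    timeDeriv F t ((extChartAt 𝓘(ℝ, E) x₀).symm y) =
      fderivWithin ℝ (chartFamily x₀ F) (Icc (0 : ℝ) 1 ×ˢ (extChartAt 𝓘(ℝ, E) x₀).target) (t, y)
        (1, 0) :=
  (hasDerivWithinAt_family_chart hF ht hy).derivWithin (uniqueDiffOn_Icc_zero_one t ht)

theorem fderivWithin_chartFamily_apply (hF : IsTimeDepHamiltonian E F) {x₀ : M} {t : ℝ}
    (ht : t ∈ Icc (0 : ℝ) 1) {y : E} (hy : y ∈ (extChartAt 𝓘(ℝ, E) x₀).target) (τ : ℝ) (ξ : E) :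
    fderivWithin ℝ (chartFamily x₀ F) (Icc (0 : ℝ) 1 ×ˢ (extChartAt 𝓘(ℝ, E) x₀).target) (t, y)
        (τ, ξ) = τ * timeDeriv F t ((extChartAt 𝓘(ℝ, E) x₀).symm y) +
      fderiv ℝ (F t ∘ (extChartAt 𝓘(ℝ, E) x₀).symm) y ξ := by
  have h1 : HasFDerivWithinAt (fun z : E => (t, z)) (.inr ℝ ℝ E)
      (extChartAt 𝓘(ℝ, E) x₀).target y := (hasFDerivAt_prodMk_right t y).hasFDerivWithinAt
  have h2 := ((hasFDerivWithinAt_chartFamily hF ht hy).comp y h1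
    (show MapsTo _ _ (Icc (0 : ℝ) 1 ×ˢ (extChartAt 𝓘(ℝ, E) x₀).target) from
      fun z hz => ⟨ht, hz⟩)).hasFDerivAt (chartTarget_mem_nhds hy)
  have h3 : fderiv ℝ (F t ∘ (extChartAt 𝓘(ℝ, E) x₀).symm) y = _ := h2.fderiv
  have h4 : ((τ, ξ) : ℝ × E) = τ • (1, 0) + (0, ξ) := by simp
  rw [h3, h4, map_add, map_smul, ← timeDeriv_chart hF ht hy]
  rfl

theorem hasDerivWithinAt_timeDeriv (hF : IsTimeDepHamiltonian E F) {t : ℝ}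
    (ht : t ∈ Icc (0 : ℝ) 1) (x : M) :
    HasDerivWithinAt (fun s => F s x) (timeDeriv F t x) (Icc 0 1) t := by
  have h := hasDerivWithinAt_family_chart hF ht (mem_extChartAt_target (I := 𝓘(ℝ, E)) x)
  rw [← timeDeriv_chart hF ht (mem_extChartAt_target (I := 𝓘(ℝ, E)) x)] at h
  rwa [(extChartAt 𝓘(ℝ, E) x).left_inv (mem_extChartAt_source x)] at h

theorem IsTimeDepHamiltonian.timeDeriv (hF : IsTimeDepHamiltonian E F) :
    IsTimeDepHamiltonian E (timeDeriv F) where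
  smooth := by
    rintro ⟨t₀, x₀⟩ ⟨ht₀, -⟩
    set e := extChartAt 𝓘(ℝ, E) x₀
    have hsrc : e.source ∈ 𝓝 x₀ := extChartAt_source_mem_nhds x₀
    have hx₀ : x₀ ∈ e.source := mem_extChartAt_source x₀
    have h1 : ContDiffWithinAt ℝ ∞ (fun q =>
        fderivWithin ℝ (chartFamily x₀ F) (Icc (0 : ℝ) 1 ×ˢ e.target) q (1, 0))
        (Icc (0 : ℝ) 1 ×ˢ e.target) (t₀, e x₀) :=
      ContDiffWithinAt.fderivWithin_right_apply (n := ∞) (m := ∞)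
        (contDiffOn_chartFamily hF.smooth x₀ (t₀, e x₀) ⟨ht₀, mem_extChartAt_target x₀⟩)
        contDiffWithinAt_const (uniqueDiffOn_family x₀) (by simp)
        ⟨ht₀, mem_extChartAt_target x₀⟩
    have h2 : ContMDiffWithinAt (𝓘(ℝ, ℝ).prod 𝓘(ℝ, E)) 𝓘(ℝ, ℝ) ∞
        (fun q : ℝ × M => HoferVariation.timeDeriv F q.1 q.2) (Icc 0 1 ×ˢ e.source) (t₀, x₀) := by
      have h3 : ContMDiffWithinAt (𝓘(ℝ, ℝ).prod 𝓘(ℝ, E)) 𝓘(ℝ, ℝ) ∞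
          ((fun q => fderivWithin ℝ (chartFamily x₀ F) (Icc (0 : ℝ) 1 ×ˢ e.target) q (1, 0)) ∘
            fun q : ℝ × M => (q.1, e q.2)) (Icc 0 1 ×ˢ e.source) (t₀, x₀) := by
        refine ContMDiffWithinAt.comp (I' := 𝓘(ℝ, ℝ × E)) (t₀, x₀) h1.contMDiffWithinAt
          (contMDiffWithinAt_fst.prodMk_space ?_) fun q hq => ⟨hq.1, e.map_source hq.2⟩
        exact (contMDiffOn_chart x₀ x₀ hx₀).comp (t₀, x₀) contMDiffWithinAt_snd fun q hq => hq.2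
      refine h3.congr_of_mem (fun q hq => ?_) ⟨ht₀, hx₀⟩
      have h4 := timeDeriv_chart hF hq.1 (e.map_source hq.2)
      rwa [e.left_inv hq.2] at h4
    refine h2.mono_of_mem_nhdsWithin ?_
    filter_upwards [self_mem_nhdsWithin, nhdsWithin_le_nhds
      (prod_mem_nhds Filter.univ_mem hsrc)] with q hq hq' using ⟨hq.1, hq'.2⟩
  compactSupport := by
    obtain ⟨K, hK, h0⟩ := hF.compactSupport
    refine ⟨K, hK, fun t ht x hx => ?_⟩
    have : HasDerivWithinAt (fun s => F s x) 0 (Icc 0 1) t :=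
      (hasDerivWithinAt_const t (Icc (0 : ℝ) 1) (0 : ℝ)).congr (fun s hs => h0 s hs x hx)
        (h0 t ht x hx)
    exact this.derivWithin (uniqueDiffOn_Icc_zero_one t ht)

end TimeDerivative

/-! ### Symplectic area density of moving surfaces -/

section Surfaces

variable {E : Type u} [NormedAddCommGroup E] [NormedSpace ℝ E]
  {M : Type*} [TopologicalSpace M] [ChartedSpace E M]

theorem uniqueDiffOn_flowDomain : UniqueDiffOn ℝ (flowDomain ℝ) :=
  uniqueDiffOn_univ.prod (uniqueDiffOn_Icc_zero_one.prod uniqueDiffOn_univ)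

/-- Needed for the symmetry of second derivatives at the boundary times t = 0 and t = 1. -/
theorem mem_closure_interior_flowDomain {q : ℝ × ℝ × ℝ} (hq : q ∈ flowDomain ℝ) :
    q ∈ closure (interior (flowDomain ℝ)) := by
  simp only [flowDomain, interior_prod_eq, interior_univ, interior_Icc, closure_prod_eq,
    closure_univ, closure_Ioo zero_ne_one]
  exact hq

/-- The derivative of a three-parameter surface, as a linear map to the model space. -/
def surfDeriv (u : ℝ × ℝ × ℝ → M) (q : ℝ × ℝ × ℝ) : ℝ × ℝ × ℝ →L[ℝ] E :=
  mfderivWithin 𝓘(ℝ, ℝ × ℝ × ℝ) 𝓘(ℝ, E) u (flowDomain ℝ) q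

/-- The pullback of a symplectic form by a three-parameter surface. -/
def surfForm (Ω : SymplecticForm E M) (u : ℝ × ℝ × ℝ → M) (a b q : ℝ × ℝ × ℝ) : ℝ :=
  Ω.formAt (u q) (surfDeriv u q a) (surfDeriv u q b)

theorem HasVelocityWithinAt.unique {γ : ℝ → M} {v w : E} {s : Set ℝ} {t : ℝ}
    (hs : UniqueDiffWithinAt ℝ s t) (hv : HasVelocityWithinAt γ v s t)
    (hw : HasVelocityWithinAt γ w s t) : v = w := by
  have h : (1 : ℝ →L[ℝ] ℝ).smulRight v = (1 : ℝ →L[ℝ] ℝ).smulRight w :=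
    UniqueMDiffWithinAt.eq (uniqueMDiffWithinAt_iff_uniqueDiffWithinAt.2 hs) hv hw
  simpa using DFunLike.congr_fun h 1

variable {u : ℝ × ℝ × ℝ → M}

theorem hasMFDerivWithinAt_surf
    (hu : ContMDiffOn 𝓘(ℝ, ℝ × ℝ × ℝ) 𝓘(ℝ, E) ∞ u (flowDomain ℝ)) {q : ℝ × ℝ × ℝ} (hq : q ∈ flowDomain ℝ) :
    HasMFDerivWithinAt 𝓘(ℝ, ℝ × ℝ × ℝ) 𝓘(ℝ, E) u (flowDomain ℝ) q (surfDeriv (E := E) u q) :=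
  ((hu q hq).mdifferentiableWithinAt (by simp)).hasMFDerivWithinAt

theorem hasVelocityWithinAt_surf_comp
    (hu : ContMDiffOn 𝓘(ℝ, ℝ × ℝ × ℝ) 𝓘(ℝ, E) ∞ u (flowDomain ℝ)) {κ : ℝ → ℝ × ℝ × ℝ} {T : Set ℝ} {τ : ℝ} {v : ℝ × ℝ × ℝ}
    (hκ : HasDerivWithinAt κ v T τ) (hT : MapsTo κ T (flowDomain ℝ))
    (hτ : κ τ ∈ flowDomain ℝ) :
    HasVelocityWithinAt (fun s => u (κ s)) (surfDeriv (E := E) u (κ τ) v) T τ := by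
  have h1 := (hasMFDerivWithinAt_surf hu hτ).comp τ hκ.hasFDerivWithinAt.hasMFDerivWithinAt hT
  refine h1.congr_mfderiv ?_
  refine ContinuousLinearMap.ext_ring ?_
  show surfDeriv (E := E) u (κ τ) ((1 : ℝ) • v) = (1 : ℝ) • surfDeriv (E := E) u (κ τ) v
  rw [one_smul, one_smul]

variable [IsManifold 𝓘(ℝ, E) ∞ M]

theorem contDiffWithinAt_surf_chart
    (hu : ContMDiffOn 𝓘(ℝ, ℝ × ℝ × ℝ) 𝓘(ℝ, E) ∞ u (flowDomain ℝ)) {x₀ : M} {q : ℝ × ℝ × ℝ} (hq : q ∈ flowDomain ℝ)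
    (hx : u q ∈ (extChartAt 𝓘(ℝ, E) x₀).source) :
    ContDiffWithinAt ℝ ∞ (fun q => extChartAt 𝓘(ℝ, E) x₀ (u q)) (flowDomain ℝ) q := by
  rw [← contMDiffWithinAt_iff_contDiffWithinAt]
  exact ((contMDiffOn_chart x₀).contMDiffAt
    ((isOpen_extChartAt_source x₀).mem_nhds hx)).comp_contMDiffWithinAt q (hu q hq)

theorem surfDeriv_eq
    (hu : ContMDiffOn 𝓘(ℝ, ℝ × ℝ × ℝ) 𝓘(ℝ, E) ∞ u (flowDomain ℝ)) {x₀ : M} {q : ℝ × ℝ × ℝ} (hq : q ∈ flowDomain ℝ)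
    (hx : u q ∈ (extChartAt 𝓘(ℝ, E) x₀).source) (v : ℝ × ℝ × ℝ) :
    surfDeriv u q v = chartSymmDeriv x₀ (extChartAt 𝓘(ℝ, E) x₀ (u q))
      (fderivWithin ℝ (fun q => extChartAt 𝓘(ℝ, E) x₀ (u q)) (flowDomain ℝ) q v) := by
  have : IsManifold 𝓘(ℝ, E) 1 M := IsManifold.of_le (n := ∞) (by simp)
  have h0 : HasMFDerivAt 𝓘(ℝ, E) 𝓘(ℝ, E) (extChartAt 𝓘(ℝ, E) x₀) (u q)
      (chartDeriv (E := E) x₀ (u q)) :=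
    (mdifferentiableAt_extChartAt (by rwa [extChartAt_source] at hx)).hasMFDerivAt
  have h1 : HasFDerivWithinAt (fun q => extChartAt 𝓘(ℝ, E) x₀ (u q))
      (chartDeriv x₀ (u q) ∘L surfDeriv u q) (flowDomain ℝ) q :=
    (h0.comp_hasMFDerivWithinAt q (hasMFDerivWithinAt_surf hu hq)).hasFDerivWithinAt
  rw [h1.fderivWithin (uniqueDiffOn_flowDomain q hq)]
  have h2 := chartSymmDeriv_comp_chartDeriv ((extChartAt 𝓘(ℝ, E) x₀).map_source hx)
    (surfDeriv u q v)
  rw [(extChartAt 𝓘(ℝ, E) x₀).left_inv hx] at h2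
  exact h2.symm

theorem surfForm_eq_pullbackForm
    (hu : ContMDiffOn 𝓘(ℝ, ℝ × ℝ × ℝ) 𝓘(ℝ, E) ∞ u (flowDomain ℝ)) (Ω : SymplecticForm E M) {x₀ : M} {q : ℝ × ℝ × ℝ}
    (hq : q ∈ flowDomain ℝ) (hx : u q ∈ (extChartAt 𝓘(ℝ, E) x₀).source) (a b : ℝ × ℝ × ℝ) :
    surfForm Ω u a b q = pullbackForm (chartForm Ω.form x₀)
      (fun q => extChartAt 𝓘(ℝ, E) x₀ (u q)) (flowDomain ℝ) a b q := by
  rw [surfForm, pullbackForm, Ω.chartForm_apply, surfDeriv_eq hu hq hx, surfDeriv_eq hu hq hx,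
    (extChartAt 𝓘(ℝ, E) x₀).left_inv hx]

theorem eventually_surf_mem_source
    (hu : ContMDiffOn 𝓘(ℝ, ℝ × ℝ × ℝ) 𝓘(ℝ, E) ∞ u (flowDomain ℝ)) {q : ℝ × ℝ × ℝ} (hq : q ∈ flowDomain ℝ) :
    ∀ᶠ p in 𝓝[flowDomain ℝ] q, u p ∈ (extChartAt 𝓘(ℝ, E) (u q)).source :=
  (hu q hq).continuousWithinAt.eventually (extChartAt_source_mem_nhds (u q))

variable [FiniteDimensional ℝ E] {F : ℝ → M → ℝ}

theorem contDiffWithinAt_family_surf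
    (hu : ContMDiffOn 𝓘(ℝ, ℝ × ℝ × ℝ) 𝓘(ℝ, E) ∞ u (flowDomain ℝ)) (hF : IsTimeDepHamiltonian E F) {q : ℝ × ℝ × ℝ}
    (hq : q ∈ flowDomain ℝ) :
    ContDiffWithinAt ℝ ∞ (fun q => F q.2.1 (u q)) (flowDomain ℝ) q := by
  rw [← contMDiffWithinAt_iff_contDiffWithinAt]
  exact (hF.smooth (q.2.1, u q) ⟨hq.2.1, mem_univ _⟩).comp q
    (ContMDiffWithinAt.prodMk (f := fun q : ℝ × ℝ × ℝ => q.2.1)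
      (contDiff_fst.comp contDiff_snd).contMDiff.contMDiffAt.contMDiffWithinAt (hu q hq))
    (show MapsTo _ _ (Icc (0 : ℝ) 1 ×ˢ univ) from fun p hp => ⟨hp.2.1, mem_univ _⟩)

theorem fderivWithin_family_surf
    (hu : ContMDiffOn 𝓘(ℝ, ℝ × ℝ × ℝ) 𝓘(ℝ, E) ∞ u (flowDomain ℝ)) (hF : IsTimeDepHamiltonian E F) {q : ℝ × ℝ × ℝ}
    (hq : q ∈ flowDomain ℝ) (v : ℝ × ℝ × ℝ) :
    fderivWithin ℝ (fun q => F q.2.1 (u q)) (flowDomain ℝ) q v =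
      v.2.1 * timeDeriv F q.2.1 (u q) + differentialAt (E := E) (F q.2.1) (u q) (surfDeriv (E := E) u q v) := by
  set e := extChartAt 𝓘(ℝ, E) (u q) with he
  have hx : u q ∈ e.source := mem_extChartAt_source (u q)
  have hy := (contDiffWithinAt_surf_chart hu (x₀ := u q) hq hx).differentiableWithinAt
    (by simp) |>.hasFDerivWithinAt
  let τ : ℝ × ℝ × ℝ →L[ℝ] ℝ := .fst ℝ ℝ ℝ ∘L .snd ℝ ℝ (ℝ × ℝ)
  let S' := flowDomain ℝ ∩ {p | u p ∈ e.source}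
  have hS' : S' ∈ 𝓝[flowDomain ℝ] q :=
    Filter.inter_mem self_mem_nhdsWithin (eventually_surf_mem_source hu hq)
  have h1 : HasFDerivWithinAt (fun p => (p.2.1, e (u p)))
      (τ.prod (fderivWithin ℝ (fun q => e (u q)) (flowDomain ℝ) q)) S' q :=
    (τ.hasFDerivAt.hasFDerivWithinAt).prodMk (hy.mono inter_subset_left)
  have h2 := (hasFDerivWithinAt_chartFamily hF hq.2.1 (e.map_source hx)).comp q h1
    (show MapsTo _ _ (Icc (0 : ℝ) 1 ×ˢ e.target) from fun p hp => ⟨hp.1.2.1, e.map_source hp.2⟩)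
  have h3 := (h2.congr (f₁ := fun q => F q.2.1 (u q))
    (fun p hp => by simp only [chartFamily, Function.comp, ← he, e.left_inv hp.2])
    (by simp only [chartFamily, Function.comp, ← he, e.left_inv hx])).mono_of_mem_nhdsWithin hS'
  rw [h3.fderivWithin (uniqueDiffOn_flowDomain q hq)]
  show fderivWithin ℝ (chartFamily (u q) F) (Icc (0 : ℝ) 1 ×ˢ e.target) (q.2.1, e (u q))
    (v.2.1, fderivWithin ℝ (fun q => e (u q)) (flowDomain ℝ) q v) = _
  rw [fderivWithin_chartFamily_apply hF hq.2.1 (e.map_source hx),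
    (hasFDerivAt_comp_chart_symm (e.map_source hx)
      (mdifferentiableAt_of_family hF.smooth hq.2.1 _)).fderiv, surfDeriv_eq hu hq hx]
  show _ + differentialAt (F q.2.1) (e.symm (e (u q))) _ = _
  rw [e.left_inv hx]
  rfl

/-- Along a family of surfaces moved by Hamiltonian flows, the symplectic area density changes at
the rate given by the time derivative of the Hamiltonians. -/
theorem hasDerivAt_surfForm
    (hu : ContMDiffOn 𝓘(ℝ, ℝ × ℝ × ℝ) 𝓘(ℝ, E) ∞ u (flowDomain ℝ)) (Ω : SymplecticForm E M) (hF : IsTimeDepHamiltonian E F)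
    (hs : ∀ q ∈ flowDomain ℝ, surfDeriv (E := E) u q (1, 0, 0) = hamAt Ω (F q.2.1) (u q))
    {q : ℝ × ℝ × ℝ} (hq : q ∈ flowDomain ℝ) :
    HasDerivAt (fun s => surfForm Ω u (0, 1, 0) (0, 0, 1) (s, q.2))
      (fderivWithin ℝ (fun q => timeDeriv F q.2.1 (u q)) (flowDomain ℝ) q (0, 0, 1)) q.1 := by
  set e := extChartAt 𝓘(ℝ, E) (u q) with he
  have hx : u q ∈ e.source := mem_extChartAt_source (u q)
  have hy := contDiffWithinAt_surf_chart hu (x₀ := u q) hq hx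
  have hyT := e.map_source hx
  have hB : DifferentiableAt ℝ (chartForm Ω.form (u q)) (e (u q)) :=
    ((Ω.smooth' (u q)).contDiffAt (chartTarget_mem_nhds hyT)).differentiableAt (by simp)
  have hev : ∀ᶠ p in 𝓝[flowDomain ℝ] q, p ∈ flowDomain ℝ ∧ u p ∈ e.source :=
    Filter.Eventually.and self_mem_nhdsWithin (eventually_surf_mem_source hu hq)
  -- Since u moves in s by the field of F_t, contracting ω with u_s gives the differential of F_t
  -- along the surface: the total derivative of F_t ∘ u minus its explicit t-part. The latter is
  -- present for ∂_t and absent for ∂_r.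
  have hcontr : ∀ a p, p ∈ flowDomain ℝ → u p ∈ e.source →
      pullbackForm (chartForm Ω.form (u q)) (fun q => e (u q)) (flowDomain ℝ) (1, 0, 0) a p =
        fderivWithin ℝ (fun q => F q.2.1 (u q)) (flowDomain ℝ) p a -
          a.2.1 * timeDeriv F p.2.1 (u p) := by
    intro a p hp hpx
    rw [← surfForm_eq_pullbackForm hu Ω hp hpx, surfForm, hs p hp, formAt_hamAt,
      fderivWithin_family_surf hu hF hp]
    ring
  have key := fderivWithin_pullbackForm_eq (B := chartForm Ω.form (u q))
    (y := fun q => e (u q)) (g := fun q => F q.2.1 (u q))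
    (h := fun q => timeDeriv F q.2.1 (u q)) (a := (0, 1, 0)) (b := (0, 0, 1)) (c := (1, 0, 0))
    hB hy uniqueDiffOn_flowDomain hq (mem_closure_interior_flowDomain hq)
    (fun z _ u v => Ω.chartForm_swap _ z u v) (fun u v w => Ω.closed' _ _ hyT u v w)
    (contDiffWithinAt_family_surf hu hF hq)
    ((contDiffWithinAt_family_surf hu hF.timeDeriv hq).differentiableWithinAt (by simp))
    (by
      filter_upwards [hev] with p hp
      rw [hcontr _ p hp.1 hp.2, one_mul])
    (by
      filter_upwards [hev] with p hp
      rw [hcontr _ p hp.1 hp.2, zero_mul, sub_zero])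
  obtain ⟨L, hL, -⟩ := hasFDerivWithinAt_pullbackForm (B := chartForm Ω.form (u q))
    (y := fun q => e (u q)) hB hy uniqueDiffOn_flowDomain hq
    (0, 1, 0) (0, 0, 1)
  rw [hL.fderivWithin (uniqueDiffOn_flowDomain q hq)] at key
  have hL' : HasFDerivWithinAt (surfForm Ω u (0, 1, 0) (0, 0, 1)) L (flowDomain ℝ) q := by
    refine hL.congr_of_eventuallyEq ?_ (surfForm_eq_pullbackForm hu Ω hq hx _ _)
    filter_upwards [hev] with p hp using surfForm_eq_pullbackForm hu Ω hp.1 hp.2 _ _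
  have hline : HasDerivWithinAt (fun s : ℝ => (s, q.2)) ((1 : ℝ), (0 : ℝ × ℝ)) univ q.1 :=
    (hasDerivWithinAt_id _ _).prodMk (hasDerivWithinAt_const _ _ _)
  have h := hL'.comp_hasDerivWithinAt q.1 hline
    (show MapsTo _ _ (flowDomain ℝ) from fun s _ => ⟨mem_univ _, hq.2⟩)
  rw [hasDerivWithinAt_univ] at h
  rw [← key]
  exact h

end Surfaces

/-! ### Integrals depending on parameters -/

section ParametricIntegrals

/-- The general statement wants the codomain in a universe at least that of the parameters; `ULift`
moves ℝ there. -/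
theorem contDiff_real_integral {P : Type u} [NormedAddCommGroup P] [NormedSpace ℝ P] {n : ℕ}
    {g : ℝ × P → ℝ} (hg : ContDiff ℝ n g) :
    ContDiff ℝ n fun p => ∫ σ in (0 : ℝ)..1, g (σ, p) := by
  let e : ULift.{u} ℝ ≃L[ℝ] ℝ := ContinuousLinearEquiv.ulift
  have h := e.contDiff.comp (contDiff_integral_of_contDiff.{u, 0} (e.symm.contDiff.comp hg))
  convert h using 1
  funext p
  simp only [Function.comp, intervalIntegral, map_sub]
  rw [← e.integral_comp_comm, ← e.integral_comp_comm]
  simp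

theorem exists_contDiff_real_extension {P : Type u} [NormedAddCommGroup P] [NormedSpace ℝ P] {n : ℕ}
    {f : ℝ × P → ℝ} (hf : ContDiffOn ℝ n f (Icc 0 1 ×ˢ univ)) :
    ∃ g : ℝ × P → ℝ, ContDiff ℝ n g ∧ EqOn g f (Icc 0 1 ×ˢ univ) := by
  let e : ULift.{u} ℝ ≃L[ℝ] ℝ := ContinuousLinearEquiv.ulift
  obtain ⟨g, hg, hgf⟩ := exists_contDiff_extension.{u, 0}
    (e.symm.contDiff.comp_contDiffOn hf)
  exact ⟨e ∘ g, e.contDiff.comp hg, fun q hq => by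
    simp only [Function.comp, hgf hq, e.apply_symm_apply]⟩

variable {E : Type u} [NormedAddCommGroup E] [NormedSpace ℝ E] [FiniteDimensional ℝ E]
  {M : Type*} [TopologicalSpace M] [ChartedSpace E M] [IsManifold 𝓘(ℝ, E) ∞ M]

/-- In a chart, the integrand is cut off in x and extended past the ends of the t-interval, which
reduces the claim to integrands defined on a whole normed space. Nothing changes near the given
point, where the cutoff is 1. -/
theorem contMDiffOn_integral {h : ℝ × ℝ × M → ℝ}
    (hh : ContMDiffOn (𝓘(ℝ, ℝ).prod (𝓘(ℝ, ℝ).prod 𝓘(ℝ, E))) 𝓘(ℝ, ℝ) ∞ h (flowDomain M)) :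
    ContMDiffOn (𝓘(ℝ, ℝ).prod 𝓘(ℝ, E)) 𝓘(ℝ, ℝ) ∞
      (fun q : ℝ × M => ∫ σ in (0 : ℝ)..1, h (σ, q)) (Icc 0 1 ×ˢ univ) := by
  rintro ⟨t₀, x₀⟩ ⟨ht₀, -⟩
  refine contMDiffWithinAt_infty.2 fun n => ?_
  set e := extChartAt 𝓘(ℝ, E) x₀
  have hT : IsOpen e.target := isOpen_extChartAt_target x₀
  obtain ⟨χ, hχ, hs, h1⟩ := exists_cutoff (hT.mem_nhds (mem_extChartAt_target (I := 𝓘(ℝ, E)) x₀))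
  have hf : ContDiffOn ℝ n (fun q : (ℝ × ℝ) × E => h (q.1.1, q.1.2, e.symm q.2))
      ((univ ×ˢ Icc (0 : ℝ) 1) ×ˢ e.target) := by
    rw [← contMDiffOn_iff_contDiffOn]
    refine (hh.of_le (m := n) (by exact_mod_cast le_top)).comp
      (ContMDiffOn.prodMk (f := fun q : (ℝ × ℝ) × E => q.1.1) ?_
        (ContMDiffOn.prodMk (f := fun q : (ℝ × ℝ) × E => q.1.2) ?_ ?_))
      fun q hq => ⟨mem_univ _, hq.1.2, mem_univ _⟩
    · exact (contDiff_fst.comp contDiff_fst).contMDiff.contMDiffOn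
    · exact (contDiff_snd.comp contDiff_fst).contMDiff.contMDiffOn
    · exact ((contMDiffOn_chart_symm x₀).of_le (by exact_mod_cast le_top)).comp
        contDiff_snd.contMDiff.contMDiffOn fun q hq => hq.2
  have hf' := contDiffOn_cutoff_smul hχ hT hs hf
  -- The variables are permuted: t comes first for the extension, then σ comes first for the
  -- integration.
  obtain ⟨g, hg, hgf⟩ := exists_contDiff_real_extension (P := ℝ × E)
    (f := fun q : ℝ × ℝ × E => χ q.2.2 • h (q.2.1, q.1, e.symm q.2.2)) (n := n)
    (hf'.comp (f := fun q : ℝ × ℝ × E => ((q.2.1, q.1), q.2.2)) (by fun_prop)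
      fun q hq => ⟨⟨mem_univ _, hq.1⟩, mem_univ _⟩)
  have hI := contDiff_real_integral (P := ℝ × E) (g := fun q => g (q.2.1, q.1, q.2.2))
    (hg.comp (by fun_prop))
  have hM : ContMDiffWithinAt (𝓘(ℝ, ℝ).prod 𝓘(ℝ, E)) 𝓘(ℝ, ℝ) n
      ((fun p : ℝ × E => ∫ σ in (0 : ℝ)..1, g (p.1, σ, p.2)) ∘ fun q : ℝ × M => (q.1, e q.2))
      (Icc 0 1 ×ˢ univ) (t₀, x₀) := by
    refine ContMDiffAt.comp_contMDiffWithinAt (I' := 𝓘(ℝ, ℝ × E)) (t₀, x₀)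
      hI.contMDiff.contMDiffAt (contMDiffWithinAt_fst.prodMk_space ?_)
    refine ContMDiffAt.comp_contMDiffWithinAt (g := e) (t₀, x₀) ?_ contMDiffWithinAt_snd
    exact ((contMDiffOn_chart x₀).contMDiffAt (extChartAt_source_mem_nhds x₀)).of_le
      (by exact_mod_cast le_top)
  have hev : ∀ᶠ q : ℝ × M in 𝓝 (t₀, x₀), q.2 ∈ e.source ∧ χ (e q.2) = 1 :=
    (continuous_snd.tendsto (t₀, x₀)).eventually ((show ∀ᶠ x in 𝓝 x₀, x ∈ e.source from
      extChartAt_source_mem_nhds x₀).and ((continuousAt_extChartAt (I := 𝓘(ℝ, E)) x₀).eventually h1))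
  refine hM.congr_of_eventuallyEq_of_mem ?_ ⟨ht₀, mem_univ _⟩
  filter_upwards [nhdsWithin_le_nhds hev, self_mem_nhdsWithin] with q hq hqS
  refine intervalIntegral.integral_congr fun σ _ => ?_
  have h2 := hgf (show ((q.1, σ, e q.2) : ℝ × ℝ × E) ∈ Icc (0 : ℝ) 1 ×ˢ univ from
    ⟨hqS.1, mem_univ _⟩)
  simp only [h2, hq.2, one_smul, e.left_inv hq.1]

theorem hasDerivAt_integral_of_contDiff {k : ℝ × ℝ → ℝ} (hk : ContDiff ℝ 1 k) (r : ℝ) :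
    HasDerivAt (fun r => ∫ σ in (0 : ℝ)..1, k (σ, r))
      (∫ σ in (0 : ℝ)..1, fderiv ℝ k (σ, r) (0, 1)) r := by
  have hc : Continuous fun q => fderiv ℝ k q (0, 1) :=
    (hk.continuous_fderiv (by simp)).clm_apply continuous_const
  obtain ⟨C, hC⟩ := (isCompact_Icc.prod (isCompact_closedBall r 1)).exists_bound_of_continuousOn
    (s := Icc (0 : ℝ) 1 ×ˢ Metric.closedBall r 1) hc.continuousOn
  refine (intervalIntegral.hasDerivAt_integral_of_dominated_loc_of_deriv_le
    (F := fun r σ => k (σ, r)) (F' := fun r σ => fderiv ℝ k (σ, r) (0, 1))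
    (bound := fun _ => C) (Metric.ball_mem_nhds r one_pos) ?_ ?_ ?_ ?_ ?_ ?_).2
  · exact Filter.Eventually.of_forall fun r =>
      (hk.continuous.comp (by fun_prop)).aestronglyMeasurable
  · exact (hk.continuous.comp (by fun_prop)).intervalIntegrable _ _
  · exact (hc.comp (by fun_prop : Continuous fun σ : ℝ => (σ, r))).aestronglyMeasurable
  · refine Filter.Eventually.of_forall fun σ hσ y hy => hC (σ, y) ⟨?_, Metric.ball_subset_closedBall hy⟩
    rw [uIoc_of_le zero_le_one] at hσ
    exact ⟨hσ.1.le, hσ.2⟩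
  · exact intervalIntegrable_const
  · refine Filter.Eventually.of_forall fun σ _ y _ => ?_
    have h1 := (hk.differentiable (by simp) (σ, y)).hasFDerivAt
    exact h1.comp_hasDerivAt y ((hasDerivAt_const y σ).prodMk (hasDerivAt_id y))

end ParametricIntegrals

/-! ### Test surfaces and derivatives of the flow maps -/

section Variation

variable {E : Type u} [NormedAddCommGroup E] [NormedSpace ℝ E]
  {M : Type*} [TopologicalSpace M] [ChartedSpace E M]

theorem HasVelocityWithinAt.hasDerivWithinAt_comp {γ : ℝ → M} {v : E} {T : Set ℝ} {t : ℝ}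
    (h : HasVelocityWithinAt γ v T t) {f : M → ℝ}
    (hf : MDifferentiableAt 𝓘(ℝ, E) 𝓘(ℝ, ℝ) f (γ t)) :
    HasDerivWithinAt (fun s => f (γ s)) (differentialAt f (γ t) v) T t := by
  have h1 : HasFDerivWithinAt (fun s => f (γ s))
      (differentialAt f (γ t) ∘L (1 : ℝ →L[ℝ] ℝ).smulRight v) T t :=
    (hf.hasMFDerivAt.comp_hasMFDerivWithinAt t h).hasFDerivWithinAt
  simpa using h1.hasDerivWithinAt

theorem hasDerivAt_mul_sin_div {δ : ℝ} (hδ : δ ≠ 0) :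
    HasDerivAt (fun r => δ * Real.sin (r / δ)) 1 0 := by
  have h := ((Real.hasDerivAt_sin (0 / δ)).comp (0 : ℝ) ((hasDerivAt_id (0 : ℝ)).div_const δ)).const_mul δ
  refine h.congr_deriv ?_
  simp [hδ]

variable [IsManifold 𝓘(ℝ, E) ∞ M]

/-- An affine plane in the chart would leave it. Replacing each coordinate r by δ sin(r/δ), bounded
by δ and of derivative 1 at 0, keeps the surface in the chart and gives the same velocities. -/
theorem exists_surface (x : M) (v w : E) (t₀ : ℝ) :
    ∃ c : ℝ × ℝ → M, ContMDiff 𝓘(ℝ, ℝ × ℝ) 𝓘(ℝ, E) ∞ c ∧ c (t₀, 0) = x ∧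
      HasVelocityAt (fun t => c (t, 0)) v t₀ ∧ HasVelocityAt (fun r => c (t₀, r)) w 0 := by
  set e := extChartAt 𝓘(ℝ, E) x with he
  have hy : e x ∈ e.target := mem_extChartAt_target x
  obtain ⟨R, hR, hRT⟩ := Metric.mem_nhds_iff.1 (chartTarget_mem_nhds hy)
  let a : E := chartDeriv x x v
  let b : E := chartDeriv x x w
  have ha : chartSymmDeriv x (e x) a = v := by
    have := chartSymmDeriv_comp_chartDeriv hy v
    rwa [e.left_inv (mem_extChartAt_source x)] at this
  have hb : chartSymmDeriv x (e x) b = w := by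
    have := chartSymmDeriv_comp_chartDeriv hy w
    rwa [e.left_inv (mem_extChartAt_source x)] at this
  obtain ⟨δ, hδ, hδR⟩ : ∃ δ > 0, δ * (‖a‖ + ‖b‖) < R := by
    refine ⟨R / (‖a‖ + ‖b‖ + 1), by positivity, ?_⟩
    rw [div_mul_eq_mul_div, div_lt_iff₀ (by positivity)]
    nlinarith [norm_nonneg a, norm_nonneg b]
  let ρ : ℝ → ℝ := fun r => δ * Real.sin (r / δ)
  have hρ0 : ρ 0 = 0 := by simp [ρ]
  have hρd : HasDerivAt ρ 1 0 := hasDerivAt_mul_sin_div hδ.ne'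
  have hρs : ContDiff ℝ ∞ ρ :=
    contDiff_const.mul (Real.contDiff_sin.comp (contDiff_id.div_const δ))
  have hρ : ∀ r, |ρ r| ≤ δ := fun r => by
    rw [abs_mul, abs_of_pos hδ]
    exact mul_le_of_le_one_right hδ.le (Real.abs_sin_le_one _)
  let y : ℝ × ℝ → E := fun p => e x + (ρ (p.1 - t₀) • a + ρ p.2 • b)
  have hys : ContDiff ℝ ∞ y := contDiff_const.add
    (((hρs.comp (contDiff_fst.sub contDiff_const)).smul contDiff_const).add
      ((hρs.comp contDiff_snd).smul contDiff_const))
  have hyT : ∀ p, y p ∈ e.target := by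
    intro p
    refine hRT ?_
    rw [mem_ball_iff_norm]
    have h1 : y p - e x = ρ (p.1 - t₀) • a + ρ p.2 • b := by simp [y]
    rw [h1]
    refine ((norm_add_le _ _).trans ?_).trans_lt hδR
    rw [norm_smul, norm_smul, mul_add]
    exact add_le_add (mul_le_mul_of_nonneg_right (hρ _) (norm_nonneg _))
      (mul_le_mul_of_nonneg_right (hρ _) (norm_nonneg _))
  have hy0 : y (t₀, 0) = e x := by simp [y, hρ0]
  refine ⟨fun p => e.symm (y p), ?_, ?_, ?_, ?_⟩
  · exact (contMDiffOn_chart_symm x).comp_contMDiff hys.contMDiff hyT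
  · show e.symm (y (t₀, 0)) = x
    rw [hy0]
    exact e.left_inv (mem_extChartAt_source x)
  · have h1 : HasDerivAt (fun t => y (t, 0)) a t₀ := by
      have h2 : HasDerivAt (fun t => ρ (t - t₀)) 1 t₀ := by
        refine HasDerivAt.comp_sub_const t₀ t₀ ?_
        rwa [sub_self]
      have h4 := ((h2.smul_const a).add_const (ρ 0 • b)).const_add (e x)
      rw [one_smul] at h4
      exact h4
    have h3 := hasVelocityAt_chart_symm (x₀ := x) h1 (hyT (t₀, 0))
    rwa [hy0, ha] at h3
  · have h1 : HasDerivAt (fun r => y (t₀, r)) b 0 := by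
      have h4 := ((hρd.smul_const b).const_add (ρ (t₀ - t₀) • a)).const_add (e x)
      rw [one_smul] at h4
      exact h4
    have h3 := hasVelocityAt_chart_symm (x₀ := x) h1 (hyT (t₀, 0))
    rwa [hy0, hb] at h3

variable [FiniteDimensional ℝ E] [T2Space M] (Ω : SymplecticForm E M) {F H : ℝ → M → ℝ}

/-- The derivative of the flows at time `a`, in the parameter and the initial value. -/
def flowDeriv (F : ℝ → M → ℝ) (a : ℝ) (p : ℝ × M) : ℝ × E →L[ℝ] E :=
  mfderivWithin (𝓘(ℝ, ℝ).prod 𝓘(ℝ, E)) 𝓘(ℝ, E) (fun p : ℝ × M => familyFlow Ω F (a, p))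
    (Icc (0 : ℝ) 1 ×ˢ univ) p

theorem contMDiffOn_familyFlow_time (hF : IsTimeDepHamiltonian E F) (a : ℝ) :
    ContMDiffOn (𝓘(ℝ, ℝ).prod 𝓘(ℝ, E)) 𝓘(ℝ, E) ∞ (fun p : ℝ × M => familyFlow Ω F (a, p))
      (Icc (0 : ℝ) 1 ×ˢ univ) :=
  (contMDiffOn_familyFlow Ω hF).comp (contMDiff_const.prodMk contMDiff_id).contMDiffOn
    fun _ hp => ⟨mem_univ _, hp⟩

theorem HasVelocityWithinAt.familyFlow (hF : IsTimeDepHamiltonian E F) (a : ℝ) {κ : ℝ → ℝ}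
    {κ' : ℝ} {γ : ℝ → M} {v : E} {T : Set ℝ} {τ : ℝ} (hκ : HasDerivWithinAt κ κ' T τ)
    (hT : MapsTo κ T (Icc 0 1)) (hτ : κ τ ∈ Icc (0 : ℝ) 1) (hγ : HasVelocityWithinAt γ v T τ) :
    HasVelocityWithinAt (fun s => familyFlow Ω F (a, κ s, γ s))
      (flowDeriv Ω F a (κ τ, γ τ) (κ', v)) T τ := by
  have h1 : HasMFDerivWithinAt (𝓘(ℝ, ℝ).prod 𝓘(ℝ, E)) 𝓘(ℝ, E)
      (fun p : ℝ × M => HoferVariation.familyFlow Ω F (a, p)) (Icc (0 : ℝ) 1 ×ˢ univ) (κ τ, γ τ)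
      (flowDeriv Ω F a (κ τ, γ τ)) :=
    ((contMDiffOn_familyFlow_time Ω hF a (κ τ, γ τ) ⟨hτ, mem_univ _⟩).mdifferentiableWithinAt
      (by simp)).hasMFDerivWithinAt
  have h2 := h1.comp (f := fun s => (κ s, γ s)) τ (hκ.hasFDerivWithinAt.hasMFDerivWithinAt.prodMk hγ)
    (show MapsTo _ _ (Icc (0 : ℝ) 1 ×ˢ univ) from fun s hs => ⟨hT hs, mem_univ _⟩)
  refine h2.congr_mfderiv ?_
  refine ContinuousLinearMap.ext_ring ?_
  show flowDeriv Ω F a (κ τ, γ τ) ((1 : ℝ) • κ', (1 : ℝ) • v) =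
    (1 : ℝ) • flowDeriv Ω F a (κ τ, γ τ) (κ', v)
  rw [one_smul, one_smul, one_smul]

/-- A curve with velocity w, transported by the flow at time -a and then at time a, returns to
itself; the velocity of the intermediate curve is a preimage of w. -/
theorem flowDeriv_surjective (hF : IsTimeDepHamiltonian E F) {t : ℝ} (ht : t ∈ Icc (0 : ℝ) 1)
    (a : ℝ) (x : M) (w : E) : ∃ v : E, flowDeriv Ω F a (t, x) (0, v) = w := by
  have hc := hF.isCompactHamiltonian ht
  obtain ⟨c, hcs, hc0, -, hcv⟩ := exists_surface (familyFlow Ω F (a, t, x)) w w 0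
  have hκ : HasDerivWithinAt (fun _ : ℝ => t) 0 univ 0 := hasDerivWithinAt_const _ _ _
  have hκ' : MapsTo (fun _ : ℝ => t) univ (Icc 0 1) := fun _ _ => ht
  have hcv' : HasVelocityWithinAt (fun r => c (0, r)) w univ 0 := hcv.hasVelocityWithinAt
  have h1 := HasVelocityWithinAt.familyFlow Ω hF (-a) hκ hκ' ht hcv'
  have h2 := HasVelocityWithinAt.familyFlow Ω hF a hκ hκ' ht h1
  have h3 : (fun s => familyFlow Ω F (a, t, familyFlow Ω F (-a, t, c (0, s)))) =
      fun s => c (0, s) := by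
    funext s
    show flow _ _ (flow _ _ _) = _
    rw [← flow_add Ω hc, add_neg_cancel, flow_zero Ω hc]
  have h4 : familyFlow Ω F (-a, t, c (0, 0)) = x := by
    rw [hc0]
    show flow _ _ (flow _ _ _) = _
    rw [← flow_add Ω hc, neg_add_cancel, flow_zero Ω hc]
  rw [h3] at h2
  have h5 := h2.unique uniqueDiffWithinAt_univ hcv'
  rw [h4] at h5
  exact ⟨_, h5⟩

end Variation

/-! ### The generating Hamiltonian of a composed path -/

section PushedHamiltonian

variable {E : Type u} [NormedAddCommGroup E] [NormedSpace ℝ E] [FiniteDimensional ℝ E]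
  {M : Type*} [TopologicalSpace M] [ChartedSpace E M] [IsManifold 𝓘(ℝ, E) ∞ M] [T2Space M]
  (Ω : SymplecticForm E M) {F H : ℝ → M → ℝ} {φ : ℝ → M → M}

/-- The Hamiltonian generating `t ↦ ψ_t ∘ φ_t`, where `ψ_t` is the time-one map of the flow of the
autonomous Hamiltonian `F_t`, and `φ_t` is generated by `H_t`. -/
def pushHam (F H : ℝ → M → ℝ) (t : ℝ) (y : M) : ℝ :=
  H t (familyFlow Ω F (-1, t, y)) + ∫ σ in (0 : ℝ)..1, timeDeriv F t (familyFlow Ω F (σ - 1, t, y))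

theorem contMDiffOn_family_flow (hF : IsTimeDepHamiltonian E F) (hH : IsTimeDepHamiltonian E H) :
    ContMDiffOn (𝓘(ℝ, ℝ).prod (𝓘(ℝ, ℝ).prod 𝓘(ℝ, E))) 𝓘(ℝ, ℝ) ∞
      (fun q : ℝ × ℝ × M => H q.2.1 (familyFlow Ω F q)) (flowDomain M) :=
  hH.smooth.comp (ContMDiffOn.prodMk (f := fun q : ℝ × ℝ × M => q.2.1)
    (contMDiff_fst.comp contMDiff_snd).contMDiffOn (contMDiffOn_familyFlow Ω hF))
    (show MapsTo _ _ (Icc (0 : ℝ) 1 ×ˢ univ) from fun _ hq => ⟨hq.2.1, mem_univ _⟩)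

/-- The shifts -1 and σ - 1 in `pushHam` are undone by the time-one map, leaving H at the initial
point and an average over the forward orbit. -/
theorem pushHam_familyFlow (hF : IsTimeDepHamiltonian E F) {t : ℝ} (ht : t ∈ Icc (0 : ℝ) 1) (z : M) :
    pushHam Ω F H t (familyFlow Ω F (1, t, z)) =
      H t z + ∫ σ in (0 : ℝ)..1, timeDeriv F t (familyFlow Ω F (σ, t, z)) := by
  have hc := hF.isCompactHamiltonian ht
  have h : ∀ a, familyFlow Ω F (a, t, familyFlow Ω F (1, t, z)) = familyFlow Ω F (a + 1, t, z) :=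
    fun a => (flow_add Ω hc a 1 z).symm
  rw [pushHam]
  simp only [h, sub_add_cancel]
  rw [neg_add_cancel]
  congr 2
  exact flow_zero Ω hc z

theorem isTimeDepHamiltonian_pushHam (hF : IsTimeDepHamiltonian E F)
    (hH : IsTimeDepHamiltonian E H) : IsTimeDepHamiltonian E (pushHam Ω F H) where
  smooth := by
    have h1 := (contMDiffOn_family_flow Ω hF hH).comp (f := fun p : ℝ × M => ((-1 : ℝ), p))
      (s := Icc (0 : ℝ) 1 ×ˢ univ) (contMDiff_const.prodMk contMDiff_id).contMDiffOn
      fun p hp => ⟨mem_univ _, hp⟩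
    have h2 := (contMDiffOn_family_flow Ω hF hF.timeDeriv).comp
      (f := fun q : ℝ × ℝ × M => (q.1 - 1, q.2)) (s := flowDomain M)
      (((contDiff_id.sub contDiff_const).contMDiff.comp contMDiff_fst).prodMk
        contMDiff_snd).contMDiffOn fun q hq => ⟨mem_univ _, hq.2⟩
    exact h1.add (contMDiffOn_integral h2)
  compactSupport := by
    obtain ⟨K₁, hK₁, h₁⟩ := hF.compactSupport
    obtain ⟨K₂, hK₂, h₂⟩ := hF.timeDeriv.compactSupport
    obtain ⟨K₃, hK₃, h₃⟩ := hH.compactSupport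
    refine ⟨K₁ ∪ K₂ ∪ K₃, (hK₁.union hK₂).union hK₃, fun t ht x hx => ?_⟩
    simp only [mem_union, not_or] at hx
    have h : ∀ a, familyFlow Ω F (a, t, x) = x := fun a =>
      flow_of_notMem Ω (hF.isCompactHamiltonian ht) hK₁ (h₁ t ht) hx.1.1 a
    simp only [pushHam, h, h₃ t ht x hx.2, h₂ t ht x hx.1.2]
    simp

/-- Differentiating under the integral gives ∂_r of F'_t ∘ u, which `hasDerivAt_surfForm` recognizes
as the s-derivative of the area density; the fundamental theorem of calculus then leaves the two
ends. -/
theorem hasDerivAt_integral_timeDeriv_surf (hF : IsTimeDepHamiltonian E F) {u : ℝ × ℝ × ℝ → M}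
    (hu : ContMDiffOn 𝓘(ℝ, ℝ × ℝ × ℝ) 𝓘(ℝ, E) ∞ u (flowDomain ℝ))
    (hs : ∀ q ∈ flowDomain ℝ, surfDeriv (E := E) u q (1, 0, 0) = hamAt Ω (F q.2.1) (u q))
    {t : ℝ} (ht : t ∈ Icc (0 : ℝ) 1) :
    HasDerivAt (fun r => ∫ σ in (0 : ℝ)..1, timeDeriv F t (u (σ, t, r)))
      (surfForm Ω u (0, 1, 0) (0, 0, 1) (1, t, 0) - surfForm Ω u (0, 1, 0) (0, 0, 1) (0, t, 0))
      0 := by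
  have hq : ∀ s r, (s, t, r) ∈ flowDomain ℝ := fun s r => ⟨mem_univ _, ht, mem_univ _⟩
  have hlr : ∀ s : ℝ, HasDerivWithinAt (fun r : ℝ => (s, t, r)) ((0 : ℝ), (0 : ℝ), (1 : ℝ))
      univ 0 := fun s =>
    (hasDerivWithinAt_const _ _ _).prodMk ((hasDerivWithinAt_const _ _ _).prodMk
      (hasDerivWithinAt_id _ _))
  let h : ℝ × ℝ × ℝ → ℝ := fun q => timeDeriv F q.2.1 (u q)
  let k : ℝ × ℝ → ℝ := fun q => h (q.1, t, q.2)
  have hh : ContDiffOn ℝ ∞ h (flowDomain ℝ) := fun q hq =>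
    contDiffWithinAt_family_surf hu hF.timeDeriv hq
  have hk : ContDiff ℝ 1 k := by
    rw [← contDiffOn_univ]
    exact (hh.of_le (by simp)).comp (f := fun q : ℝ × ℝ => (q.1, t, q.2)) (by fun_prop)
      fun q _ => hq _ _
  have hkh : ∀ s, fderivWithin ℝ h (flowDomain ℝ) (s, t, 0) (0, 0, 1) =
      fderiv ℝ k (s, 0) (0, 1) := by
    intro s
    have h1 := ((hh _ (hq s 0)).differentiableWithinAt (by simp)).hasFDerivWithinAt
    have h2 := h1.comp_hasDerivWithinAt (0 : ℝ) (hlr s)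
      (show MapsTo _ _ (flowDomain ℝ) from fun r _ => hq s r)
    have h3 := ((hk.differentiable (by simp) (s, 0)).hasFDerivAt).comp_hasDerivAt (0 : ℝ)
      ((hasDerivAt_const (0 : ℝ) s).prodMk (hasDerivAt_id (0 : ℝ)))
    exact (hasDerivWithinAt_univ.1 h2).unique h3
  have hint : ∫ s in (0 : ℝ)..1, fderiv ℝ k (s, 0) (0, 1) =
      surfForm Ω u (0, 1, 0) (0, 0, 1) (1, t, 0) - surfForm Ω u (0, 1, 0) (0, 0, 1) (0, t, 0) := by
    refine intervalIntegral.integral_eq_sub_of_hasDerivAt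
      (f := fun s => surfForm Ω u (0, 1, 0) (0, 0, 1) (s, t, 0)) (fun s _ => ?_) ?_
    · rw [← hkh s]
      exact hasDerivAt_surfForm hu Ω hF hs (hq s 0)
    · have : Continuous fun s : ℝ => fderiv ℝ k (s, 0) (0, 1) :=
        ((hk.continuous_fderiv (by simp)).comp (by fun_prop)).clm_apply continuous_const
      exact this.intervalIntegrable _ _
  rw [← hint]
  exact hasDerivAt_integral_of_contDiff hk 0

/-- A surface c through x with velocities X_H and w is moved by the flows of F. Its area density is
ω(X_H, w) = dH(w) at s = 0 and the left-hand side at s = 1. The difference is the derivative along w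
of the integral of F'_t over orbits, and H_t plus this integral is `pushHam` pulled back by the
time-one map. -/
theorem formAt_flowDeriv (hF : IsTimeDepHamiltonian E F) (hH : IsTimeDepHamiltonian E H) {t : ℝ}
    (ht : t ∈ Icc (0 : ℝ) 1) (x : M) (w : E) :
    Ω.formAt (familyFlow Ω F (1, t, x)) (flowDeriv Ω F 1 (t, x) (1, hamAt Ω (H t) x))
        (flowDeriv Ω F 1 (t, x) (0, w)) =
      differentialAt (pushHam Ω F H t) (familyFlow Ω F (1, t, x))
        (flowDeriv Ω F 1 (t, x) (0, w)) := by
  have hc := hF.isCompactHamiltonian ht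
  obtain ⟨c, hcs, hc0, hcA, hcw⟩ := exists_surface x (hamAt Ω (H t) x) w t
  let u : ℝ × ℝ × ℝ → M := fun q => familyFlow Ω F (q.1, q.2.1, c q.2)
  have hu : ContMDiffOn 𝓘(ℝ, ℝ × ℝ × ℝ) 𝓘(ℝ, E) ∞ u (flowDomain ℝ) := by
    refine (contMDiffOn_familyFlow Ω hF).comp
      (ContMDiff.prodMk (f := fun q : ℝ × ℝ × ℝ => q.1) contDiff_fst.contMDiff
        (ContMDiff.prodMk (f := fun q : ℝ × ℝ × ℝ => q.2.1)
          (contDiff_fst.comp contDiff_snd).contMDiff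
          (hcs.comp contDiff_snd.contMDiff))).contMDiffOn fun q hq => ⟨mem_univ _, hq.2.1, mem_univ _⟩
  have hs : ∀ q ∈ flowDomain ℝ, surfDeriv (E := E) u q (1, 0, 0) = hamAt Ω (F q.2.1) (u q) := by
    intro q hq
    have hline : HasDerivWithinAt (fun s : ℝ => (s, q.2)) ((1 : ℝ), (0 : ℝ × ℝ)) univ q.1 :=
      (hasDerivWithinAt_id _ _).prodMk (hasDerivWithinAt_const _ _ _)
    have h1 := hasVelocityWithinAt_surf_comp hu hline (fun s _ => ⟨mem_univ _, hq.2⟩) hq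
    have h2 : HasVelocityWithinAt (fun s => u (s, q.2)) (hamAt Ω (F q.2.1) (u q)) univ q.1 :=
      (isMIntegralCurve_flow Ω (hF.isCompactHamiltonian hq.2.1) (c q.2) q.1).hasMFDerivWithinAt
    exact h1.unique uniqueDiffWithinAt_univ h2
  have hq : ∀ s r, (s, t, r) ∈ flowDomain ℝ := fun s r => ⟨mem_univ _, ht, mem_univ _⟩
  have htt : HasDerivWithinAt (fun _ : ℝ => t) 0 univ 0 := hasDerivWithinAt_const _ _ _
  have htm : MapsTo (fun _ : ℝ => t) univ (Icc 0 1) := fun _ _ => ht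
  have hcw' : HasVelocityWithinAt (fun r => c (t, r)) w univ 0 := hcw.hasVelocityWithinAt
  have hcA' : HasVelocityWithinAt (fun t => c (t, 0)) (hamAt Ω (H t) x) (Icc 0 1) t :=
    hcA.hasVelocityWithinAt
  -- the velocities of the surface at the two ends of the flow
  have hlt : ∀ s : ℝ, HasDerivWithinAt (fun t : ℝ => (s, t, (0 : ℝ))) ((0 : ℝ), (1 : ℝ), (0 : ℝ))
      (Icc 0 1) t := fun s =>
    (hasDerivWithinAt_const _ _ _).prodMk ((hasDerivWithinAt_id _ _).prodMk
      (hasDerivWithinAt_const _ _ _))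
  have hlr : ∀ s : ℝ, HasDerivWithinAt (fun r : ℝ => (s, t, r)) ((0 : ℝ), (0 : ℝ), (1 : ℝ))
      univ 0 := fun s =>
    (hasDerivWithinAt_const _ _ _).prodMk ((hasDerivWithinAt_const _ _ _).prodMk
      (hasDerivWithinAt_id _ _))
  have hut : ∀ s, HasVelocityWithinAt (fun t => u (s, t, 0)) (surfDeriv (E := E) u (s, t, 0) (0, 1, 0))
      (Icc 0 1) t := fun s =>
    hasVelocityWithinAt_surf_comp hu (hlt s) (fun t ht => ⟨mem_univ _, ht, mem_univ _⟩) (hq s 0)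
  have hur : ∀ s, HasVelocityWithinAt (fun r => u (s, t, r)) (surfDeriv (E := E) u (s, t, 0) (0, 0, 1))
      univ 0 := fun s =>
    hasVelocityWithinAt_surf_comp hu (hlr s) (fun r _ => hq s r) (hq s 0)
  have hut1 : surfDeriv (E := E) u (1, t, 0) (0, 1, 0) =
      flowDeriv Ω F 1 (t, x) (1, hamAt Ω (H t) x) := by
    have h := HasVelocityWithinAt.familyFlow Ω hF 1 (hasDerivWithinAt_id t (Icc (0 : ℝ) 1))
      (mapsTo_id _) ht hcA'
    have h' := (hut 1).unique (uniqueDiffOn_Icc_zero_one t ht) h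
    rw [h']
    simp only [id, hc0]
  have hur1 : surfDeriv (E := E) u (1, t, 0) (0, 0, 1) = flowDeriv Ω F 1 (t, x) (0, w) := by
    have h := HasVelocityWithinAt.familyFlow Ω hF 1 htt htm ht hcw'
    have h' := (hur 1).unique uniqueDiffWithinAt_univ h
    rw [h', hc0]
  have hu0 : ∀ p : ℝ × ℝ, p.1 ∈ Icc (0 : ℝ) 1 → u (0, p) = c p := fun p hp =>
    flow_zero Ω (hF.isCompactHamiltonian hp) _
  have hut0 : surfDeriv (E := E) u (0, t, 0) (0, 1, 0) = hamAt Ω (H t) x :=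
    (hut 0).unique (uniqueDiffOn_Icc_zero_one t ht)
      (HasMFDerivWithinAt.congr_of_eventuallyEq hcA'
        (by filter_upwards [self_mem_nhdsWithin] with s hs using hu0 (s, 0) hs) (hu0 (t, 0) ht))
  have hur0 : surfDeriv (E := E) u (0, t, 0) (0, 0, 1) = w := by
    have : (fun r => u (0, t, r)) = fun r => c (t, r) := funext fun r => hu0 (t, r) ht
    have h := hur 0
    rw [this] at h
    exact h.unique uniqueDiffWithinAt_univ hcw'
  have hk := hasDerivAt_integral_timeDeriv_surf Ω hF hu hs ht
  have hd1 : HasDerivAt (fun r => H t (c (t, r))) (differentialAt (H t) x w) 0 := by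
    have h1 := hcw'.hasDerivWithinAt_comp (f := H t) (mdifferentiableAt_of_family hH.smooth ht _)
    rw [hc0] at h1
    exact hasDerivWithinAt_univ.1 h1
  have hd2 := hd1.add hk
  have hd3 : HasDerivAt (fun r => pushHam Ω F H t (u (1, t, r)))
      (differentialAt (pushHam Ω F H t) (u (1, t, 0)) (flowDeriv Ω F 1 (t, x) (0, w))) 0 := by
    have h1 := (hur 1).hasDerivWithinAt_comp (f := pushHam Ω F H t)
      (mdifferentiableAt_of_family (isTimeDepHamiltonian_pushHam Ω hF hH).smooth ht _)
    rw [hur1] at h1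
    exact hasDerivWithinAt_univ.1 h1
  have hd4 : (fun r => pushHam Ω F H t (u (1, t, r))) =
      (fun r => H t (c (t, r))) + fun r => ∫ σ in (0 : ℝ)..1, timeDeriv F t (u (σ, t, r)) :=
    funext fun r => pushHam_familyFlow Ω hF ht (c (t, r))
  rw [hd4] at hd3
  -- One function of r is differentiated twice: by the chain rule for `pushHam`, and as the sum of
  -- dH(w) and the change of area density. At s = 0 the density cancels dH(w).
  have hfin := hd3.unique hd2
  have hu1 : u (1, t, 0) = familyFlow Ω F (1, t, x) := by simp only [u, hc0]
  have hu00 : u (0, t, 0) = x := (hu0 (t, 0) ht).trans hc0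
  simp only [surfForm, hut0, hur0, hut1, hur1, hu00, hu1, formAt_hamAt] at hfin
  rw [hfin]
  ring

/-- Composing a path generated by `H` with the time-one maps of the flows of a smooth family of
Hamiltonians. -/
theorem generates_pushHam (hF : IsTimeDepHamiltonian E F) (hφ : Generates Ω H φ) :
    Generates Ω (pushHam Ω F H) (fun t => flow (hamField Ω (F t)) 1 ∘ φ t) where
  smooth := (contMDiffOn_familyFlow_time Ω hF 1).comp
    (ContMDiffOn.prodMk (f := fun q : ℝ × M => q.1) contMDiffOn_fst hφ.smooth)
    (show MapsTo _ _ (Icc (0 : ℝ) 1 ×ˢ univ) from fun q hq => ⟨hq.1, mem_univ _⟩)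
  hamiltonian := isTimeDepHamiltonian_pushHam Ω hF hφ.hamiltonian
  ode t ht x := by
    have h1 : HasVelocityWithinAt (fun s => φ s x) (hamAt Ω (H t) (φ t x)) (Icc 0 1) t :=
      hφ.ode t ht x
    have h2 := HasVelocityWithinAt.familyFlow Ω hF 1 (hasDerivWithinAt_id t (Icc (0 : ℝ) 1))
      (mapsTo_id _) ht h1
    have h3 : flowDeriv Ω F 1 (t, φ t x) (1, hamAt Ω (H t) (φ t x)) =
        hamAt Ω (pushHam Ω F H t) (familyFlow Ω F (1, t, φ t x)) := by
      -- The field is identified by pairing with all v, and every v is the image of some w under the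
      -- derivative of the time-one map.
      refine eq_hamAt_of_forall Ω fun v => ?_
      obtain ⟨w, rfl⟩ := flowDeriv_surjective Ω hF ht 1 (φ t x) v
      exact formAt_flowDeriv Ω hF hφ.hamiltonian ht (φ t x) w
    simp only [id] at h2
    rw [h3] at h2
    exact h2

end PushedHamiltonian

/-! ### Maps of a Hamiltonian path are onto -/

section Surjectivity

variable {E : Type u} [NormedAddCommGroup E] [NormedSpace ℝ E] [FiniteDimensional ℝ E]
  {M : Type*} [TopologicalSpace M] [ChartedSpace E M] [IsManifold 𝓘(ℝ, E) ∞ M]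
  (Ω : SymplecticForm E M) {F H : ℝ → M → ℝ} {φ : ℝ → M → M}

/-- The suspension of a time-dependent Hamiltonian vector field to space-time. -/
def suspendedField (F : ℝ → M → ℝ) (q : ℝ × M) : TangentSpace (𝓘(ℝ, ℝ).prod 𝓘(ℝ, E)) q :=
  ((1 : ℝ), hamField Ω (F q.1) q.2)

theorem hasMFDerivAt_suspendedField {α : ℝ → ℝ} {c : ℝ → M} {s : ℝ}
    (hα : HasDerivAt α 1 s) (hc : HasVelocityAt c (hamAt Ω (F (α s)) (c s)) s) :
    HasMFDerivAt 𝓘(ℝ, ℝ) (𝓘(ℝ, ℝ).prod 𝓘(ℝ, E)) (fun s => (α s, c s)) s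
      ((1 : ℝ →L[ℝ] ℝ).smulRight (suspendedField Ω F (α s, c s))) := by
  refine (HasMFDerivAt.prodMk hα.hasFDerivAt.hasMFDerivAt hc).congr_mfderiv ?_
  refine ContinuousLinearMap.ext_ring ?_
  show (((1 : ℝ) • (1 : ℝ), (1 : ℝ) • hamAt Ω (F (α s)) (c s)) : ℝ × E) =
    (1 : ℝ) • ((1 : ℝ), hamAt Ω (F (α s)) (c s))
  rfl

theorem contMDiff_suspendedField
    (hF : ContMDiff (𝓘(ℝ, ℝ).prod 𝓘(ℝ, E)) 𝓘(ℝ, ℝ) ∞ (fun q : ℝ × M => F q.1 q.2)) :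
    ContMDiff (𝓘(ℝ, ℝ).prod 𝓘(ℝ, E)) (𝓘(ℝ, ℝ).prod 𝓘(ℝ, E)).tangent 1
      (fun q => (⟨q, suspendedField Ω F q⟩ :
        TangentBundle (𝓘(ℝ, ℝ).prod 𝓘(ℝ, E)) (ℝ × M))) := by
  have h1 : IsManifold 𝓘(ℝ, E) 1 M := IsManifold.of_le (n := ∞) (by simp)
  have h2 := contMDiffOn_hamField Ω (S := univ) (F := F) hF.contMDiffOn
  rw [univ_prod_univ, contMDiffOn_univ] at h2
  have h3 : ContMDiff 𝓘(ℝ, ℝ) 𝓘(ℝ, ℝ).tangent 1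
      (fun t : ℝ => (⟨t, (1 : ℝ)⟩ : TangentBundle 𝓘(ℝ, ℝ) ℝ)) :=
    contMDiff_vectorSpace_iff_contDiff.2 contDiff_const
  exact contMDiff_equivTangentBundleProd_symm.comp
    ((h3.comp contMDiff_fst).prodMk (h2.of_le (by exact_mod_cast le_top)))

/-- As for the short flows of a family, except that the time coordinate now has velocity 1. A fixed
rescaling factor a serves all nearby initial points. -/
theorem eventually_exists_isMIntegralCurveOn_suspendedField
    (hF : ContMDiff (𝓘(ℝ, ℝ).prod 𝓘(ℝ, E)) 𝓘(ℝ, ℝ) ∞ (fun q : ℝ × M => F q.1 q.2))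
    (q₀ : ℝ × M) :
    ∃ δ > 0, ∀ᶠ q in 𝓝 q₀, ∃ γ : ℝ → ℝ × M, γ 0 = q ∧
      IsMIntegralCurveOn (I := 𝓘(ℝ, ℝ).prod 𝓘(ℝ, E)) γ (suspendedField Ω F) (Ioo (-δ) δ) := by
  obtain ⟨t₀, x₀⟩ := q₀
  set e := extChartAt 𝓘(ℝ, E) x₀
  have hT : IsOpen e.target := isOpen_extChartAt_target x₀
  have hy₀ : e x₀ ∈ e.target := mem_extChartAt_target x₀
  have hFo : ContMDiffOn (𝓘(ℝ, ℝ).prod 𝓘(ℝ, E)) 𝓘(ℝ, ℝ) ∞ (fun q : ℝ × M => F q.1 q.2)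
    (univ ×ˢ univ) := hF.contMDiffOn
  obtain ⟨g, hg, hgf⟩ := exists_contDiff_eventually_eq hT hy₀
    ((contDiffOn_chartField Ω hFo x₀).of_le (m := (1 : ℕ)) (by simp))
  obtain ⟨Y, hY, hY0, hode⟩ := exists_contDiffAt_rescaledFlow one_ne_zero
    (f := fun q : ℝ × E => ((1 : ℝ), g q)) (contDiff_const.prodMk hg) (t₀, e x₀)
  have hsrc : e.source ∈ 𝓝 x₀ := extChartAt_source_mem_nhds x₀
  have hW : {p : ℝ × E | p.2 ∈ e.target ∧ ∀ t, g (t, p.2) = chartField Ω x₀ (F t) p.2} ∈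
      𝓝 (t₀, e x₀) := (continuous_snd.tendsto (t₀, e x₀)).eventually ((hT.eventually_mem hy₀).and hgf)
  have hev := hode.and (eventually_extendCurve_mem hY.continuousAt hY0 hW)
  obtain ⟨a, h4, ha⟩ := ((hev.curry_nhds.filter_mono nhdsWithin_le_nhds).and
    (self_mem_nhdsWithin : Ioi (0 : ℝ) ∈ 𝓝[>] 0)).exists
  have ha0 : (0 : ℝ) < a := ha
  refine ⟨a, ha0, ?_⟩
  have hchart : Filter.Tendsto (fun q : ℝ × M => (q.1, e q.2)) (𝓝 (t₀, x₀)) (𝓝 (t₀, e x₀)) :=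
    (continuous_fst.tendsto (t₀, x₀)).prodMk_nhds
      ((continuousAt_extChartAt (I := 𝓘(ℝ, E)) x₀).tendsto.comp (continuous_snd.tendsto (t₀, x₀)))
  have hxs : ∀ᶠ q : ℝ × M in 𝓝 (t₀, x₀), q.2 ∈ e.source :=
    (continuous_snd.tendsto (t₀, x₀)).eventually hsrc
  filter_upwards [hchart.eventually h4, hxs] with q ⟨⟨hq0, hqode⟩, hqmem⟩ hqs
  set α := extendCurve (Y (a, q.1, e q.2))
  have hd : ∀ s ∈ Ioo (-a) a, HasDerivAt (fun s => α (s / a)) ((1 : ℝ), g (α (s / a))) s := by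
    intro s hs
    have hs' : s / a ∈ Ioo (-2 : ℝ) 2 := by
      have h1 : -1 < s / a := by rw [lt_div_iff₀ ha0]; linarith [hs.1]
      have h2 : s / a < 1 := by rw [div_lt_iff₀ ha0]; linarith [hs.2]
      exact ⟨by linarith, by linarith⟩
    have h := HasDerivAt.scomp s (hqode _ hs') ((hasDerivAt_id s).div_const a)
    rw [smul_smul, one_div, inv_mul_cancel₀ ha0.ne', one_smul] at h
    exact h
  have hfst : ∀ s ∈ Ioo (-a) a, HasDerivAt (fun s => (α (s / a)).1) 1 s := fun s hs => by
    simpa using (hd s hs).hasFDerivAt.fst.hasDerivAt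
  refine ⟨fun s => ((α (s / a)).1, e.symm (α (s / a)).2), ?_, fun s hs => ?_⟩
  · simp only [zero_div, hq0]
    exact Prod.ext rfl (e.left_inv hqs)
  · refine (hasMFDerivAt_suspendedField Ω (hfst s hs) ?_).hasMFDerivWithinAt
    have h' : HasDerivAt (fun s => (α (s / a)).2) (g (α (s / a))) s := by
      simpa using (hd s hs).hasFDerivAt.snd.hasDerivAt
    have hv := hasVelocityAt_chart_symm (x₀ := x₀) h' (hqmem _).1
    have h6 : g (α (s / a)) = chartField Ω x₀ (F (α (s / a)).1) (α (s / a)).2 := (hqmem _).2 _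
    rw [h6, chartSymmDeriv_chartField Ω (hqmem _).1
      (mdifferentiableAt_of_family hFo (mem_univ _) _)] at hv
    exact hv

variable [T2Space M]

theorem exists_isMIntegralCurve_suspendedField
    (hF : ContMDiff (𝓘(ℝ, ℝ).prod 𝓘(ℝ, E)) 𝓘(ℝ, ℝ) ∞ (fun q : ℝ × M => F q.1 q.2))
    {K : Set M} (hK : IsCompact K) (h0 : ∀ t, ∀ x ∉ K, F t x = 0)
    (h1 : ∀ t ∉ Icc (0 : ℝ) 1, ∀ x, F t x = 0) (q : ℝ × M) :
    ∃ γ : ℝ → ℝ × M, γ 0 = q ∧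
      IsMIntegralCurve (I := 𝓘(ℝ, ℝ).prod 𝓘(ℝ, E)) γ (suspendedField Ω F) := by
  have hM : IsManifold 𝓘(ℝ, E) 1 M := IsManifold.of_le (n := ∞) (by simp)
  -- The interval [-1, 2] leaves a margin of 1 around [0, 1]: a curve starting outside with space
  -- coordinate in K cannot meet the times where F is nonzero while |s| < 1, so its space coordinate
  -- stays fixed.
  refine exists_isMIntegralCurve_of_isCompact (contMDiff_suspendedField Ω hF)
    ((isCompact_Icc (a := (-1 : ℝ)) (b := 2)).prod hK)
    (fun q _ => eventually_exists_isMIntegralCurveOn_suspendedField Ω hF q)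
    ⟨1, one_pos, fun q hq => ⟨fun s => (q.1 + s, q.2), by simp, fun s hs => ?_⟩⟩ q
  refine (hasMFDerivAt_suspendedField Ω ((hasDerivAt_id s).const_add q.1) ?_).hasMFDerivWithinAt
  have h2 : hamAt Ω (F (q.1 + s)) q.2 = 0 := by
    by_cases hx : q.2 ∈ K
    · refine hamAt_eq_zero_of_eventually Ω (Filter.Eventually.of_forall (h1 _ fun h => hq ⟨?_, hx⟩))
      exact ⟨by linarith [hs.2, h.1], by linarith [hs.1, h.2]⟩
    · exact hamField_eq_zero_of_notMem Ω hK (h0 _) hx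
  have h3 : HasVelocityAt (fun _ : ℝ => q.2) (0 : E) s := by
    refine (hasMFDerivAt_const q.2 s).congr_mfderiv (ContinuousLinearMap.ext_ring ?_)
    exact (smul_zero (1 : ℝ) : (1 : ℝ) • (0 : E) = 0).symm
  show HasVelocityAt (fun _ : ℝ => q.2) (hamAt Ω (F (q.1 + s)) q.2) s
  rwa [h2]

/-- Reparametrizing by a smooth step θ turns H into F_s = θ'(s) H_{θ(s)}, defined for all s, and the
curves s ↦ (s, φ_{θ(s)}(x)) follow its suspended field. The integral curve through (τ, y) with θ(τ)
= t, followed back to time 0, arrives at some φ_0(x); uniqueness of integral curves then gives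
φ_t(x) = y. -/
theorem Generates.surjective (hφ : Generates Ω H φ) (h0 : Function.Surjective (φ 0)) {t : ℝ}
    (ht : t ∈ Icc (0 : ℝ) 1) : Function.Surjective (φ t) := by
  have hM : IsManifold 𝓘(ℝ, E) 1 M := IsManifold.of_le (n := ∞) (by simp)
  let θ : ℝ → ℝ := Real.smoothTransition
  have hθ : ContDiff ℝ ∞ θ := Real.smoothTransition.contDiff
  have hθI : ∀ s, θ s ∈ Icc (0 : ℝ) 1 := fun s =>
    ⟨Real.smoothTransition.nonneg s, Real.smoothTransition.le_one s⟩
  have hθ' : ContDiff ℝ ∞ (deriv θ) := (contDiff_infty_iff_deriv.1 hθ).2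
  have hθd : ∀ s, HasDerivAt θ (deriv θ s) s := fun s =>
    (hθ.differentiable (by simp) s).hasDerivAt
  have hθ0 : ∀ s ∉ Icc (0 : ℝ) 1, deriv θ s = 0 := by
    intro s hs
    have : ∃ c, θ =ᶠ[𝓝 s] fun _ => c := by
      rcases lt_or_ge s 0 with h | h
      · exact ⟨0, by filter_upwards [Iio_mem_nhds h] with r hr using
          Real.smoothTransition.zero_of_nonpos (le_of_lt hr)⟩
      · have h' : 1 < s := by
          by_contra! h''
          exact hs ⟨h, h''⟩
        exact ⟨1, by filter_upwards [Ioi_mem_nhds h'] with r hr using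
          Real.smoothTransition.one_of_one_le (le_of_lt hr)⟩
    obtain ⟨c, hc⟩ := this
    rw [hc.deriv_eq, deriv_const]
  let F : ℝ → M → ℝ := fun s x => deriv θ s * H (θ s) x
  have hF : ContMDiff (𝓘(ℝ, ℝ).prod 𝓘(ℝ, E)) 𝓘(ℝ, ℝ) ∞ (fun q : ℝ × M => F q.1 q.2) := by
    refine (hθ'.contMDiff.comp contMDiff_fst).mul ?_
    rw [← contMDiffOn_univ]
    exact hφ.hamiltonian.smooth.comp (f := fun q : ℝ × M => (θ q.1, q.2))
      ((hθ.contMDiff.comp contMDiff_fst).prodMk contMDiff_snd).contMDiffOn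
      fun q _ => ⟨hθI _, mem_univ _⟩
  obtain ⟨K, hK, hKH⟩ := hφ.hamiltonian.compactSupport
  intro y
  obtain ⟨τ, -, hτ⟩ : ∃ τ ∈ Icc (0 : ℝ) 1, θ τ = t := by
    refine intermediate_value_Icc zero_le_one hθ.continuous.continuousOn ?_
    simpa [θ] using ht
  obtain ⟨γ, hγ0, hγ⟩ := exists_isMIntegralCurve_suspendedField Ω hF hK
    (fun s x hx => by simp only [F, hKH _ (hθI s) x hx, mul_zero])
    (fun s hs x => by simp only [F, hθ0 s hs, zero_mul]) (τ, y)
  have hcurve : ∀ x, IsMIntegralCurve (I := 𝓘(ℝ, ℝ).prod 𝓘(ℝ, E))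
      (fun s => (τ + s, φ (θ (τ + s)) x)) (suspendedField Ω F) := by
    intro x s
    refine hasMFDerivAt_suspendedField Ω ((hasDerivAt_id s).const_add τ) ?_
    have h1 : HasDerivAt (fun s => θ (τ + s)) (deriv θ (τ + s)) s := (hθd _).comp_const_add τ s
    have h2 : HasMFDerivAt 𝓘(ℝ, ℝ) 𝓘(ℝ, E) (fun s => φ (θ (τ + s)) x) s _ :=
      hasMFDerivWithinAt_univ.1 (HasMFDerivWithinAt.comp (g := fun s => φ s x) s
        (hφ.ode (θ (τ + s)) (hθI _) x)
        (h1.hasFDerivAt.hasMFDerivAt.hasMFDerivWithinAt (s := univ)) fun s _ => hθI _)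
    have h3 : hamAt Ω (F (τ + s)) (φ (θ (τ + s)) x) =
        deriv θ (τ + s) • hamAt Ω (H (θ (τ + s))) (φ (θ (τ + s)) x) :=
      hamAt_const_mul Ω _ (mdifferentiableAt_of_family hφ.hamiltonian.smooth (hθI _) _)
    show HasVelocityAt (fun s => φ (θ (τ + s)) x) (hamAt Ω (F (τ + s)) (φ (θ (τ + s)) x)) s
    rw [h3]
    refine h2.congr_mfderiv ?_
    refine ContinuousLinearMap.ext_ring ?_
    show ((1 : ℝ) • deriv θ (τ + s)) • hamAt Ω (H (θ (τ + s))) (φ (θ (τ + s)) x) =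
      (1 : ℝ) • (deriv θ (τ + s) • hamAt Ω (H (θ (τ + s))) (φ (θ (τ + s)) x))
    rw [one_smul, one_smul]
  have htime : ∀ s, (γ s).1 = τ + s := by
    have hd : ∀ s, HasDerivAt (fun s => (γ s).1 - s) 0 s := by
      intro s
      have h1 : HasFDerivAt (fun s => (γ s).1)
          (ContinuousLinearMap.fst ℝ ℝ E ∘L (1 : ℝ →L[ℝ] ℝ).smulRight
            ((1 : ℝ), hamAt Ω (F (γ s).1) (γ s).2)) s :=
        ((hasMFDerivAt_fst (I := 𝓘(ℝ, ℝ)) (I' := 𝓘(ℝ, E)) (γ s)).comp s (hγ s)).hasFDerivAt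
      exact (h1.hasDerivAt.sub (hasDerivAt_id s)).congr_deriv (by simp)
    intro s
    have h := is_const_of_deriv_eq_zero (fun s => (hd s).differentiableAt)
      (fun s => (hd s).deriv) s 0
    simp only [hγ0, sub_zero] at h
    linarith
  have hunique : ∀ x, φ 0 x = (γ (-τ)).2 → γ = fun s => (τ + s, φ (θ (τ + s)) x) := by
    intro x hx
    refine isMIntegralCurve_Ioo_eq_of_contMDiff_boundaryless (I := 𝓘(ℝ, ℝ).prod 𝓘(ℝ, E))
      (t₀ := -τ) (contMDiff_suspendedField Ω hF) hγ (hcurve x) (Prod.ext (htime _) ?_)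
    have h6 : θ 0 = 0 := Real.smoothTransition.zero
    simp only [add_neg_cancel, h6, hx]
  obtain ⟨x, hx⟩ := h0 (γ (-τ)).2
  have h5 := congrFun (hunique x hx) 0
  rw [hγ0] at h5
  refine ⟨x, ?_⟩
  have h6 := congrArg Prod.snd h5
  simp only [add_zero, hτ] at h6
  exact h6.symm

end Surjectivity

/-! ### Extrema and oscillation -/

section Extrema

variable {M : Type*}

theorem totVar_eq {f : M → ℝ} {x y : M} (hx : x ∈ maxset f) (hy : y ∈ minset f) :
    totVar f = f x - f y := by
  have : Nonempty M := ⟨x⟩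
  rw [totVar, le_antisymm (ciSup_le hx) (le_ciSup ⟨f x, forall_mem_range.2 hx⟩ x),
    le_antisymm (ciInf_le ⟨f y, forall_mem_range.2 hy⟩ y) (le_ciInf hy)]

theorem maxset_eq_of_add_const {f g : M → ℝ} {c : ℝ} (h : ∀ x, f x = g x + c) :
    maxset f = maxset g := by
  ext x
  simp only [maxset, mem_ofPred_eq, h, add_le_add_iff_right]

theorem minset_eq_of_add_const {f g : M → ℝ} {c : ℝ} (h : ∀ x, f x = g x + c) :
    minset f = minset g := by
  ext x
  simp only [minset, mem_ofPred_eq, h, add_le_add_iff_right]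

theorem abs_totVar_sub_le {f g : M → ℝ} {x y x' y' : M} (hx : x ∈ maxset f) (hy : y ∈ minset f)
    (hx' : x' ∈ maxset g) (hy' : y' ∈ minset g) {δ : ℝ} (h : ∀ z, |f z - g z| ≤ δ) :
    |totVar f - totVar g| ≤ 2 * δ := by
  rw [totVar_eq hx hy, totVar_eq hx' hy']
  have h1 := abs_le.1 (h x)
  have h2 := abs_le.1 (h y)
  have h3 := abs_le.1 (h x')
  have h4 := abs_le.1 (h y')
  rw [abs_le]
  constructor <;> linarith [hx x', hx' x, hy y', hy' y]

variable {E : Type u} [NormedAddCommGroup E] [NormedSpace ℝ E]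
  [TopologicalSpace M] [ChartedSpace E M] [IsManifold 𝓘(ℝ, E) ∞ M] [T2Space M]

theorem IsCompactHamiltonian.exists_mem_maxset [Nonempty M] {g : M → ℝ}
    (hg : IsCompactHamiltonian (E := E) g) : ∃ x, x ∈ maxset g := by
  obtain ⟨K, hK, h0⟩ := hg.compactSupport
  exact hg.smooth.continuous.exists_forall_ge_of_hasCompactSupport (HasCompactSupport.intro hK h0)

theorem IsCompactHamiltonian.exists_mem_minset [Nonempty M] {g : M → ℝ}
    (hg : IsCompactHamiltonian (E := E) g) : ∃ x, x ∈ minset g := by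
  obtain ⟨K, hK, h0⟩ := hg.compactSupport
  exact hg.smooth.continuous.exists_forall_le_of_hasCompactSupport (HasCompactSupport.intro hK h0)

variable [FiniteDimensional ℝ E] {F : ℝ → M → ℝ}

/-- On the common compact support, F_t → F_{t₀} uniformly, and the oscillation is 2-Lipschitz for
the sup norm. -/
theorem IsTimeDepHamiltonian.continuousOn_totVar [Nonempty M] (hF : IsTimeDepHamiltonian E F) :
    ContinuousOn (fun t => totVar (F t)) (Icc 0 1) := by
  intro t₀ ht₀
  obtain ⟨K, hK, h0⟩ := hF.compactSupport
  refine Metric.tendsto_nhds.2 fun ε hε => ?_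
  obtain ⟨v, hv, hvK⟩ := hK.mem_uniformity_of_prod (f := F) (s := Icc (0 : ℝ) 1)
    (hF.smooth.continuousOn.mono (prod_mono_right (subset_univ K))) ht₀
    (Metric.dist_mem_uniformity (show 0 < ε / 3 by positivity))
  filter_upwards [hv, self_mem_nhdsWithin] with t htv ht
  obtain ⟨x, hx⟩ := (hF.isCompactHamiltonian ht).exists_mem_maxset
  obtain ⟨y, hy⟩ := (hF.isCompactHamiltonian ht).exists_mem_minset
  obtain ⟨x', hx'⟩ := (hF.isCompactHamiltonian ht₀).exists_mem_maxset
  obtain ⟨y', hy'⟩ := (hF.isCompactHamiltonian ht₀).exists_mem_minset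
  refine (abs_totVar_sub_le hx hy hx' hy' (δ := ε / 3) fun z => ?_).trans_lt (by linarith)
  by_cases hz : z ∈ K
  · exact (show dist (F t z) (F t₀ z) < ε / 3 from hvK t htv z hz).le
  · rw [h0 t ht z hz, h0 t₀ ht₀ z hz, sub_self, abs_zero]
    positivity

theorem IsTimeDepHamiltonian.exists_bound (hF : IsTimeDepHamiltonian E F) :
    ∃ C, ∀ t ∈ Icc (0 : ℝ) 1, ∀ x, |F t x| ≤ C := by
  obtain ⟨K, hK, h0⟩ := hF.compactSupport
  obtain ⟨C, hC⟩ := (isCompact_Icc.prod hK).exists_bound_of_continuousOn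
    (hF.smooth.continuousOn.mono (prod_mono_right (subset_univ K)))
  refine ⟨max C 0, fun t ht x => ?_⟩
  by_cases hx : x ∈ K
  · exact (hC (t, x) ⟨ht, hx⟩).trans (le_max_left _ _)
  · rw [h0 t ht x hx, abs_zero]
    exact le_max_right _ _

end Extrema

/-! ### Uniqueness of generating Hamiltonians -/

section Uniqueness

variable {E : Type u} [NormedAddCommGroup E] [NormedSpace ℝ E] [FiniteDimensional ℝ E]
  {M : Type*} [TopologicalSpace M] [ChartedSpace E M] [IsManifold 𝓘(ℝ, E) ∞ M]
  {Ω : SymplecticForm E M} {F G H K : ℝ → M → ℝ} {φ : ℝ → M → M}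

theorem apply_eq_of_differentialAt_eq_zero [ConnectedSpace M] {f : M → ℝ}
    (hf : ContMDiff 𝓘(ℝ, E) 𝓘(ℝ, ℝ) ∞ f) (h : ∀ x, differentialAt (E := E) f x = 0) (x y : M) :
    f x = f y := by
  refine IsLocallyConstant.apply_eq_of_preconnectedSpace
    ((IsLocallyConstant.iff_eventually_eq f).2 fun x => ?_) x y
  set e := extChartAt 𝓘(ℝ, E) x
  obtain ⟨R, hR, hRT⟩ := Metric.mem_nhds_iff.1
    (chartTarget_mem_nhds (mem_extChartAt_target (I := 𝓘(ℝ, E)) x))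
  have hd : ∀ y ∈ Metric.ball (e x) R, HasFDerivAt (f ∘ e.symm) (0 : E →L[ℝ] ℝ) y := by
    intro y hy
    have h1 := hasFDerivAt_comp_chart_symm (hRT hy) (hf.mdifferentiableAt (by simp))
    rwa [h, ContinuousLinearMap.zero_comp] at h1
  filter_upwards [extChartAt_source_mem_nhds (I := 𝓘(ℝ, E)) x,
    (continuousAt_extChartAt (I := 𝓘(ℝ, E)) x).eventually (Metric.ball_mem_nhds (e x) hR)] with z hz hz'
  have h2 : (f ∘ e.symm) (e z) = (f ∘ e.symm) (e x) :=
    Metric.isOpen_ball.is_const_of_fderiv_eq_zero (convex_ball _ _).isPreconnected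
      (fun y hy => (hd y hy).differentiableAt.differentiableWithinAt)
      (fun y hy => (hd y hy).fderiv) hz' (Metric.mem_ball_self hR)
  simpa only [Function.comp, e.left_inv hz, e.left_inv (mem_extChartAt_source x)] using h2

/-- The velocity of the path determines the Hamiltonian field, hence the differential of the
Hamiltonian, at the points φ_t(x). Surjectivity of φ_t makes these all points, and M is connected.
-/
theorem Generates.exists_eq_add_const [ConnectedSpace M] (hH : Generates Ω H φ)
    (hK : Generates Ω K φ) {t : ℝ} (ht : t ∈ Icc (0 : ℝ) 1) (hs : Function.Surjective (φ t)) :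
    ∃ c, ∀ x, H t x = K t x + c := by
  have hHs := contMDiff_of_family hH.hamiltonian.smooth ht
  have hKs := contMDiff_of_family hK.hamiltonian.smooth ht
  have h0 : ∀ y, differentialAt (E := E) (fun x => H t x - K t x) y = 0 := by
    intro y
    obtain ⟨x, rfl⟩ := hs y
    have h1 : HasVelocityWithinAt (fun s => φ s x) (hamAt Ω (H t) (φ t x)) (Icc 0 1) t :=
      hH.ode t ht x
    have h2 : HasVelocityWithinAt (fun s => φ s x) (hamAt Ω (K t) (φ t x)) (Icc 0 1) t :=
      hK.ode t ht x
    have h3 := h1.unique (uniqueDiffOn_Icc_zero_one t ht) h2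
    have h4 : differentialAt (E := E) (H t) (φ t x) = differentialAt (K t) (φ t x) :=
      ContinuousLinearMap.ext fun v => by rw [← formAt_hamAt Ω, ← formAt_hamAt Ω, h3]
    have h5 : differentialAt (E := E) (fun x => H t x - K t x) (φ t x) =
        differentialAt (H t) (φ t x) - differentialAt (K t) (φ t x) :=
      ((hHs.mdifferentiableAt (by simp)).hasMFDerivAt.sub
        (hKs.mdifferentiableAt (by simp)).hasMFDerivAt).mfderiv
    rw [h5, h4, sub_self]
  obtain ⟨x₀⟩ := (inferInstance : Nonempty M)
  refine ⟨H t x₀ - K t x₀, fun x => ?_⟩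
  have := apply_eq_of_differentialAt_eq_zero (hHs.sub hKs) h0 x x₀
  linarith

theorem Generates.generates_generatingHamiltonian (hH : Generates Ω H φ) :
    Generates Ω (generatingHamiltonian Ω φ) φ := by
  have h : ∃ H, Generates Ω H φ := ⟨H, hH⟩
  rw [generatingHamiltonian, dif_pos h]
  exact h.choose_spec

variable [T2Space M]

/-- Surjectivity is propagated twice: from the identity to φ_0, then from φ_0 along the path. -/
theorem IsHamiltonianPath.surjective (hφ : IsHamiltonianPath Ω φ) {t : ℝ}
    (ht : t ∈ Icc (0 : ℝ) 1) : Function.Surjective (φ t) := by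
  obtain ⟨⟨H, ψ, hψ, h0, h1⟩, K, hK⟩ := hφ
  refine hK.surjective Ω ?_ ht
  rw [← h1]
  exact hψ.surjective Ω (h0 ▸ Function.surjective_id) (by norm_num)

theorem IsTimeDepHamiltonian.const_mul (hF : IsTimeDepHamiltonian E F) (ε : ℝ) :
    IsTimeDepHamiltonian E fun t x => ε * F t x where
  smooth := contMDiffOn_const.mul hF.smooth
  compactSupport := let ⟨K, hK, h⟩ := hF.compactSupport
    ⟨K, hK, fun t ht x hx => by rw [h t ht x hx, mul_zero]⟩

theorem Generates.variation (hG : IsTimeDepHamiltonian E G) (hφ : Generates Ω H φ) (ε : ℝ) :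
    Generates Ω (pushHam Ω (fun t x => ε * G t x) H) (variation Ω G φ ε) :=
  generates_pushHam Ω (hG.const_mul ε) hφ

theorem IsHamiltonianPath.variation (hG : IsTangentField E G) (hφ : IsHamiltonianPath Ω φ) (ε : ℝ) :
    IsHamiltonianPath Ω (variation Ω G φ ε) := by
  obtain ⟨h0, H, hH⟩ := hφ
  refine ⟨?_, _, hH.variation hG.hamiltonian ε⟩
  -- As G_0 = 0 has empty support, its flow fixes every point and the variation keeps the starting
  -- point φ_0.
  have : HoferVariation.variation Ω G φ ε 0 = φ 0 := funext fun x =>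
    flow_of_notMem Ω ((hG.hamiltonian.isCompactHamiltonian (by norm_num)).const_mul ε) isCompact_empty
      (fun x _ => by rw [hG.zero, Pi.zero_apply, mul_zero]) (notMem_empty _) 1
  rwa [this]

end Uniqueness

/-! ### Envelope principle and differentiation of the integral -/

section Calculus

/-- From ε c(ε) ≤ ε b(ε), positive ε gives C ≤ B and negative ε gives B ≤ C. The difference quotient
of m lies between the minimum and the maximum of b(ε) and c(ε). -/
theorem hasDerivAt_of_squeeze {m b c : ℝ → ℝ} {B C m₀ : ℝ} (hb : Filter.Tendsto b (𝓝 0) (𝓝 B))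
    (hc : Filter.Tendsto c (𝓝 0) (𝓝 C))
    (h : ∀ᶠ ε in 𝓝 0, m₀ + ε * c ε ≤ m ε ∧ m ε ≤ m₀ + ε * b ε) :
    C = B ∧ HasDerivAt m B 0 := by
  have h1 : C ≤ B := by
    refine le_of_tendsto_of_tendsto (hc.mono_left nhdsWithin_le_nhds)
      (hb.mono_left nhdsWithin_le_nhds) (b := 𝓝[>] 0) ?_
    filter_upwards [nhdsWithin_le_nhds h, self_mem_nhdsWithin] with ε hε hpos
    exact le_of_mul_le_mul_left (by linarith) (mem_Ioi.1 hpos)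
  have h2 : B ≤ C := by
    refine le_of_tendsto_of_tendsto (hb.mono_left nhdsWithin_le_nhds)
      (hc.mono_left nhdsWithin_le_nhds) (b := 𝓝[<] 0) ?_
    filter_upwards [nhdsWithin_le_nhds h, self_mem_nhdsWithin] with ε hε hneg
    exact le_of_mul_le_mul_left (by linarith) (neg_pos.2 (mem_Iio.1 hneg))
  have hCB := le_antisymm h1 h2
  refine ⟨hCB, hasDerivAt_iff_tendsto_slope_zero.2 ?_⟩
  subst hCB
  have hm0 : m 0 = m₀ := by
    have := h.self_of_nhds
    linarith [this.1, this.2]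
  have hmin := (hb.min hc).mono_left (nhdsWithin_le_nhds (s := {0}ᶜ))
  have hmax := (hb.max hc).mono_left (nhdsWithin_le_nhds (s := {0}ᶜ))
  rw [min_self] at hmin
  rw [max_self] at hmax
  have key : ∀ᶠ ε in 𝓝[≠] (0 : ℝ), min (b ε) (c ε) ≤ ε⁻¹ • (m (0 + ε) - m 0) ∧
      ε⁻¹ • (m (0 + ε) - m 0) ≤ max (b ε) (c ε) := by
    filter_upwards [nhdsWithin_le_nhds h, self_mem_nhdsWithin] with ε hε hne
    rw [zero_add, hm0, smul_eq_mul]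
    have hεε : ε * (ε⁻¹ * (m ε - m₀)) = m ε - m₀ := mul_inv_cancel_left₀ hne _
    rcases lt_or_gt_of_ne hne with hneg | hpos
    · exact ⟨min_le_of_left_le (le_of_mul_le_mul_left (by linarith) (neg_pos.2 hneg)),
        le_max_of_le_right (le_of_mul_le_mul_left (by linarith) (neg_pos.2 hneg))⟩
    · exact ⟨min_le_of_right_le (le_of_mul_le_mul_left (by linarith) hpos),
        le_max_of_le_left (le_of_mul_le_mul_left (by linarith) hpos)⟩
  exact tendsto_of_tendsto_of_tendsto_of_le_of_le' hmin hmax (key.mono fun _ h => h.1)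
    (key.mono fun _ h => h.2)

/-- Dominated convergence for the difference quotients at 0, all bounded by C. The limit F' is
measurable as their pointwise limit, so no regularity in t of the extremal points is required. -/
theorem hasDerivAt_integral_of_lipschitz_at {F : ℝ → ℝ → ℝ} {F' : ℝ → ℝ} {C : ℝ}
    (hF : ∀ ε, IntervalIntegrable (F ε) MeasureTheory.volume 0 1)
    (hlip : ∀ t ∈ Icc (0 : ℝ) 1, ∀ ε, |F ε t - F 0 t| ≤ C * |ε|)
    (hd : ∀ t ∈ Icc (0 : ℝ) 1, HasDerivAt (fun ε => F ε t) (F' t) 0) :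
    IntervalIntegrable F' MeasureTheory.volume 0 1 ∧
      HasDerivAt (fun ε => ∫ t in (0 : ℝ)..1, F ε t) (∫ t in (0 : ℝ)..1, F' t) 0 := by
  have hI : ∀ t ∈ uIoc (0 : ℝ) 1, t ∈ Icc (0 : ℝ) 1 := fun t ht => by
    rw [uIoc_of_le zero_le_one] at ht
    exact Ioc_subset_Icc_self ht
  have hC : 0 ≤ C := by simpa using (abs_nonneg _).trans (hlip 0 (by norm_num) 1)
  have hslope : ∀ ε, MeasureTheory.AEStronglyMeasurable (fun t => ε⁻¹ • (F (0 + ε) t - F 0 t))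
      (MeasureTheory.volume.restrict (uIoc 0 1)) := fun ε =>
    (((hF (0 + ε)).sub (hF 0)).def'.aestronglyMeasurable).const_smul ε⁻¹
  have hlim : ∀ᵐ t ∂(MeasureTheory.volume.restrict (uIoc (0 : ℝ) 1)),
      Filter.Tendsto (fun ε => ε⁻¹ • (F (0 + ε) t - F 0 t)) (𝓝[≠] 0) (𝓝 (F' t)) :=
    (MeasureTheory.ae_restrict_iff' measurableSet_uIoc).2 (Filter.Eventually.of_forall fun t ht =>
      hasDerivAt_iff_tendsto_slope_zero.1 (hd t (hI t ht)))
  have hmeas : MeasureTheory.AEStronglyMeasurable F'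
      (MeasureTheory.volume.restrict (uIoc (0 : ℝ) 1)) :=
    aestronglyMeasurable_of_tendsto_ae (𝓝[≠] (0 : ℝ)) hslope hlim
  refine ⟨?_, hasDerivAt_iff_tendsto_slope_zero.2 ?_⟩
  · refine (intervalIntegrable_const (c := C)).mono_fun hmeas ?_
    refine (MeasureTheory.ae_restrict_iff' measurableSet_uIoc).2
      (Filter.Eventually.of_forall fun t ht => ?_)
    refine ((hd t (hI t ht)).le_of_lip' hC (Filter.Eventually.of_forall fun ε => ?_)).trans
      (le_abs_self C)
    simpa using hlip t (hI t ht) ε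
  · have h := intervalIntegral.tendsto_integral_filter_of_dominated_convergence
      (F := fun ε t => ε⁻¹ • (F (0 + ε) t - F 0 t)) (l := 𝓝[≠] (0 : ℝ)) (a := 0) (b := 1)
      (μ := MeasureTheory.volume) (f := F') (fun _ => C)
      (Filter.Eventually.of_forall hslope) ?_ intervalIntegrable_const
      ((MeasureTheory.ae_restrict_iff' measurableSet_uIoc).1 hlim)
    · refine h.congr fun ε => ?_
      rw [intervalIntegral.integral_smul, intervalIntegral.integral_sub (hF _) (hF _)]
    · filter_upwards [self_mem_nhdsWithin] with ε hε
      refine Filter.Eventually.of_forall fun t ht => ?_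
      rw [norm_smul, norm_inv, zero_add, inv_mul_le_iff₀ (norm_pos_iff.2 hε), mul_comm]
      exact hlip t (hI t ht) ε

variable {M : Type*} {h : M → ℝ} {a : ℝ → M → ℝ}

/-- Testing the maximality of z(ε) at x bounds the value from below by h(x) + ε a_ε(x); h(z(ε)) ≤
h(x) bounds it from above by h(x) + ε a_ε(z(ε)). -/
theorem hasDerivAt_of_maximizers [TopologicalSpace M] {z : ℝ → M} (ha : Continuous (Function.uncurry a))
    (hz : ContinuousAt z 0) (hmax : ∀ᶠ ε in 𝓝 0, z ε ∈ maxset fun x => h x + ε * a ε x) {x : M}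
    (hx : x ∈ maxset h) :
    a 0 x = a 0 (z 0) ∧ HasDerivAt (fun ε => h (z ε) + ε * a ε (z ε)) (a 0 (z 0)) 0 := by
  refine hasDerivAt_of_squeeze (m₀ := h x) (b := fun ε => a ε (z ε)) (c := fun ε => a ε x) ?_ ?_ ?_
  · exact ContinuousAt.comp (g := Function.uncurry a) (f := fun ε => (ε, z ε)) ha.continuousAt
      (continuousAt_id.prodMk hz)
  · exact (ha.comp (by fun_prop : Continuous fun ε : ℝ => (ε, x))).tendsto 0
  · filter_upwards [hmax] with ε hε
    exact ⟨hε x, by linarith [hx (z ε)]⟩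

/-- The same squeeze with the two bounds exchanged. -/
theorem hasDerivAt_of_minimizers [TopologicalSpace M] {z : ℝ → M} (ha : Continuous (Function.uncurry a))
    (hz : ContinuousAt z 0) (hmin : ∀ᶠ ε in 𝓝 0, z ε ∈ minset fun x => h x + ε * a ε x) {x : M}
    (hx : x ∈ minset h) :
    a 0 x = a 0 (z 0) ∧ HasDerivAt (fun ε => h (z ε) + ε * a ε (z ε)) (a 0 (z 0)) 0 := by
  obtain ⟨h1, h2⟩ : a 0 (z 0) = a 0 x ∧
      HasDerivAt (fun ε => h (z ε) + ε * a ε (z ε)) (a 0 x) 0 := by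
    refine hasDerivAt_of_squeeze (m₀ := h x) (c := fun ε => a ε (z ε)) (b := fun ε => a ε x) ?_ ?_ ?_
    · exact (ha.comp (by fun_prop : Continuous fun ε : ℝ => (ε, x))).tendsto 0
    · exact ContinuousAt.comp (g := Function.uncurry a) (f := fun ε => (ε, z ε)) ha.continuousAt
        (continuousAt_id.prodMk hz)
    · filter_upwards [hmin] with ε hε
      exact ⟨by linarith [hx (z ε)], hε x⟩
  exact ⟨h1.symm, h1 ▸ h2⟩

end Calculus

/-! ### Oscillation of the varied Hamiltonians -/

section FirstVariation

variable {E : Type u} [NormedAddCommGroup E] [NormedSpace ℝ E] [FiniteDimensional ℝ E]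
  {M : Type*} [TopologicalSpace M] [ChartedSpace E M] [IsManifold 𝓘(ℝ, E) ∞ M] [T2Space M]
  (Ω : SymplecticForm E M) {G H : ℝ → M → ℝ} {φ : ℝ → M → M} {t : ℝ}

/-- The average of the time derivative of `G` along a piece of an orbit of the flow of `G_t`. -/
def orbitAverage (G : ℝ → M → ℝ) (t ε : ℝ) (z : M) : ℝ :=
  ∫ σ in (0 : ℝ)..1, timeDeriv G t (flow (hamField Ω (G t)) (σ * ε) z)

theorem continuous_flow (hG : IsTimeDepHamiltonian E G) (ht : t ∈ Icc (0 : ℝ) 1) :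
    Continuous fun q : ℝ × M => flow (hamField Ω (G t)) q.1 q.2 := by
  rw [← continuousOn_univ]
  exact (contMDiffOn_familyFlow Ω hG).continuousOn.comp (f := fun q : ℝ × M => (q.1, t, q.2))
    (by fun_prop) fun q _ => ⟨mem_univ _, ht, mem_univ _⟩

theorem continuous_orbitAverage [FirstCountableTopology M] (hG : IsTimeDepHamiltonian E G)
    (ht : t ∈ Icc (0 : ℝ) 1) : Continuous (Function.uncurry (orbitAverage Ω G t)) := by
  refine intervalIntegral.continuous_parametric_intervalIntegral_of_continuous'
    (f := fun (q : ℝ × M) σ => timeDeriv G t (flow (hamField Ω (G t)) (σ * q.1) q.2)) ?_ 0 1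
  exact (contMDiff_of_family hG.timeDeriv.smooth ht).continuous.comp
    ((continuous_flow Ω hG ht).comp (f := fun p : (ℝ × M) × ℝ => (p.2 * p.1.1, p.1.2)) (by fun_prop))

theorem orbitAverage_zero (hG : IsTimeDepHamiltonian E G) (ht : t ∈ Icc (0 : ℝ) 1) (z : M) :
    orbitAverage Ω G t 0 z = timeDeriv G t z := by
  simp [orbitAverage, flow_zero Ω (hG.isCompactHamiltonian ht)]

theorem timeDeriv_const_mul (hG : IsTimeDepHamiltonian E G) (ht : t ∈ Icc (0 : ℝ) 1) (ε : ℝ) (x : M) :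
    timeDeriv (fun t x => ε * G t x) t x = ε * timeDeriv G t x :=
  ((hasDerivWithinAt_timeDeriv hG ht x).const_mul ε).derivWithin (uniqueDiffOn_Icc_zero_one t ht)

/-- The time-σ map of the flow of εG_t is the time-σε map of that of G_t, and the factor ε of the
time derivative leaves the integral. -/
theorem pushHam_const_mul (hG : IsTimeDepHamiltonian E G) (ht : t ∈ Icc (0 : ℝ) 1) (ε : ℝ) (z : M) :
    pushHam Ω (fun t x => ε * G t x) H t (flow (hamField Ω (G t)) ε z) =
      H t z + ε * orbitAverage Ω G t ε z := by
  have hc := hG.isCompactHamiltonian ht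
  have h1 : ∀ s z, familyFlow Ω (fun t x => ε * G t x) (s, t, z) =
      flow (hamField Ω (G t)) (s * ε) z := fun s z => flow_const_mul Ω hc ε s z
  have h2 := pushHam_familyFlow Ω (H := H) (hG.const_mul ε) ht z
  simp only [h1, one_mul, timeDeriv_const_mul hG ht, intervalIntegral.integral_const_mul] at h2
  exact h2

theorem flow_neg_mem_maxset (hG : IsTimeDepHamiltonian E G) (ht : t ∈ Icc (0 : ℝ) 1) {ε : ℝ} {P : M}
    (hP : P ∈ maxset (pushHam Ω (fun t x => ε * G t x) H t)) :
    flow (hamField Ω (G t)) (-ε) P ∈ maxset fun x => H t x + ε * orbitAverage Ω G t ε x := by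
  intro x
  simp only [← pushHam_const_mul Ω hG ht]
  rw [← flow_add Ω (hG.isCompactHamiltonian ht), add_neg_cancel,
    flow_zero Ω (hG.isCompactHamiltonian ht)]
  exact hP _

theorem flow_neg_mem_minset (hG : IsTimeDepHamiltonian E G) (ht : t ∈ Icc (0 : ℝ) 1) {ε : ℝ} {P : M}
    (hP : P ∈ minset (pushHam Ω (fun t x => ε * G t x) H t)) :
    flow (hamField Ω (G t)) (-ε) P ∈ minset fun x => H t x + ε * orbitAverage Ω G t ε x := by
  intro x
  simp only [← pushHam_const_mul Ω hG ht]
  rw [← flow_add Ω (hG.isCompactHamiltonian ht), add_neg_cancel,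
    flow_zero Ω (hG.isCompactHamiltonian ht)]
  exact hP _

theorem totVar_pushHam (hG : IsTimeDepHamiltonian E G) (ht : t ∈ Icc (0 : ℝ) 1) {ε : ℝ} {p P : M}
    (hp : p ∈ minset (pushHam Ω (fun t x => ε * G t x) H t))
    (hP : P ∈ maxset (pushHam Ω (fun t x => ε * G t x) H t)) :
    totVar (pushHam Ω (fun t x => ε * G t x) H t) =
      totVar fun x => H t x + ε * orbitAverage Ω G t ε x := by
  rw [totVar_eq hP hp, totVar_eq (flow_neg_mem_maxset Ω hG ht hP) (flow_neg_mem_minset Ω hG ht hp)]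
  simp only [← pushHam_const_mul Ω hG ht]
  rw [← flow_add Ω (hG.isCompactHamiltonian ht), ← flow_add Ω (hG.isCompactHamiltonian ht),
    add_neg_cancel, flow_zero Ω (hG.isCompactHamiltonian ht),
    flow_zero Ω (hG.isCompactHamiltonian ht)]

theorem abs_orbitAverage_le {C : ℝ} (hC : ∀ x, |timeDeriv G t x| ≤ C) (ε : ℝ) (z : M) :
    |orbitAverage Ω G t ε z| ≤ C := by
  have h := intervalIntegral.norm_integral_le_of_norm_le_const (a := (0 : ℝ)) (b := 1) (C := C)
    (f := fun σ => timeDeriv G t (flow (hamField Ω (G t)) (σ * ε) z)) fun σ _ => hC _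
  rw [sub_zero, abs_one, mul_one] at h
  exact h

/-- After pulling back, the Hamiltonian differs from H_t by at most C|ε|. Compact support supplies
the extremal points, so the bound holds for every ε. -/
theorem abs_totVar_pushHam_sub_le [Nonempty M] (hG : IsTimeDepHamiltonian E G)
    (hH : IsTimeDepHamiltonian E H) (ht : t ∈ Icc (0 : ℝ) 1) {C : ℝ}
    (hC : ∀ x, |timeDeriv G t x| ≤ C) (ε : ℝ) :
    |totVar (pushHam Ω (fun t x => ε * G t x) H t) -
      totVar (pushHam Ω (fun t x => 0 * G t x) H t)| ≤ 2 * C * |ε| := by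
  have hK : ∀ ε, IsCompactHamiltonian (E := E) (pushHam Ω (fun t x => ε * G t x) H t) := fun ε =>
    (isTimeDepHamiltonian_pushHam Ω (hG.const_mul ε) hH).isCompactHamiltonian ht
  obtain ⟨P, hP⟩ := (hK ε).exists_mem_maxset
  obtain ⟨p, hp⟩ := (hK ε).exists_mem_minset
  obtain ⟨P', hP'⟩ := (hK 0).exists_mem_maxset
  obtain ⟨p', hp'⟩ := (hK 0).exists_mem_minset
  rw [totVar_pushHam Ω hG ht hp hP, totVar_pushHam Ω hG ht hp' hP', mul_assoc]
  refine abs_totVar_sub_le (flow_neg_mem_maxset Ω hG ht hP) (flow_neg_mem_minset Ω hG ht hp)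
    (flow_neg_mem_maxset Ω hG ht hP') (flow_neg_mem_minset Ω hG ht hp') fun z => ?_
  rw [zero_mul, add_zero, add_sub_cancel_left, abs_mul, mul_comm]
  exact mul_le_mul_of_nonneg_right (abs_orbitAverage_le Ω hC ε z) (abs_nonneg ε)

/-- Extremal points are transported back by the time -ε flow, and the envelope principle applies to
H_t + ε a_ε. It also shows that G'_t is constant on each extremal set, so the supremum and infimum
run over singletons. -/
theorem hasDerivAt_totVar_pushHam [FirstCountableTopology M] (hG : IsTimeDepHamiltonian E G)
    (ht : t ∈ Icc (0 : ℝ) 1) {p P : ℝ → M} (hpc : ContinuousAt p 0) (hPc : ContinuousAt P 0)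
    (hp : ∀ᶠ ε in 𝓝 0, p ε ∈ minset (pushHam Ω (fun t x => ε * G t x) H t))
    (hP : ∀ᶠ ε in 𝓝 0, P ε ∈ maxset (pushHam Ω (fun t x => ε * G t x) H t)) :
    HasDerivAt (fun ε => totVar (pushHam Ω (fun t x => ε * G t x) H t))
      (sSup (timeDeriv G t '' maxset (H t)) - sInf (timeDeriv G t '' minset (H t))) 0 := by
  have hcont : ∀ {P : ℝ → M}, ContinuousAt P 0 →
      ContinuousAt (fun ε => flow (hamField Ω (G t)) (-ε) (P ε)) 0 := fun hPc =>
    ContinuousAt.comp (g := fun q : ℝ × M => flow (hamField Ω (G t)) q.1 q.2)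
      (continuous_flow Ω hG ht).continuousAt (continuousAt_neg.prodMk hPc)
  have ha := continuous_orbitAverage Ω hG ht
  have hmax := hP.mono fun ε h => flow_neg_mem_maxset Ω hG ht h
  have hmin := hp.mono fun ε h => flow_neg_mem_minset Ω hG ht h
  set z : ℝ → M := fun ε => flow (hamField Ω (G t)) (-ε) (P ε)
  set w : ℝ → M := fun ε => flow (hamField Ω (G t)) (-ε) (p ε)
  have hz : z 0 ∈ maxset (H t) := by simpa only [zero_mul, add_zero] using hmax.self_of_nhds
  have hw : w 0 ∈ minset (H t) := by simpa only [zero_mul, add_zero] using hmin.self_of_nhds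
  have h1 : timeDeriv G t '' maxset (H t) = {timeDeriv G t (z 0)} := by
    refine eq_singleton_iff_unique_mem.2 ⟨mem_image_of_mem _ hz, ?_⟩
    rintro _ ⟨x, hx, rfl⟩
    have := (hasDerivAt_of_maximizers ha (hcont hPc) hmax hx).1
    rwa [orbitAverage_zero Ω hG ht, orbitAverage_zero Ω hG ht] at this
  have h2 : timeDeriv G t '' minset (H t) = {timeDeriv G t (w 0)} := by
    refine eq_singleton_iff_unique_mem.2 ⟨mem_image_of_mem _ hw, ?_⟩
    rintro _ ⟨x, hx, rfl⟩
    have := (hasDerivAt_of_minimizers ha (hcont hpc) hmin hx).1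
    rwa [orbitAverage_zero Ω hG ht, orbitAverage_zero Ω hG ht] at this
  have h3 := ((hasDerivAt_of_maximizers ha (hcont hPc) hmax hz).2).sub
    ((hasDerivAt_of_minimizers ha (hcont hpc) hmin hw).2)
  rw [h1, h2, csSup_singleton, csInf_singleton, ← orbitAverage_zero Ω hG ht,
    ← orbitAverage_zero Ω hG ht]
  refine h3.congr_of_eventuallyEq ?_
  filter_upwards [hP, hp] with ε hPε hpε
  exact (totVar_pushHam Ω hG ht hpε hPε).trans (totVar_eq
    (flow_neg_mem_maxset Ω hG ht hPε) (flow_neg_mem_minset Ω hG ht hpε))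

variable {Ω}

/-- All generating Hamiltonians of the variation have the same extrema. -/
theorem generatingHamiltonian_variation [ConnectedSpace M] (hφ : IsHamiltonianPath Ω φ)
    (hH : Generates Ω H φ) (hG : IsTangentField E G) (ε : ℝ) (ht : t ∈ Icc (0 : ℝ) 1) :
    ∃ c, ∀ x, generatingHamiltonian Ω (variation Ω G φ ε) t x =
      pushHam Ω (fun t x => ε * G t x) H t x + c := by
  have h := hH.variation hG.hamiltonian ε
  exact h.generates_generatingHamiltonian.exists_eq_add_const h ht ((hφ.variation hG ε).surjective ht)

end FirstVariation

end HoferVariation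

end

/-! ### The first variation formula -/

open HoferVariation

theorem mainTheorem8
    {E : Type*} [NormedAddCommGroup E] [NormedSpace ℝ E] [FiniteDimensional ℝ E]
    {M : Type*} [TopologicalSpace M] [ChartedSpace E M] [IsManifold 𝓘(ℝ, E) ∞ M]
    [T2Space M] [SecondCountableTopology M] [ConnectedSpace M]
    (Ω : HoferVariation.SymplecticForm E M)
    (φ : ℝ → M → M) (H : ℝ → M → ℝ)
    (hφ : HoferVariation.IsHamiltonianPath Ω φ)
    (hH : HoferVariation.Generates Ω H φ)
    (hcont : HoferVariation.HypothesisOfContinuity Ω φ)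
    (G : ℝ → M → ℝ) (hG : HoferVariation.IsTangentField E G) :
    (∀ ε : ℝ, HoferVariation.IsHamiltonianPath Ω (HoferVariation.variation Ω G φ ε) ∧
      IntervalIntegrable
        (fun t => HoferVariation.totVar (HoferVariation.generatingHamiltonian Ω
          (HoferVariation.variation Ω G φ ε) t)) MeasureTheory.volume 0 1) ∧
    IntervalIntegrable
      (fun t => sSup (HoferVariation.timeDeriv G t '' HoferVariation.maxset (H t)) -
        sInf (HoferVariation.timeDeriv G t '' HoferVariation.minset (H t)))
      MeasureTheory.volume 0 1 ∧
    HasDerivAt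
      (fun ε : ℝ => HoferVariation.hoferLength Ω (HoferVariation.variation Ω G φ ε))
      (∫ t in (0 : ℝ)..1,
        (sSup (HoferVariation.timeDeriv G t '' HoferVariation.maxset (H t)) -
          sInf (HoferVariation.timeDeriv G t '' HoferVariation.minset (H t)))) 0 := by

  have hne : Nonempty M := inferInstance
  have hint : ∀ ε, IntervalIntegrable
      (fun t => totVar (generatingHamiltonian Ω (variation Ω G φ ε) t)) MeasureTheory.volume 0 1 :=
    fun ε => by
      refine ContinuousOn.intervalIntegrable ?_
      rw [uIcc_of_le zero_le_one]
      exact (hH.variation hG.hamiltonian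
        ε).generates_generatingHamiltonian.hamiltonian.continuousOn_totVar
  have hconst : ∀ ε, ∀ t ∈ Icc (0 : ℝ) 1, ∃ c, ∀ x,
      generatingHamiltonian Ω (variation Ω G φ ε) t x =
        pushHam Ω (fun t x => ε * G t x) H t x + c := fun ε t ht =>
    generatingHamiltonian_variation hφ hH hG ε ht
  -- An additive constant does not affect the oscillation. The extrema come from compact support, so
  -- this holds for all ε, not only |ε| < ε₀.
  have htot : ∀ ε, ∀ t ∈ Icc (0 : ℝ) 1, totVar (generatingHamiltonian Ω (variation Ω G φ ε) t) =
      totVar (pushHam Ω (fun t x => ε * G t x) H t) := by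
    intro ε t ht
    obtain ⟨c, hc⟩ := hconst ε t ht
    have hK : IsCompactHamiltonian (E := E) (pushHam Ω (fun t x => ε * G t x) H t) :=
      (isTimeDepHamiltonian_pushHam Ω (hG.hamiltonian.const_mul ε)
        hH.hamiltonian).isCompactHamiltonian ht
    obtain ⟨P, hP⟩ := hK.exists_mem_maxset
    obtain ⟨p, hp⟩ := hK.exists_mem_minset
    rw [totVar_eq hP hp, totVar_eq (maxset_eq_of_add_const hc ▸ hP)
      (minset_eq_of_add_const hc ▸ hp), hc, hc]
    ring
  obtain ⟨ε₀, hε₀, p, P, hpP⟩ := hcont G hG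
  obtain ⟨C, hC⟩ := hG.hamiltonian.timeDeriv.exists_bound
  have hnhds : Ioo (-ε₀) ε₀ ∈ 𝓝 (0 : ℝ) := Ioo_mem_nhds (by linarith) hε₀
  have hderiv : ∀ t ∈ Icc (0 : ℝ) 1, HasDerivAt
      (fun ε => totVar (generatingHamiltonian Ω (variation Ω G φ ε) t))
      (sSup (timeDeriv G t '' maxset (H t)) - sInf (timeDeriv G t '' minset (H t))) 0 := by
    intro t ht
    obtain ⟨hps, hPs, hext⟩ := hpP t ht
    simp only [htot _ t ht]
    refine hasDerivAt_totVar_pushHam Ω hG.hamiltonian ht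
      ((hps.contMDiffAt hnhds).continuousAt) ((hPs.contMDiffAt hnhds).continuousAt) ?_ ?_
    · filter_upwards [hnhds] with ε hε
      obtain ⟨c, hc⟩ := hconst ε t ht
      exact minset_eq_of_add_const hc ▸ (hext ε hε).1
    · filter_upwards [hnhds] with ε hε
      obtain ⟨c, hc⟩ := hconst ε t ht
      exact maxset_eq_of_add_const hc ▸ (hext ε hε).2
  refine ⟨fun ε => ⟨hφ.variation hG ε, hint ε⟩, ?_⟩
  -- The factor 2 arises because the maximum and the minimum each move by at most C|ε|, where C
  -- bounds |G'_t| for all t in [0,1].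
  refine hasDerivAt_integral_of_lipschitz_at (C := 2 * C) hint (fun t ht ε => ?_) hderiv
  rw [htot ε t ht, htot 0 t ht]
  exact abs_totVar_pushHam_sub_le Ω hG.hamiltonian hH.hamiltonian ht (hC t ht) ε
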